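/- **Setting.** Manifolds are smooth, finite-dimensional, Hausdorff and second countable. Let $G\rightrightarrows M$ be a Lie groupoid over a manifold $M$, with source $s$, target $t$, units $1_x$ and inversion $i$; $G$ need not be Hausdorff, but its source fibres are. Let $A=\ker(ds)|_M$ be its Lie algebroid. For $\alpha\in\Gamma(A)$ let $\overrightarrow{\alpha}$ be the right-invariant vector field on $G$, $\overrightarrow{\alpha}_g=d(R_g)\,\alpha_{t(g)}$, and let $\overleftarrow{\alpha}=-i_*\overrightarrow{\alpha}$ be the left-invariant one. Let $\mathcal B$ be a singular subalgebroid of $A$, that is, an involutive, locally finitely generated $C^\infty(M)$-submodule of the compactly supported sections $\Gamma_c(A)$. Put $I_x=\{f\in C^\infty(M): f(x)=0\}$. A *bisubmersion* for $\mathcal B$ is a smooth map $\varphi\colon U\to G$ from a manifold $U$ such that (i) $s_U=s\circ\varphi$ and $t_U=t\circ\varphi$ are submersions; (ii) for every $\alpha\in\mathcal B$ there are smooth vector fields on $U$ that are $\varphi$-related to $\overrightarrow{\alpha}$ and to $\overleftarrow{\alpha}$, respectively; (iii) $\varphi^{-1}(\overrightarrow{\mathcal B})=\Gamma_c(U,\ker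 ds_U)$ and $\varphi^{-1}(\overleftarrow{\mathcal B})=\Gamma_c(U,\ker dt_U)$. Here $\varphi^{-1}(\overrightarrow{\mathcal B})$ is the set of smooth compactly supported vector fields $X$ on $U$ with $d\varphi(X)=\sum_j f_j\,(\overrightarrow{\alpha_j}\circ\varphi)$, a finite sum with $f_j\in C_c^\infty(U)$ and $\alpha_j\in\mathcal B$; similarly for $\overleftarrow{\mathcal B}$. A *morphism* from $(U_1,\varphi_1)$ to $(U_2,\varphi_2)$ is a smooth map $f\colon U_1\to U_2$ with $\varphi_2\circ f=\varphi_1$. A *bisection* of $U$ (respectively of $G$) is a submanifold that $s_U$ and $t_U$ (respectively $s$ and $t$) map diffeomorphically onto open subsets of $M$. For $u\in U$ and a bisection $\mathbf c$ of $G$ with $\varphi(u)\in\mathbf c$, we say that $u$ *carries* $\mathbf c$ if there is a bisection $\mathbf b$ of $U$ with $u\in\mathbf b$ such that $\varphi(\mathbf b)$ is an open subset of $\mathbf c$. The identity bisection of $G$ is $1_M=\{1_y: y\in M\}$. For $x\in M$ and $\alpha_1,\dots,\alpha_n\in\mathcal B$ whose classes form a basis of $\mathcal B/I_x\mathcal B$,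 the associated *minimal path holonomy bisubmersion* at $x$ is the map $\varphi_0\colon U_0\to G$, $\varphi_0(\lambda,y)=\exp_{1_y}\bigl(\sum_i\lambda_i\overrightarrow{\alpha_i}\bigr)$ (time-one flow), where $U_0$ is an open neighbourhood of $(0,x)$ in $\mathbb R^n\times M$ on which $t\circ\varphi_0$ is a submersion. **Statement.** 1. Let $x\in M$, let $\alpha_1,\dots,\alpha_n\in\mathcal B$ induce a basis of $\mathcal B/I_x\mathcal B$, and let $\varphi_0\colon U_0\to G$ be an associated minimal path holonomy bisubmersion. Let $(U,\varphi)$ be a bisubmersion for $\mathcal B$ and let $u\in U$ be a point with $\varphi(u)=1_x$ that carries the identity bisection $1_M$. Then there are an open neighbourhood $U'$ of $u$ in $U$ and a submersion $g\colon U'\to U_0$ with $\varphi_0\circ g=\varphi|_{U'}$ and $g(u)=(0,x)$. 2. Let $(U_1,\varphi_1)$ and $(U_2,\varphi_2)$ be bisubmersions for $\mathcal B$. - (a) If $u_1\in U_1$ and $u_2\in U_2$ satisfy $\varphi_1(u_1)=\varphi_2(u_2)$ and both carry $1_M$, then there are an open neighbourhood $U_1'$ of $u_1$ in $U_1$ and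 a morphism $f\colon U_1'\to U_2$ with $f(u_1)=u_2$. - (b) If $u_1\in U_1$ and $u_2\in U_2$ satisfy $\varphi_1(u_1)=\varphi_2(u_2)$ and carry a common bisection of $G$, then there are an open neighbourhood $U_1'$ of $u_1$ in $U_1$ and a morphism $f\colon U_1'\to U_2$ with $f(u_1)=u_2$. - (c) If $g\colon U_1\to U_2$ is a morphism with $g(u_1)=u_2$, then there are an open neighbourhood $U_2'$ of $u_2$ in $U_2$ and a morphism $f\colon U_2'\to U_1$ with $f(u_2)=u_1$. 3. For points $u_1\in U_1$, $u_2\in U_2$ of bisubmersions for $\mathcal B$, write $u_1\sim u_2$ if there are an open neighbourhood $U_1'$ of $u_1$ in $U_1$ and a morphism $f\colon U_1'\to U_2$ with $f(u_1)=u_2$. Then $\sim$ is an equivalence relation on the points of all bisubmersions for $\mathcal B$. -/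

import Mathlib

open scoped Manifold ContDiff

universe v

noncomputable section

namespace SingAlg

/-! ### Submersions, vector fields, sections of submersions -/

/-- `f` is a smooth submersion on the open set `W`: smooth, with surjective differential. -/
def IsSubmersionOn
    {E F N P : Type*} [NormedAddCommGroup E] [NormedSpace ℝ E] [NormedAddCommGroup F]
    [NormedSpace ℝ F] {H K : Type*} [TopologicalSpace H] [TopologicalSpace K]
    (I : ModelWithCorners ℝ E H) (J : ModelWithCorners ℝ F K)
    [TopologicalSpace N] [ChartedSpace H N] [TopologicalSpace P] [ChartedSpace K P]
    (f : N → P) (W : Set N) : Prop :=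
  ContMDiffOn I J ∞ f W ∧ ∀ u ∈ W, Function.Surjective (mfderiv I J f u)

/-- A smooth vector field on a manifold. -/
def IsSmoothField {E N : Type*} [NormedAddCommGroup E] [NormedSpace ℝ E]
    [TopologicalSpace N] [ChartedSpace E N] [IsManifold 𝓘(ℝ, E) ∞ N]
    (X : ∀ u : N, TangentSpace 𝓘(ℝ, E) u) : Prop :=
  ContMDiff 𝓘(ℝ, E) 𝓘(ℝ, E).tangent ∞ (fun u => (⟨u, X u⟩ : TangentBundle 𝓘(ℝ, E) N))

/-- A vector field vanishing outside a compact set. -/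
def IsCompactField {E N : Type*} [NormedAddCommGroup E] [NormedSpace ℝ E]
    [TopologicalSpace N] [ChartedSpace E N] (X : ∀ u : N, TangentSpace 𝓘(ℝ, E) u) : Prop :=
  IsCompact (closure {u | X u ≠ 0})

/-- `X` on `N` is `φ`-related to `Y` on `P`: `dφ (X u) = Y (φ u)` for all `u`. -/
def IsRelated {E F N P : Type*} [NormedAddCommGroup E] [NormedSpace ℝ E] [NormedAddCommGroup F]
    [NormedSpace ℝ F] [TopologicalSpace N] [ChartedSpace E N] [TopologicalSpace P]
    [ChartedSpace F P] (φ : N → P) (X : ∀ u : N, TangentSpace 𝓘(ℝ, E) u)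
    (Y : ∀ v : P, TangentSpace 𝓘(ℝ, F) v) : Prop :=
  ∀ u, mfderiv 𝓘(ℝ, E) 𝓘(ℝ, F) φ u (X u) = Y (φ u)

/-- `φ⁻¹(𝓕)` for a family `S` of vector fields generating `𝓕`: the smooth compactly supported
vector fields `X` on `N` with `dφ (X) = ∑ i, f i • (Y i ∘ φ)`, a finite sum with
`f i ∈ C_c^∞(N)` and `Y i ∈ S`. -/
def pullbackFields {E F N P : Type*} [NormedAddCommGroup E] [NormedSpace ℝ E]
    [NormedAddCommGroup F] [NormedSpace ℝ F] [TopologicalSpace N] [ChartedSpace E N]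
    [IsManifold 𝓘(ℝ, E) ∞ N] [TopologicalSpace P] [ChartedSpace F P] (φ : N → P)
    (S : Set (∀ v : P, TangentSpace 𝓘(ℝ, F) v)) : Set (∀ u : N, TangentSpace 𝓘(ℝ, E) u) :=
  {X | IsSmoothField X ∧ IsCompactField X ∧
    ∃ (k : ℕ) (f : Fin k → C^∞⟮𝓘(ℝ, E), N; ℝ⟯) (Y : Fin k → ∀ v : P, TangentSpace 𝓘(ℝ, F) v),
      (∀ i, HasCompactSupport (f i)) ∧ (∀ i, Y i ∈ S) ∧
      ∀ u, mfderiv 𝓘(ℝ, E) 𝓘(ℝ, F) φ u (X u) = ∑ i, f i u • Y i (φ u)}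

/-- `Γ_c(N, ker dp)`. -/
def verticalFields {E F N P : Type*} [NormedAddCommGroup E] [NormedSpace ℝ E]
    [NormedAddCommGroup F] [NormedSpace ℝ F] [TopologicalSpace N] [ChartedSpace E N]
    [IsManifold 𝓘(ℝ, E) ∞ N] [TopologicalSpace P] [ChartedSpace F P] (p : N → P) :
    Set (∀ u : N, TangentSpace 𝓘(ℝ, E) u) :=
  {X | IsSmoothField X ∧ IsCompactField X ∧ ∀ u, mfderiv 𝓘(ℝ, E) 𝓘(ℝ, F) p u (X u) = 0}

/-- `b` is the image of a smooth section of `p` over an open set `V`; that is, `b` is a submanifold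
of `N` which `p` maps diffeomorphically onto an open subset of `P`. -/
def IsSectionImage {E F N P : Type*} [NormedAddCommGroup E] [NormedSpace ℝ E]
    [NormedAddCommGroup F] [NormedSpace ℝ F] [TopologicalSpace N] [ChartedSpace E N]
    [TopologicalSpace P] [ChartedSpace F P] (p : N → P) (b : Set N) : Prop :=
  ∃ (V : Set P) (σ : P → N), IsOpen V ∧ ContMDiffOn 𝓘(ℝ, F) 𝓘(ℝ, E) ∞ σ V ∧
    (∀ y ∈ V, p (σ y) = y) ∧ b = σ '' V

/-- The time-one flow of the vector field `X` (junk value `g` if the maximal integral curve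
starting at `g` is not defined for all times). -/
def expAt {E N : Type*} [NormedAddCommGroup E] [NormedSpace ℝ E]
    [TopologicalSpace N] [ChartedSpace E N] (X : ∀ u : N, TangentSpace 𝓘(ℝ, E) u) (g : N) : N :=
  open Classical in
  if h : ∃ γ : ℝ → N, γ 0 = g ∧ IsMIntegralCurve (I := 𝓘(ℝ, E)) γ X then h.choose 1 else g

/-! ### Lie groupoids and their Lie algebroids -/

/-- A Lie groupoid `G ⇉ M`; `G` need not be Hausdorff, its source fibres are. Arrows `g`, `h` are
composable if `s g = t h`, and the values of `mul` on other pairs are irrelevant. The set of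
composable pairs is an embedded submanifold of `G × G`, and smoothness of the multiplication on it
is smoothness within that set. -/
structure LieGroupoid (EG EM G M : Type*) [NormedAddCommGroup EG] [NormedSpace ℝ EG]
    [NormedAddCommGroup EM] [NormedSpace ℝ EM] [TopologicalSpace G] [ChartedSpace EG G]
    [TopologicalSpace M] [ChartedSpace EM M] where
  s : G → M
  t : G → M
  one : M → G
  inv : G → G
  mul : G → G → G
  s_one : ∀ x, s (one x) = x
  t_one : ∀ x, t (one x) = x
  s_mul : ∀ g h, s g = t h → s (mul g h) = s h
  t_mul : ∀ g h, s g = t h → t (mul g h) = t g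
  mul_assoc : ∀ g h k, s g = t h → s h = t k → mul (mul g h) k = mul g (mul h k)
  one_mul : ∀ g, mul (one (t g)) g = g
  mul_one : ∀ g, mul g (one (s g)) = g
  s_inv : ∀ g, s (inv g) = t g
  t_inv : ∀ g, t (inv g) = s g
  inv_mul : ∀ g, mul (inv g) g = one (s g)
  mul_inv : ∀ g, mul g (inv g) = one (t g)
  submersion_s : IsSubmersionOn 𝓘(ℝ, EG) 𝓘(ℝ, EM) s Set.univ
  submersion_t : IsSubmersionOn 𝓘(ℝ, EG) 𝓘(ℝ, EM) t Set.univ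
  smooth_one : ContMDiff 𝓘(ℝ, EM) 𝓘(ℝ, EG) ∞ one
  smooth_inv : ContMDiff 𝓘(ℝ, EG) 𝓘(ℝ, EG) ∞ inv
  smooth_mul : ContMDiffOn (𝓘(ℝ, EG).prod 𝓘(ℝ, EG)) 𝓘(ℝ, EG) ∞ (fun p : G × G => mul p.1 p.2)
    {p | s p.1 = t p.2}
  hausdorff_fiber : ∀ x, T2Space {g : G // s g = x}

variable {EG EM G M : Type*} [NormedAddCommGroup EG] [NormedSpace ℝ EG]
    [NormedAddCommGroup EM] [NormedSpace ℝ EM] [TopologicalSpace G] [ChartedSpace EG G]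
    [TopologicalSpace M] [ChartedSpace EM M]

namespace LieGroupoid

/-- The ambient type of sections: a tangent vector of `G` at `1_x` for each `x`. The sections of the
Lie algebroid `A = ker (ds)|_M` are those satisfying `IsSection`. -/
def Sec (𝒢 : LieGroupoid EG EM G M) : Type _ := ∀ x : M, TangentSpace 𝓘(ℝ, EG) (𝒢.one x)

variable (𝒢 : LieGroupoid EG EM G M)

instance : AddCommGroup 𝒢.Sec :=
  inferInstanceAs (AddCommGroup (∀ x : M, TangentSpace 𝓘(ℝ, EG) (𝒢.one x)))

instance : Module ℝ 𝒢.Sec :=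
  inferInstanceAs (Module ℝ (∀ x : M, TangentSpace 𝓘(ℝ, EG) (𝒢.one x)))

/-- Pointwise multiplication of sections by smooth functions. -/
instance : Module C^∞⟮𝓘(ℝ, EM), M; ℝ⟯ 𝒢.Sec where
  smul f α := fun x => f x • α x
  one_smul α := funext fun x => one_smul ℝ (α x)
  mul_smul f g α := funext fun x => mul_smul (f x) (g x) (α x)
  smul_zero f := funext fun x => smul_zero (f x)
  smul_add f α β := funext fun x => smul_add (f x) (α x) (β x)
  add_smul f g α := funext fun x => add_smul (f x) (g x) (α x)
  zero_smul α := funext fun x => zero_smul ℝ (α x)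

instance : IsScalarTower ℝ C^∞⟮𝓘(ℝ, EM), M; ℝ⟯ 𝒢.Sec where
  smul_assoc c f α := funext fun x => smul_assoc c (f x) (α x)

variable {𝒢}

/-- The support of a section. -/
def Sec.supp (α : 𝒢.Sec) : Set M := closure {x | α x ≠ 0}

/-- `α` is a smooth section of `A = ker (ds)|_M`. -/
def Sec.IsSection [IsManifold 𝓘(ℝ, EG) ∞ G] (α : 𝒢.Sec) : Prop :=
  ContMDiff 𝓘(ℝ, EM) 𝓘(ℝ, EG).tangent ∞
      (fun x => (⟨𝒢.one x, α x⟩ : TangentBundle 𝓘(ℝ, EG) G)) ∧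
    ∀ x, mfderiv 𝓘(ℝ, EG) 𝓘(ℝ, EM) 𝒢.s (𝒢.one x) (α x) = 0

/-- The right-invariant vector field of `α`: its value at `g` is `d(R_g) (α (t g))`, where the right
translation `R_g : h ↦ h g` is defined on the source fibre `{h | s h = t g}`. On vectors tangent to
the fibre, the derivative within the fibre is the differential of `R_g`. -/
def Sec.right (α : 𝒢.Sec) (g : G) : TangentSpace 𝓘(ℝ, EG) g :=
  mfderivWithin 𝓘(ℝ, EG) 𝓘(ℝ, EG) (fun h => 𝒢.mul h g) {h | 𝒢.s h = 𝒢.t g} (𝒢.one (𝒢.t g))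
    (α (𝒢.t g))

/-- The left-invariant vector field of `α`, that is, minus the push-forward of the right-invariant
vector field of `α` under the inversion. -/
def Sec.left (α : 𝒢.Sec) (g : G) : TangentSpace 𝓘(ℝ, EG) g :=
  -(mfderiv 𝓘(ℝ, EG) 𝓘(ℝ, EG) 𝒢.inv (𝒢.inv g) (α.right (𝒢.inv g)))

/-- The bracket of the Lie algebroid `A`: the bracket of right-invariant vector fields, restricted
to the units. -/
def Sec.bracket (α β : 𝒢.Sec) : 𝒢.Sec :=
  fun x => VectorField.mlieBracket 𝓘(ℝ, EG) α.right β.right (𝒢.one x)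

end LieGroupoid

/-! ### Singular subalgebroids -/

/-- A singular subalgebroid of the Lie algebroid `A` of `𝒢`: an involutive, locally finitely
generated `C^∞(M)`-submodule of `Γ_c(A)`. -/
structure SingularSubalgebroid [IsManifold 𝓘(ℝ, EG) ∞ G] (𝒢 : LieGroupoid EG EM G M) where
  toSubmodule : Submodule C^∞⟮𝓘(ℝ, EM), M; ℝ⟯ 𝒢.Sec
  isSection : ∀ α ∈ toSubmodule, α.IsSection
  compact_supp : ∀ α ∈ toSubmodule, IsCompact α.supp
  bracket_mem : ∀ α ∈ toSubmodule, ∀ β ∈ toSubmodule, α.bracket β ∈ toSubmodule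
  /-- Every point has an open neighbourhood `W` with finitely many sections `Y j` over `W` (only
  their values on `W` matter) such that `f Y j ∈ 𝓑` for all `f ∈ C_c^∞(W)`, and such that the
  elements of `𝓑` supported in `W` are `C_c^∞(W)`-linear combinations of the `Y j`. -/
  locally_fg : ∀ x : M, ∃ (W : Set M) (k : ℕ) (Y : Fin k → 𝒢.Sec), IsOpen W ∧ x ∈ W ∧
    (∀ (j : Fin k) (f : C^∞⟮𝓘(ℝ, EM), M; ℝ⟯), HasCompactSupport f → tsupport f ⊆ W →
      f • Y j ∈ toSubmodule) ∧
    ∀ β ∈ toSubmodule, β.supp ⊆ W →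
      ∃ f : Fin k → C^∞⟮𝓘(ℝ, EM), M; ℝ⟯,
        (∀ j, HasCompactSupport (f j) ∧ tsupport (f j) ⊆ W) ∧ β = ∑ j, f j • Y j

/-- The ideal `I_x` of smooth functions on `M` vanishing at `x`. -/
def vanishingIdeal (EM : Type*) {M : Type*} [NormedAddCommGroup EM] [NormedSpace ℝ EM]
    [TopologicalSpace M] [ChartedSpace EM M] (x : M) : Ideal C^∞⟮𝓘(ℝ, EM), M; ℝ⟯ :=
  RingHom.ker (ContMDiffMap.evalRingHom x : C^∞⟮𝓘(ℝ, EM), M; ℝ⟯ →+* ℝ)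

variable [IsManifold 𝓘(ℝ, EG) ∞ G] {𝒢 : LieGroupoid EG EM G M}

namespace SingularSubalgebroid

variable (𝓑 : SingularSubalgebroid 𝒢)

/-- The quotient `𝓑 / I_x 𝓑`. -/
abbrev Fiber (x : M) : Type _ :=
  𝓑.toSubmodule ⧸ (vanishingIdeal EM x • (⊤ : Submodule C^∞⟮𝓘(ℝ, EM), M; ℝ⟯ 𝓑.toSubmodule))

/-- `α 1, …, α n ∈ 𝓑` is a minimal set of generators of `𝓑` around `x`: the classes of the `α i`
form a basis of the vector space `𝓑 / I_x 𝓑`. -/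
def IsMinimalGenerators (x : M) {n : ℕ} (α : Fin n → 𝓑.toSubmodule) : Prop :=
  LinearIndependent ℝ (fun i => (Submodule.Quotient.mk (α i) : 𝓑.Fiber x)) ∧
    Submodule.span ℝ (Set.range fun i => (Submodule.Quotient.mk (α i) : 𝓑.Fiber x)) = ⊤

/-- `(λ, y) ↦ exp_y (∑ i, λ i →α i)`. -/
def pathHolonomyMap {n : ℕ} (α : Fin n → 𝓑.toSubmodule) (p : EuclideanSpace ℝ (Fin n) × M) : G :=
  expAt (fun g => ∑ i, p.1 i • (α i : 𝒢.Sec).right g) (𝒢.one p.2)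

/-- `U₀` may serve as domain of the path holonomy bisubmersion of `α` at `x`: it is an open
neighbourhood of `(0, x)` in `ℝⁿ × M` on which `t ∘ φ₀` is a submersion. -/
def IsPathHolonomyDomain (x : M) {n : ℕ} (α : Fin n → 𝓑.toSubmodule)
    (U₀ : Set (EuclideanSpace ℝ (Fin n) × M)) : Prop :=
  IsOpen U₀ ∧ (0, x) ∈ U₀ ∧
    IsSubmersionOn (𝓘(ℝ, EuclideanSpace ℝ (Fin n)).prod 𝓘(ℝ, EM)) 𝓘(ℝ, EM)
      (fun p => 𝒢.t (𝓑.pathHolonomyMap α p)) U₀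

/-- The family `{→α | α ∈ 𝓑}`, generating the singular foliation `→𝓑` on `G`. -/
def rightFields : Set (∀ g : G, TangentSpace 𝓘(ℝ, EG) g) := {Y | ∃ α ∈ 𝓑.toSubmodule, Y = α.right}

/-- The family `{←α | α ∈ 𝓑}`, generating the singular foliation `←𝓑` on `G`. -/
def leftFields : Set (∀ g : G, TangentSpace 𝓘(ℝ, EG) g) := {Y | ∃ α ∈ 𝓑.toSubmodule, Y = α.left}

end SingularSubalgebroid

/-! ### Bisubmersions -/

/-- `φ : U → G` is a bisubmersion for `𝓑`. -/
structure IsBisubmersion (𝓑 : SingularSubalgebroid 𝒢) {E U : Type*} [NormedAddCommGroup E]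
    [NormedSpace ℝ E] [TopologicalSpace U] [ChartedSpace E U] [IsManifold 𝓘(ℝ, E) ∞ U]
    (φ : U → G) : Prop where
  smooth : ContMDiff 𝓘(ℝ, E) 𝓘(ℝ, EG) ∞ φ
  submersion_s : IsSubmersionOn 𝓘(ℝ, E) 𝓘(ℝ, EM) (fun u => 𝒢.s (φ u)) Set.univ
  submersion_t : IsSubmersionOn 𝓘(ℝ, E) 𝓘(ℝ, EM) (fun u => 𝒢.t (φ u)) Set.univ
  lift_right : ∀ α ∈ 𝓑.toSubmodule, ∃ Z : ∀ u : U, TangentSpace 𝓘(ℝ, E) u,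
    IsSmoothField Z ∧ IsRelated φ Z α.right
  lift_left : ∀ α ∈ 𝓑.toSubmodule, ∃ Z : ∀ u : U, TangentSpace 𝓘(ℝ, E) u,
    IsSmoothField Z ∧ IsRelated φ Z α.left
  pullback_right : pullbackFields φ 𝓑.rightFields =
    verticalFields (E := E) (F := EM) (fun u => 𝒢.s (φ u))
  pullback_left : pullbackFields φ 𝓑.leftFields =
    verticalFields (E := E) (F := EM) (fun u => 𝒢.t (φ u))

/-- A bisubmersion `(U, φ, G)` for `𝓑`, with its manifold `U`. -/
structure Bisubmersion (𝓑 : SingularSubalgebroid 𝒢) where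
  dim : ℕ
  carrier : Type v
  [topologicalSpace : TopologicalSpace carrier]
  [chartedSpace : ChartedSpace (EuclideanSpace ℝ (Fin dim)) carrier]
  [isManifold : IsManifold 𝓘(ℝ, EuclideanSpace ℝ (Fin dim)) ∞ carrier]
  [t2Space : T2Space carrier]
  [secondCountable : SecondCountableTopology carrier]
  φ : carrier → G
  isBisubmersion : IsBisubmersion 𝓑 (E := EuclideanSpace ℝ (Fin dim)) φ

namespace Bisubmersion

variable {𝓑 : SingularSubalgebroid 𝒢}

attribute [instance] topologicalSpace chartedSpace isManifold t2Space secondCountable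

/-- The model space of the manifold of a bisubmersion. -/
abbrev model (U : Bisubmersion 𝓑) : Type := EuclideanSpace ℝ (Fin U.dim)

/-- `s_U = s ∘ φ`. -/
def source (U : Bisubmersion 𝓑) (u : U.carrier) : M := 𝒢.s (U.φ u)

/-- `t_U = t ∘ φ`. -/
def target (U : Bisubmersion 𝓑) (u : U.carrier) : M := 𝒢.t (U.φ u)

/-- A bisection of `U`: a submanifold which `s_U` and `t_U` map diffeomorphically onto open subsets
of `M`. -/
def IsBisection (U : Bisubmersion 𝓑) (b : Set U.carrier) : Prop :=
  IsSectionImage (E := U.model) (F := EM) U.source b ∧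
    IsSectionImage (E := U.model) (F := EM) U.target b

end Bisubmersion

/-- A (local) bisection of the Lie groupoid. -/
def LieGroupoid.IsBisection (𝒢 : LieGroupoid EG EM G M) (c : Set G) : Prop :=
  IsSectionImage (E := EG) (F := EM) 𝒢.s c ∧ IsSectionImage (E := EG) (F := EM) 𝒢.t c

namespace Bisubmersion

variable {𝓑 : SingularSubalgebroid 𝒢}

/-- The bisection `c` of `G` through `φ u` is carried by `U` at `u`: there is a bisection `b` of `U`
through `u` such that `φ(b)` is an open subset of `c`. -/
def Carries (U : Bisubmersion 𝓑) (u : U.carrier) (c : Set G) : Prop :=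
  𝒢.IsBisection c ∧ U.φ u ∈ c ∧
    ∃ b : Set U.carrier, U.IsBisection b ∧ u ∈ b ∧ ∃ O : Set G, IsOpen O ∧ U.φ '' b = O ∩ c

/-- `f`, restricted to the open subset `W` of `U₁`, is a morphism of bisubmersions `W → U₂`. -/
def IsMorphismOn (U₁ U₂ : Bisubmersion 𝓑) (W : Set U₁.carrier) (f : U₁.carrier → U₂.carrier) :
    Prop :=
  ContMDiffOn 𝓘(ℝ, U₁.model) 𝓘(ℝ, U₂.model) ∞ f W ∧ ∀ u ∈ W, U₂.φ (f u) = U₁.φ u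

/-- There is a morphism of bisubmersions from an open neighbourhood of `u₁` in `U₁` to `U₂` that
sends `u₁` to `u₂`. -/
def LocalMorphism (U₁ U₂ : Bisubmersion 𝓑) (u₁ : U₁.carrier) (u₂ : U₂.carrier) : Prop :=
  ∃ (W : Set U₁.carrier) (f : U₁.carrier → U₂.carrier),
    IsOpen W ∧ u₁ ∈ W ∧ IsMorphismOn U₁ U₂ W f ∧ f u₁ = u₂

end Bisubmersion

end SingAlg

end

/-!
Local morphisms between bisubmersions come from flows. Let `φ : U → G` be a bisubmersion for `𝓑`,
let `β` be a section of `t ∘ φ` through a point `u`, defined near `x = t (φ u)`, and let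
`α 1, …, α n ∈ 𝓑` generate `𝓑` near `x`. Two constructions carry the proof.

* *Lifting* (`IsBisubmersion.exists_expAt_lift`). The fields `→α j` have `φ`-related lifts `Z j`
  to `U`. As `φ` maps integral curves of `∑ λ j Z j` to integral curves of `∑ λ j →α j`, the map
  `(λ, y) ↦ exp_{φ (β y)} (∑ λ j →α j)` is `φ ∘ F` for a smooth map `F` into `U` with
  `F (0, x) = u`.
* *Factorization* (`IsBisubmersion.exists_expAt_factorization`). Let `β` also be transversal to
  the fibres of `s ∘ φ`. The vertical fields of `s ∘ φ` are spanned by finitely many compactly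
  supported ones `W a`, whose images under `dφ` are combinations of the `→α j`; subtracting the
  same combinations of the `Z j` gives fields `W' a` in the kernel of `dφ`. By transversality, the
  time-one flow of `∑ λ j Z j + ∑ μ a W' a` starting at `β y` is a submersion in `(λ, μ, y)` at
  `(0, 0, x)`. A right inverse of it, followed by `(λ, μ, y) ↦ (λ, y)`, is a smooth map `g` with
  `g u = (0, x)` through which `φ` factors: `exp_{φ (β y)} (∑ λ j →α j) = φ w` for `(λ, y) = g w`.

If `φ₁ ∘ β₁ = φ₂ ∘ β₂`, the composition of the factorization in `U₁` and the lift to `U₂` is a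
local morphism (`Bisubmersion.localMorphism_of_sections`). If both points carry a common bisection
of `G`, the bisections of `U₁` and `U₂` over it provide such sections. If `f` is a local morphism
from `U₁` to `U₂`, then `β₁` and `f ∘ β₁` are such sections, for any bisection `β₁`, so that local
morphisms can be reversed. Over the identity bisection, the factorization is a map into the path
holonomy bisubmersion.

For minimal generators the factoring map `g` is a submersion, because the lifts `Z j` are
independent at `u` modulo fields in the kernel of `dφ` (`IsBisubmersion.eq_zero_of_sum_lift_eq`):
a vertical field vanishing at `u` is a combination of the `W a` with coefficients vanishing at
`u`, so a dependence would give, along `β`, a relation showing that a combination of the `α j`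
lies in `I_x 𝓑`. That the `α j` generate `𝓑` near `x` is Nakayama's lemma
(`IsMinimalGenerators.generatesAt`).

The flows are those of Banach-space calculus: the integral equation is solved by the inverse
function theorem in a space of continuous curves, which gives smooth dependence on parameters
(`exists_smooth_flow`). On `G` the fields `→α` are complete and have unique integral curves
although `G` may fail to be Hausdorff, since the curves stay in source fibres and right
translation makes their time of existence uniform; hence `exp` is computed by any integral curve
(`Sec.IsSection.expAt_eq`).
-/

set_option linter.unusedSectionVars false

namespace SingAlg

open Set Filter Topology

/-! ### Calculus in Banach spaces: smooth local inverses and flows depending on parameters -/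

/-- The inverse function theorem for maps that are smooth near a point, with smoothness of the
inverse near the image point. -/
theorem exists_smooth_local_inverse {E F : Type*} [NormedAddCommGroup E] [NormedSpace ℝ E]
    [NormedAddCommGroup F] [NormedSpace ℝ F] [CompleteSpace E] {f : E → F} {a : E}
    (hf : ∀ᶠ x in 𝓝 a, ContDiffAt ℝ ∞ f x) (f' : E ≃L[ℝ] F)
    (hf' : HasFDerivAt f (f' : E →L[ℝ] F) a) :
    ∃ g : F → E, g (f a) = a ∧ (∀ᶠ y in 𝓝 (f a), ContDiffAt ℝ ∞ g y) ∧
      (∀ᶠ y in 𝓝 (f a), f (g y) = y) ∧ ∀ᶠ x in 𝓝 a, g (f x) = x := by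
  have hfa := hf.self_of_nhds
  set Φ := hfa.toOpenPartialHomeomorph f hf' (by simp) with hΦ
  have hΦc : (Φ : E → F) = f := rfl
  have haS : a ∈ Φ.source := hfa.mem_toOpenPartialHomeomorph_source hf' (by simp)
  have haT : f a ∈ Φ.target := hfa.image_mem_toOpenPartialHomeomorph_target hf' (by simp)
  have hga : Φ.symm (f a) = a := Φ.left_inv haS
  have hinv : ∀ᶠ x in 𝓝 a, ∃ e : E ≃L[ℝ] F, (e : E →L[ℝ] F) = fderiv ℝ f x := by
    have hc : ContinuousAt (fderiv ℝ f) a :=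
      (hfa.fderiv_right (m := 0) (by simp)).continuousAt
    have := f'.nhds
    rw [← hf'.fderiv] at this
    exact hc.eventually this
  refine ⟨Φ.symm, hga, ?_, ?_, ?_⟩
  · have hcont : ContinuousAt Φ.symm (f a) := Φ.continuousAt_symm haT
    have h1 : ∀ᶠ y in 𝓝 (f a), ContDiffAt ℝ ∞ f (Φ.symm y) ∧
        ∃ e : E ≃L[ℝ] F, (e : E →L[ℝ] F) = fderiv ℝ f (Φ.symm y) := by
      have := hf.and hinv
      rw [← hga] at this
      exact hcont.eventually this
    filter_upwards [h1, Φ.open_target.mem_nhds haT] with y ⟨hy, e, he⟩ hyT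
    refine Φ.contDiffAt_symm hyT (f₀' := e) ?_ hy
    rw [he]
    exact (hy.differentiableAt (by simp)).hasFDerivAt
  · filter_upwards [Φ.open_target.mem_nhds haT] with y hy using Φ.right_inv hy
  · filter_upwards [Φ.open_source.mem_nhds haS] with y hy using Φ.left_inv hy

section Nemytskii

variable {K : Type*} [TopologicalSpace K] [CompactSpace K]

/-- Pointwise application of a family of operators to a family of vectors, as a bounded bilinear
map. -/
noncomputable def applyFamily (K E F : Type*) [TopologicalSpace K] [CompactSpace K]
    [NormedAddCommGroup E] [NormedSpace ℝ E] [NormedAddCommGroup F] [NormedSpace ℝ F] :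
    C(K, E →L[ℝ] F) →L[ℝ] C(K, E) →L[ℝ] C(K, F) :=
  LinearMap.mkContinuous₂
    (LinearMap.mk₂ ℝ (fun (A : C(K, E →L[ℝ] F)) (d : C(K, E)) =>
      (⟨fun k => A k (d k), by fun_prop⟩ : C(K, F)))
      (fun A B d => by ext k; simp) (fun c A d => by ext k; simp)
      (fun A d d' => by ext k; simp) (fun c A d => by ext k; simp)) 1
    (fun A d => by
      rw [one_mul]
      refine (ContinuousMap.norm_le _ (mul_nonneg (norm_nonneg A) (norm_nonneg d))).2 fun k => ?_
      exact ((A k).le_opNorm _).trans (mul_le_mul (A.norm_coe_le_norm k) (d.norm_coe_le_norm k)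
        (norm_nonneg _) (norm_nonneg _)))

/-- Composition with a `C^1` map is differentiable on continuous functions over a compact space. -/
theorem hasFDerivAt_comp_continuousMap {E F : Type*}
    [NormedAddCommGroup E] [NormedSpace ℝ E] [NormedAddCommGroup F] [NormedSpace ℝ F]
    (f : C(E, F)) (f' : C(E, E →L[ℝ] F)) (hf : ∀ x, HasFDerivAt f (f' x) x) (γ : C(K, E)) :
    HasFDerivAt (fun γ : C(K, E) => f.comp γ) (applyFamily K E F (f'.comp γ)) γ := by
  rw [hasFDerivAt_iff_isLittleO, Asymptotics.isLittleO_iff]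
  intro ε hε
  have hc : Continuous (fun γ : C(K, E) => f'.comp γ) := ContinuousMap.continuous_postcomp f'
  obtain ⟨η, hη, hball⟩ := (Metric.continuousAt_iff (f := fun γ : C(K, E) => f'.comp γ) (a := γ)).1
    hc.continuousAt ε hε
  filter_upwards [Metric.ball_mem_nhds γ hη] with δ hδ
  rw [ContinuousMap.norm_le _ (by positivity)]
  intro k
  have hδ' : ‖δ - γ‖ < η := by rwa [← dist_eq_norm]
  have hseg : ∀ x ∈ segment ℝ (γ k) (δ k), ‖f' x - f' (γ k)‖ ≤ ε := by
    intro x hx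
    rw [segment_eq_image'] at hx
    obtain ⟨θ, hθ, rfl⟩ := hx
    have := hball (x := γ + θ • (δ - γ)) (by
      rw [dist_eq_norm, add_sub_cancel_left, norm_smul]
      calc ‖θ‖ * ‖δ - γ‖ ≤ 1 * ‖δ - γ‖ := by
            gcongr; rw [Real.norm_eq_abs, abs_of_nonneg hθ.1]; exact hθ.2
        _ < η := by rwa [one_mul])
    have h2 := (ContinuousMap.dist_apply_le_dist k).trans this.le
    rw [dist_eq_norm] at h2
    simpa using h2
  have := Convex.norm_image_sub_le_of_norm_hasFDerivWithin_le' (f := f) (f' := f')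
    (φ := f' (γ k)) (fun x _ => (hf x).hasFDerivWithinAt) hseg (convex_segment _ _)
    (left_mem_segment ℝ _ _) (right_mem_segment ℝ _ _)
  calc _ ≤ ε * ‖δ k - γ k‖ := this
    _ ≤ ε * ‖δ - γ‖ := by
      gcongr
      exact (δ - γ).norm_coe_le_norm k

/-- Composition with a smooth map is a smooth operation on continuous functions over a compact
space. -/
theorem contDiff_comp_continuousMap {E F : Type v} [NormedAddCommGroup E] [NormedSpace ℝ E]
    [NormedAddCommGroup F] [NormedSpace ℝ F] (f : C(E, F)) (hf : ContDiff ℝ ∞ f) :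
    ContDiff ℝ ∞ (fun γ : C(K, E) => f.comp γ) := by
  rw [contDiff_infty]
  intro n
  induction n generalizing F with
  | zero =>
    rw [Nat.cast_zero, contDiff_zero]
    exact ContinuousMap.continuous_postcomp f
  | succ n ih =>
    have hf1 : ContDiff ℝ ∞ (fderiv ℝ f) := hf.fderiv_right (by simp)
    let f' : C(E, E →L[ℝ] F) := ⟨fderiv ℝ f, hf1.continuous⟩
    have hd := hasFDerivAt_comp_continuousMap (K := K) f f'
      (fun x => (hf.differentiable (by simp) x).hasFDerivAt)
    rw [Nat.cast_succ, contDiff_succ_iff_hasFDerivAt]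
    have hA : ContDiff ℝ n (fun A : C(K, E →L[ℝ] F) => applyFamily K E F A) := by
      exact ContinuousLinearMap.contDiff (𝕜 := ℝ) (n := n) (E := C(K, E →L[ℝ] F))
        (F := C(K, E) →L[ℝ] C(K, F)) (applyFamily K E F)
    exact ⟨fun γ => applyFamily K E F (f'.comp γ), hA.comp (ih f' hf1), hd⟩

end Nemytskii

section Flow

/-- The primitive `τ ↦ ∫₀^τ γ` of a continuous function on `[-1, 2]`, as a bounded operator. -/
noncomputable def primitiveCLM (E : Type*) [NormedAddCommGroup E] [NormedSpace ℝ E] :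
    C(Icc (-1 : ℝ) 2, E) →L[ℝ] C(Icc (-1 : ℝ) 2, E) :=
  LinearMap.mkContinuous
    { toFun := fun γ => ⟨fun τ => ∫ s in (0 : ℝ)..τ, IccExtend (by norm_num : (-1 : ℝ) ≤ 2) γ s, by
        have hc : Continuous (IccExtend (by norm_num : (-1 : ℝ) ≤ 2) γ) := γ.continuous.Icc_extend'
        exact (intervalIntegral.continuous_primitive (fun a b => hc.intervalIntegrable a b) 0).comp
          continuous_subtype_val⟩
      map_add' := fun γ δ => by
        ext τ
        have hγ : Continuous (IccExtend (by norm_num : (-1 : ℝ) ≤ 2) γ) := γ.continuous.Icc_extend'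
        have hδ : Continuous (IccExtend (by norm_num : (-1 : ℝ) ≤ 2) δ) := δ.continuous.Icc_extend'
        exact intervalIntegral.integral_add (hγ.intervalIntegrable 0 τ) (hδ.intervalIntegrable 0 τ)
      map_smul' := fun r γ => by
        ext τ
        exact intervalIntegral.integral_smul r _ } 2
    (fun γ => by
      refine (ContinuousMap.norm_le _ (by positivity)).2 fun τ => ?_
      have h := intervalIntegral.norm_integral_le_of_norm_le_const
        (f := IccExtend (by norm_num : (-1 : ℝ) ≤ 2) γ) (a := 0) (b := τ) (C := ‖γ‖)
        (fun s _ => γ.norm_coe_le_norm _)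
      refine h.trans ?_
      rw [mul_comm]
      refine mul_le_mul_of_nonneg_right ?_ (norm_nonneg _)
      rw [sub_zero, abs_le]
      exact ⟨by linarith [τ.2.1], τ.2.2⟩)

theorem primitiveCLM_apply {E : Type*} [NormedAddCommGroup E] [NormedSpace ℝ E]
    (γ : C(Icc (-1 : ℝ) 2, E)) (τ : Icc (-1 : ℝ) 2) :
    primitiveCLM E γ τ = ∫ s in (0 : ℝ)..τ, IccExtend (by norm_num : (-1 : ℝ) ≤ 2) γ s := rfl

/-- Smooth dependence of solutions of `c' = ∑ j, λ j • v j (c)` on the parameter `λ` near `0` and on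
the initial value. The implicit function theorem is applied to the integral equation in the Banach
space of continuous curves; at `λ = 0` the linearized equation is trivial. -/
theorem exists_smooth_flow {ι : Type*} {E : Type v} [Fintype ι] [NormedAddCommGroup E]
    [NormedSpace ℝ E] [CompleteSpace E] (v : ι → E → E) (hv : ∀ j, ContDiff ℝ ∞ (v j)) (p : E)
    {O : Set E} (hO : O ∈ 𝓝 p) :
    ∃ h : (ι → ℝ) × E → E, (∀ᶠ q in 𝓝 ((0 : ι → ℝ), p), ContDiffAt ℝ ∞ h q) ∧ h (0, p) = p ∧
      HasFDerivAt h (ContinuousLinearMap.snd ℝ (ι → ℝ) E +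
        ∑ j, (((ContinuousLinearMap.proj j : (ι → ℝ) →L[ℝ] ℝ).comp
          (ContinuousLinearMap.fst ℝ (ι → ℝ) E)).smulRight (v j p))) (0, p) ∧
      ∀ᶠ q in 𝓝 ((0 : ι → ℝ), p), ∃ c : ℝ → E, c 0 = q.2 ∧ c 1 = h q ∧
        ∀ τ ∈ Ioo (-1 : ℝ) 2, c τ ∈ O ∧ HasDerivAt c (∑ j, q.1 j • v j (c τ)) τ := by
  let K := Icc (-1 : ℝ) 2
  let one' : K := ⟨1, by norm_num, by norm_num⟩
  let X := C(K, E)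
  let N : ι → X → X := fun j γ => (⟨v j, (hv j).continuous⟩ : C(E, E)).comp γ
  have hN : ∀ j, ContDiff ℝ ∞ (N j) := fun j =>
    contDiff_comp_continuousMap (K := K) ⟨v j, (hv j).continuous⟩ (hv j)
  let cst : E →L[ℝ] X := LinearMap.mkContinuous
    { toFun := fun w => ContinuousMap.const K w, map_add' := fun _ _ => rfl,
      map_smul' := fun _ _ => rfl } 1 (fun w => by
        rw [one_mul]
        exact (ContinuousMap.norm_le _ (norm_nonneg w)).2 fun τ => le_rfl)
  let ev : X →L[ℝ] E := LinearMap.mkContinuous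
    { toFun := fun γ => γ one', map_add' := fun _ _ => rfl,
      map_smul' := fun _ _ => rfl } 1 (fun γ => by
        rw [one_mul]
        exact γ.norm_coe_le_norm one')
  let Q := (ι → ℝ) × E
  let A : Q × X → X := fun z => cst z.1.2 + ∑ j, z.1.1 j • primitiveCLM E (N j z.2)
  have hP : ContDiff ℝ ∞ (fun γ : X => primitiveCLM E γ) :=
    ContinuousLinearMap.contDiff (𝕜 := ℝ) (E := X) (F := X) (primitiveCLM E)
  have hA : ContDiff ℝ ∞ A := by
    have h1 : ContDiff ℝ ∞ (fun z : Q × X => cst z.1.2) := cst.contDiff.comp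
      (contDiff_snd.comp contDiff_fst)
    have h2 : ∀ j, ContDiff ℝ ∞ (fun z : Q × X => z.1.1 j • primitiveCLM E (N j z.2)) := by
      intro j
      have h3 : ContDiff ℝ ∞ (fun z : Q × X => z.1.1 j) :=
        (contDiff_apply ℝ ℝ j).comp (contDiff_fst.comp contDiff_fst)
      exact h3.smul (hP.comp ((hN j).comp contDiff_snd))
    exact h1.add (ContDiff.sum fun j _ => h2 j)
  let q₀ : Q := (0, p)
  let γ₀ : X := cst p
  have hA0 : A (q₀, γ₀) = γ₀ := by simp [A, q₀, γ₀]
  let ℓ : Q →L[ℝ] X := cst.comp (ContinuousLinearMap.snd ℝ (ι → ℝ) E) +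
    ∑ j, ((ContinuousLinearMap.proj j : (ι → ℝ) →L[ℝ] ℝ).comp
      (ContinuousLinearMap.fst ℝ (ι → ℝ) E)).smulRight (primitiveCLM E (N j γ₀))
  -- at `λ = 0` the integral term contributes only through the derivative in `λ`
  have hA' : HasFDerivAt A (ℓ.comp (ContinuousLinearMap.fst ℝ Q X)) (q₀, γ₀) := by
    have h1 : HasFDerivAt (fun z : Q × X => cst z.1.2)
        ((cst.comp (ContinuousLinearMap.snd ℝ (ι → ℝ) E)).comp (ContinuousLinearMap.fst ℝ Q X))
        (q₀, γ₀) :=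
      ((cst.comp (ContinuousLinearMap.snd ℝ (ι → ℝ) E)).comp
        (ContinuousLinearMap.fst ℝ Q X)).hasFDerivAt
    have h2 : ∀ j, HasFDerivAt (fun z : Q × X => z.1.1 j • primitiveCLM E (N j z.2))
        ((((ContinuousLinearMap.proj j : (ι → ℝ) →L[ℝ] ℝ).comp
          (ContinuousLinearMap.fst ℝ (ι → ℝ) E)).smulRight (primitiveCLM E (N j γ₀))).comp
          (ContinuousLinearMap.fst ℝ Q X)) (q₀, γ₀) := by
      intro j
      have h3 : HasFDerivAt (fun z : Q × X => z.1.1 j)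
          (((ContinuousLinearMap.proj j : (ι → ℝ) →L[ℝ] ℝ).comp
          (ContinuousLinearMap.fst ℝ (ι → ℝ) E)).comp (ContinuousLinearMap.fst ℝ Q X))
          (q₀, γ₀) := (((ContinuousLinearMap.proj j : (ι → ℝ) →L[ℝ] ℝ).comp
          (ContinuousLinearMap.fst ℝ (ι → ℝ) E)).comp
          (ContinuousLinearMap.fst ℝ Q X)).hasFDerivAt
      have h4 : DifferentiableAt ℝ (fun z : Q × X => primitiveCLM E (N j z.2)) (q₀, γ₀) :=
        ((hP.comp ((hN j).comp contDiff_snd)).differentiable (by simp)) _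
      have h5 := h3.smul h4.hasFDerivAt
      convert! h5 using 1
      refine ContinuousLinearMap.ext fun z => ?_
      simp [q₀]
    have h6 := h1.add (HasFDerivAt.fun_sum fun j (_ : j ∈ Finset.univ) => h2 j)
    convert! h6 using 1
    refine ContinuousLinearMap.ext fun z => ?_
    simp only [ℓ, ContinuousLinearMap.add_comp, add_apply,
      ContinuousLinearMap.comp_apply, sum_apply]
  let Θ : Q × X → Q × X := fun z => (z.1, z.2 - A z)
  have hΘ : ContDiff ℝ ∞ Θ := contDiff_fst.prodMk (contDiff_snd.sub hA)
  let Θ' : (Q × X) ≃L[ℝ] (Q × X) := ContinuousLinearEquiv.equivOfInverse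
    ((ContinuousLinearMap.fst ℝ Q X).prod
      (ContinuousLinearMap.snd ℝ Q X - ℓ.comp (ContinuousLinearMap.fst ℝ Q X)))
    ((ContinuousLinearMap.fst ℝ Q X).prod
      (ContinuousLinearMap.snd ℝ Q X + ℓ.comp (ContinuousLinearMap.fst ℝ Q X)))
    (fun z => by ext1 <;> simp) (fun z => by ext1 <;> simp)
  have hΘ' : HasFDerivAt Θ (Θ' : (Q × X) →L[ℝ] (Q × X)) (q₀, γ₀) :=
    (hasFDerivAt_fst).prodMk (hasFDerivAt_snd.sub hA')
  obtain ⟨g, hg0, hgs, hfg, -⟩ := exists_smooth_local_inverse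
    (Eventually.of_forall fun z => hΘ.contDiffAt) Θ' hΘ'
  have hΘ0 : Θ (q₀, γ₀) = (q₀, 0) := by simp [Θ, hA0]
  rw [hΘ0] at hg0 hgs hfg
  let Γ : Q → X := fun q => (g (q, 0)).2
  have hin : Continuous (fun q : Q => (q, (0 : X))) := by fun_prop
  have hΓs : ∀ᶠ q in 𝓝 q₀, ContDiffAt ℝ ∞ Γ q := by
    filter_upwards [hin.continuousAt.eventually hgs] with q hq
    exact contDiffAt_snd.comp q (hq.comp q (contDiffAt_id.prodMk contDiffAt_const))
  have hΓ0 : Γ q₀ = γ₀ := by simp [Γ, hg0]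
  have hΓeq : ∀ᶠ q in 𝓝 q₀, Γ q = A (q, Γ q) := by
    filter_upwards [hin.continuousAt.eventually hfg] with q hq
    have h1 : (g (q, 0)).1 = q := congrArg Prod.fst hq
    have h2 : (g (q, 0)).2 - A (g (q, 0)) = 0 := congrArg Prod.snd hq
    have h3 : g (q, 0) = (q, Γ q) := Prod.ext h1 rfl
    rw [h3] at h2
    exact sub_eq_zero.1 h2
  have hΓd : HasFDerivAt Γ ℓ q₀ := by
    have h1 : HasFDerivAt Γ (fderiv ℝ Γ q₀) q₀ :=
      (hΓs.self_of_nhds.differentiableAt (by simp)).hasFDerivAt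
    have h2 : HasFDerivAt (fun q => A (q, Γ q)) ((ℓ.comp (ContinuousLinearMap.fst ℝ Q X)).comp
        ((ContinuousLinearMap.id ℝ Q).prod (fderiv ℝ Γ q₀))) q₀ := by
      refine HasFDerivAt.comp (g := A) q₀ ?_ ((hasFDerivAt_id q₀).prodMk h1)
      simpa [hΓ0] using hA'
    have h3 := h2.congr_of_eventuallyEq hΓeq
    convert! h3 using 1
  refine ⟨fun q => ev (Γ q), ?_, ?_, ?_, ?_⟩
  · filter_upwards [hΓs] with q hq using ev.contDiff.contDiffAt.comp q hq
  · change ev (Γ q₀) = p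
    rw [hΓ0]; rfl
  · have h1 : HasFDerivAt (fun q => ev (Γ q)) (ev.comp ℓ) q₀ := ev.hasFDerivAt.comp q₀ hΓd
    convert! h1 using 1
    refine ContinuousLinearMap.ext fun z => ?_
    have h2 : ∀ j, ev (primitiveCLM E (N j γ₀)) = v j p := by
      intro j
      change primitiveCLM E (N j γ₀) one' = v j p
      rw [primitiveCLM_apply]
      have : ∀ s, IccExtend (by norm_num : (-1 : ℝ) ≤ 2) (N j γ₀) s = v j p := fun s => rfl
      simp_rw [this]
      simp [one']
    have h3 : ev (cst z.2) = z.2 := rfl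
    simp [ℓ, h2, h3]
  · obtain ⟨ε, hε, hball⟩ := Metric.mem_nhds_iff.1 hO
    have hnear : ∀ᶠ q in 𝓝 q₀, ‖Γ q - γ₀‖ < ε := by
      have hc := hΓd.continuousAt
      have := (Metric.continuousAt_iff (f := Γ) (a := q₀)).1 hc ε hε
      obtain ⟨δ, hδ, h⟩ := this
      filter_upwards [Metric.ball_mem_nhds q₀ hδ] with q hq
      have := h hq
      rwa [hΓ0, dist_eq_norm] at this
    filter_upwards [hΓeq, hnear] with q hq hqn
    let γ := Γ q
    let F : ℝ → E := fun s => ∑ j, q.1 j • v j (IccExtend (by norm_num : (-1 : ℝ) ≤ 2) γ s)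
    have hcγ : Continuous (IccExtend (by norm_num : (-1 : ℝ) ≤ 2) γ) := γ.continuous.Icc_extend'
    have hF : Continuous F := continuous_finsetSum _ fun j _ =>
      ((hv j).continuous.comp hcγ).const_smul (q.1 j)
    let c : ℝ → E := fun τ => q.2 + ∫ s in (0 : ℝ)..τ, F s
    have hcval : ∀ τ : K, c τ = γ τ := by
      intro τ
      have h1 : γ τ = A (q, γ) τ := congrArg (fun f : X => f τ) hq
      rw [h1]
      have h2 : A (q, γ) τ = q.2 + ∑ j, q.1 j • primitiveCLM E (N j γ) τ := by
        change q.2 + (∑ j, q.1 j • primitiveCLM E (N j γ) : C(K, E)) τ = _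
        rw [ContinuousMap.sum_apply]
        rfl
      rw [h2]
      simp only [c, F]
      rw [intervalIntegral.integral_finsetSum]
      · congr 1
        refine Finset.sum_congr rfl fun j _ => ?_
        rw [intervalIntegral.integral_smul, primitiveCLM_apply]
        rfl
      · intro j _
        exact (((hv j).continuous.comp hcγ).const_smul (q.1 j)).intervalIntegrable _ _
    refine ⟨c, by simp [c], hcval one', fun τ hτ => ?_⟩
    have hτ' : τ ∈ Icc (-1 : ℝ) 2 := Ioo_subset_Icc_self hτ
    have hcτ : c τ = γ ⟨τ, hτ'⟩ := hcval ⟨τ, hτ'⟩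
    constructor
    · apply hball
      rw [hcτ, Metric.mem_ball, dist_eq_norm]
      exact ((γ - γ₀).norm_coe_le_norm ⟨τ, hτ'⟩).trans_lt hqn
    · have h1 : HasDerivAt c (F τ) τ :=
        (intervalIntegral.integral_hasDerivAt_right (hF.intervalIntegrable _ _)
          hF.stronglyMeasurable.stronglyMeasurableAtFilter hF.continuousAt).const_add q.2
      convert! h1 using 1
      simp only [F]
      rw [hcτ, IccExtend_of_mem _ _ hτ']

end Flow

/-! ### Maps that are smooth near a point -/

section SmoothNear

variable {E F E' : Type*} [NormedAddCommGroup E] [NormedSpace ℝ E] [NormedAddCommGroup F]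
  [NormedSpace ℝ F] [NormedAddCommGroup E'] [NormedSpace ℝ E']
  {H K H' : Type*} [TopologicalSpace H] [TopologicalSpace K] [TopologicalSpace H']
  {I : ModelWithCorners ℝ E H} {J : ModelWithCorners ℝ F K} {I' : ModelWithCorners ℝ E' H'}
  {N P Q : Type*} [TopologicalSpace N] [ChartedSpace H N] [TopologicalSpace P] [ChartedSpace K P]
  [TopologicalSpace Q] [ChartedSpace H' Q]

/-- `f` is smooth at all points of some neighbourhood of `x`. (Smoothness at `x` in the sense of
`ContMDiffAt … ∞` allows the neighbourhood to shrink with the order of differentiability.) -/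
def SmoothNear (I : ModelWithCorners ℝ E H) (J : ModelWithCorners ℝ F K) (f : N → P) (x : N) :
    Prop :=
  ∀ᶠ y in 𝓝 x, ContMDiffAt I J ∞ f y

theorem SmoothNear.contMDiffAt {f : N → P} {x : N} (hf : SmoothNear I J f x) :
    ContMDiffAt I J ∞ f x := hf.self_of_nhds

theorem SmoothNear.continuousAt {f : N → P} {x : N} (hf : SmoothNear I J f x) :
    ContinuousAt f x := hf.contMDiffAt.continuousAt

theorem SmoothNear.mdifferentiableAt {f : N → P} {x : N} (hf : SmoothNear I J f x) :
    MDifferentiableAt I J f x := hf.contMDiffAt.mdifferentiableAt (by simp)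

theorem SmoothNear.comp {f : N → P} {g : P → Q} {x : N} (hg : SmoothNear J I' g (f x))
    (hf : SmoothNear I J f x) : SmoothNear I I' (fun y => g (f y)) x := by
  filter_upwards [hf, hf.continuousAt.eventually hg] with y hy hy' using hy'.comp y hy

theorem SmoothNear.congr {f g : N → P} {x : N} (hf : SmoothNear I J f x) (h : g =ᶠ[𝓝 x] f) :
    SmoothNear I J g x := by
  filter_upwards [hf, h.eventuallyEq_nhds] with y hy hy' using hy.congr_of_eventuallyEq hy'

theorem ContMDiff.smoothNear {f : N → P} (hf : ContMDiff I J ∞ f) (x : N) : SmoothNear I J f x :=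
  Eventually.of_forall fun y => hf y

theorem ContMDiffOn.smoothNear {f : N → P} {W : Set N} (hf : ContMDiffOn I J ∞ f W) {x : N}
    (hW : IsOpen W) (hx : x ∈ W) : SmoothNear I J f x := by
  filter_upwards [hW.mem_nhds hx] with y hy using hf.contMDiffAt (hW.mem_nhds hy)

theorem SmoothNear.prodMk {f : N → P} {g : N → Q} {x : N} (hf : SmoothNear I J f x)
    (hg : SmoothNear I I' g x) : SmoothNear I (J.prod I') (fun y => (f y, g y)) x := by
  filter_upwards [hf, hg] with y hy hy' using hy.prodMk hy'

theorem SmoothNear.prodMk_space {f : N → F} {g : N → E'} {x : N} (hf : SmoothNear I 𝓘(ℝ, F) f x)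
    (hg : SmoothNear I 𝓘(ℝ, E') g x) : SmoothNear I 𝓘(ℝ, F × E') (fun y => (f y, g y)) x := by
  filter_upwards [hf, hg] with y hy hy' using hy.prodMk_space hy'

theorem smoothNear_iff_contDiffAt {f : E → F} {x : E} :
    SmoothNear 𝓘(ℝ, E) 𝓘(ℝ, F) f x ↔ ∀ᶠ y in 𝓝 x, ContDiffAt ℝ ∞ f y := by
  simp only [SmoothNear, contMDiffAt_iff_contDiffAt]

theorem surjective_comp_comp_iff {A B C D : Type*} {a : C → D} {f : B → C} {b : A → B}
    (ha : Function.Bijective a) (hb : Function.Bijective b) :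
    Function.Surjective (fun z => a (f (b z))) ↔ Function.Surjective f := by
  constructor
  · intro h w
    obtain ⟨z, hz⟩ := h (a w)
    exact ⟨b z, ha.1 hz⟩
  · intro h
    exact ha.2.comp (h.comp hb.2)

/-- Being a submersion is an open condition. -/
theorem SmoothNear.eventually_surjective [CompleteSpace F] [FiniteDimensional ℝ F]
    [IsManifold I ∞ N] [IsManifold J ∞ P] {f : N → P} {x : N} (hf : SmoothNear I J f x)
    (hs : Function.Surjective (mfderiv I J f x)) :
    ∀ᶠ y in 𝓝 x, Function.Surjective (mfderiv I J f y) := by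
  have hD : ContinuousAt (inTangentCoordinates I J id f (mfderiv I J f) x) x :=
    (hf.contMDiffAt.mfderiv_const (m := 0) (by simp)).continuousAt
  have hcoord : ∀ y ∈ (chartAt H x).source, f y ∈ (chartAt K (f x)).source →
      (Function.Surjective (inTangentCoordinates I J id f (mfderiv I J f) x y) ↔
        Function.Surjective (mfderiv I J f y)) := by
    intro y hy hfy
    rw [inTangentCoordinates_eq_mfderiv_comp (f := id) hy hfy]
    have h1 := (isInvertible_mfderiv_extChartAt (I := J) (x := f x) (y := f y)
      (by rwa [extChartAt_source])).bijective
    have h2 := (isInvertible_mfderivWithin_extChartAt_symm (I := I) (x := x)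
      (y := extChartAt I x y) ((extChartAt I x).map_source (by rwa [extChartAt_source]))).bijective
    exact surjective_comp_comp_iff h1 h2
  have hx0 : Function.Surjective (inTangentCoordinates I J id f (mfderiv I J f) x x) :=
    (hcoord x (mem_chart_source H x) (mem_chart_source K (f x))).2 hs
  set D := inTangentCoordinates I J id f (mfderiv I J f) x with hDdef
  obtain ⟨R, hR⟩ := (D x).exists_rightInverse_of_surjective (LinearMap.range_eq_top.2 hx0)
  have hcomp : ContinuousAt (fun y => (D y).comp R) x :=
    ((ContinuousLinearMap.compL ℝ F E F).flip R).continuous.continuousAt.comp hD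
  have hunit : ∀ᶠ y in 𝓝 x, IsUnit ((D y).comp R) := by
    have h1 : IsUnit ((D x).comp R) := by rw [hR]; exact isUnit_one
    exact hcomp.eventually (Units.isOpen.mem_nhds h1)
  filter_upwards [hunit, (chartAt H x).open_source.mem_nhds (mem_chart_source H x),
    hf.continuousAt.eventually ((chartAt K (f x)).open_source.mem_nhds
      (mem_chart_source K (f x)))] with y hy hy1 hy2
  rw [← hcoord y hy1 hy2]
  obtain ⟨a, ha⟩ := hy
  intro w
  refine ⟨R (((a⁻¹ : (F →L[ℝ] F)ˣ) : F →L[ℝ] F) w), ?_⟩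
  have h2 : ((D y).comp R).comp ((a⁻¹ : (F →L[ℝ] F)ˣ) : F →L[ℝ] F) = 1 := by
    rw [← ha]; exact a.mul_inv
  exact congrArg (fun T : F →L[ℝ] F => T w) h2

end SmoothNear

section Charts

variable {E F : Type*} [NormedAddCommGroup E] [NormedSpace ℝ E] [NormedAddCommGroup F]
  [NormedSpace ℝ F] {N P : Type*} [TopologicalSpace N] [ChartedSpace E N]
  [TopologicalSpace P] [ChartedSpace F P]

theorem smoothNear_extChartAt [IsManifold 𝓘(ℝ, E) ∞ N] (u : N) :
    SmoothNear 𝓘(ℝ, E) 𝓘(ℝ, E) (extChartAt 𝓘(ℝ, E) u) u := by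
  filter_upwards [(chartAt E u).open_source.mem_nhds (mem_chart_source E u)] with y hy
  exact contMDiffAt_extChartAt' hy

theorem smoothNear_extChartAt_symm [IsManifold 𝓘(ℝ, E) ∞ N] (u : N) :
    SmoothNear 𝓘(ℝ, E) 𝓘(ℝ, E) (extChartAt 𝓘(ℝ, E) u).symm (extChartAt 𝓘(ℝ, E) u u) := by
  filter_upwards [(isOpen_extChartAt_target u).mem_nhds (mem_extChartAt_target u)] with y hy
  exact (contMDiffOn_extChartAt_symm u).contMDiffAt ((isOpen_extChartAt_target u).mem_nhds hy)

theorem eventually_extChartAt_left_inv (u : N) :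
    ∀ᶠ w in 𝓝 u, (extChartAt 𝓘(ℝ, E) u).symm (extChartAt 𝓘(ℝ, E) u w) = w := by
  filter_upwards [(isOpen_extChartAt_source (I := 𝓘(ℝ, E)) u).mem_nhds
    (mem_extChartAt_source u)] with w hw using (extChartAt 𝓘(ℝ, E) u).left_inv hw

theorem mfderiv_extChartAt_symm_self [IsManifold 𝓘(ℝ, E) ∞ N] (u : N) :
    mfderiv 𝓘(ℝ, E) 𝓘(ℝ, E) (extChartAt 𝓘(ℝ, E) u).symm (extChartAt 𝓘(ℝ, E) u u) =
      ContinuousLinearMap.id ℝ E := by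
  have := mfderivWithin_range_extChartAt_symm (I := 𝓘(ℝ, E)) (x := u)
  rwa [ModelWithCorners.range_eq_univ, mfderivWithin_univ] at this

/-- A map written in the preferred charts at `u` and at its image. -/
noncomputable def inCharts (E F : Type*) [NormedAddCommGroup E] [NormedSpace ℝ E]
    [NormedAddCommGroup F] [NormedSpace ℝ F] {N P : Type*} [TopologicalSpace N] [ChartedSpace E N]
    [TopologicalSpace P] [ChartedSpace F P] (f : N → P) (u : N) (z : E) : F :=
  extChartAt 𝓘(ℝ, F) (f u) (f ((extChartAt 𝓘(ℝ, E) u).symm z))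

theorem hasFDerivAt_inCharts {f : N → P} {u : N} (hf : MDifferentiableAt 𝓘(ℝ, E) 𝓘(ℝ, F) f u) :
    HasFDerivAt (inCharts E F f u) (mfderiv 𝓘(ℝ, E) 𝓘(ℝ, F) f u : E →L[ℝ] F)
      (extChartAt 𝓘(ℝ, E) u u) := by
  have := hf.hasMFDerivAt.2
  rw [ModelWithCorners.range_eq_univ] at this
  exact (hasFDerivWithinAt_univ (𝕜 := ℝ) (E := E) (F := F)).1 this

variable [IsManifold 𝓘(ℝ, E) ∞ N] [IsManifold 𝓘(ℝ, F) ∞ P]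

theorem SmoothNear.inCharts {f : N → P} {u : N} (hf : SmoothNear 𝓘(ℝ, E) 𝓘(ℝ, F) f u) :
    SmoothNear 𝓘(ℝ, E) 𝓘(ℝ, F) (inCharts E F f u) (extChartAt 𝓘(ℝ, E) u u) := by
  have h0 : (extChartAt 𝓘(ℝ, E) u).symm (extChartAt 𝓘(ℝ, E) u u) = u := extChartAt_to_inv u
  have h1 : SmoothNear 𝓘(ℝ, E) 𝓘(ℝ, F) (fun z => f ((extChartAt 𝓘(ℝ, E) u).symm z))
      (extChartAt 𝓘(ℝ, E) u u) :=
    SmoothNear.comp (g := f) (by rwa [h0]) (smoothNear_extChartAt_symm u)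
  exact SmoothNear.comp (g := extChartAt 𝓘(ℝ, F) (f u))
    (by simp only [h0]; exact smoothNear_extChartAt (f u)) h1

end Charts

section Retraction

theorem exists_fiber_retraction_aux {E F : Type*} [NormedAddCommGroup E] [NormedSpace ℝ E]
    [CompleteSpace E] [NormedAddCommGroup F] [NormedSpace ℝ F] [FiniteDimensional ℝ F]
    {f : E → F} {a : E} (hf : ∀ᶠ x in 𝓝 a, ContDiffAt ℝ ∞ f x) {f' : E →L[ℝ] F}
    (hf' : HasFDerivAt f f' a) (hs : Function.Surjective f') :
    ∃ π : F × E → E, (∀ᶠ q in 𝓝 (f a, a), ContDiffAt ℝ ∞ π q) ∧ π (f a, a) = a ∧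
      (∀ᶠ q in 𝓝 (f a, a), f (π q) = q.1) ∧ ∀ᶠ h in 𝓝 a, π (f h, h) = h := by
  have : CompleteSpace F := FiniteDimensional.complete ℝ F
  obtain ⟨L, hL⟩ := f'.exists_rightInverse_of_surjective (LinearMap.range_eq_top.2 hs)
  have hL' : ∀ z, f' (L z) = z := fun z => congrArg (fun T : F →L[ℝ] F => T z) hL
  let S : E × F → E := fun q => q.1 + L q.2
  have hS : ContDiff ℝ ∞ S := contDiff_fst.add (L.contDiff.comp contDiff_snd)
  have hSd : HasFDerivAt S (ContinuousLinearMap.fst ℝ E F +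
      L.comp (ContinuousLinearMap.snd ℝ E F)) (a, 0) :=
    (ContinuousLinearMap.fst ℝ E F + L.comp (ContinuousLinearMap.snd ℝ E F)).hasFDerivAt
  have hS0 : S (a, 0) = a := by simp [S]
  let Θ : E × F → E × F := fun q => (q.1, f (S q))
  have hΘ : ∀ᶠ q in 𝓝 (a, (0 : F)), ContDiffAt ℝ ∞ Θ q := by
    have h1 : ∀ᶠ q in 𝓝 (a, (0 : F)), ContDiffAt ℝ ∞ f (S q) :=
      hS.continuous.continuousAt.eventually (by rwa [hS0])
    filter_upwards [h1] with q hq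
    exact contDiffAt_fst.prodMk (hq.comp q hS.contDiffAt)
  let Θ' : (E × F) ≃L[ℝ] (E × F) := ContinuousLinearEquiv.equivOfInverse
    ((ContinuousLinearMap.fst ℝ E F).prod (f'.comp (ContinuousLinearMap.fst ℝ E F +
      L.comp (ContinuousLinearMap.snd ℝ E F))))
    ((ContinuousLinearMap.fst ℝ E F).prod (ContinuousLinearMap.snd ℝ E F -
      f'.comp (ContinuousLinearMap.fst ℝ E F)))
    (fun z => by ext1 <;> simp [hL']) (fun z => by ext1 <;> simp [hL'])
  have hΘ' : HasFDerivAt Θ (Θ' : (E × F) →L[ℝ] (E × F)) (a, 0) :=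
    hasFDerivAt_fst.prodMk (HasFDerivAt.comp (g := f) (a, (0 : F)) (by rwa [hS0]) hSd)
  obtain ⟨g, hg0, hgs, hfg, hgf⟩ := exists_smooth_local_inverse hΘ Θ' hΘ'
  have hΘ0 : Θ (a, 0) = (a, f a) := by simp [Θ, hS0]
  rw [hΘ0] at hg0 hgs hfg
  have hswap : Continuous (fun q : F × E => (q.2, q.1)) := by fun_prop
  refine ⟨fun q => q.2 + L (g (q.2, q.1)).2, ?_, ?_, ?_, ?_⟩
  · filter_upwards [(hswap.continuousAt (x := (f a, a))).eventually hgs] with q hq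
    exact contDiffAt_snd.add (L.contDiff.contDiffAt.comp q (contDiffAt_snd.comp q
      (hq.comp q (contDiffAt_snd.prodMk contDiffAt_fst))))
  · simp [hg0]
  · filter_upwards [(hswap.continuousAt (x := (f a, a))).eventually hfg] with q hq
    have h1 : (g (q.2, q.1)).1 = q.2 := congrArg Prod.fst hq
    have h2 : f ((g (q.2, q.1)).1 + L (g (q.2, q.1)).2) = q.1 := congrArg Prod.snd hq
    rwa [h1] at h2
  · have hin : Continuous (fun h : E => (h, (0 : F))) := by fun_prop
    filter_upwards [(hin.continuousAt (x := a)).eventually hgf] with h hh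
    have h1 : Θ (h, 0) = (h, f h) := by simp [Θ, S]
    rw [h1] at hh
    simp [hh]

variable {E F : Type*} [NormedAddCommGroup E] [NormedSpace ℝ E] [CompleteSpace E]
  [NormedAddCommGroup F]
  [NormedSpace ℝ F] [FiniteDimensional ℝ F] {N P : Type*} [TopologicalSpace N] [ChartedSpace E N]
  [TopologicalSpace P] [ChartedSpace F P]
  [IsManifold 𝓘(ℝ, E) ∞ N] [IsManifold 𝓘(ℝ, F) ∞ P]

/-- Near a point `u` at which `p` is a submersion, there is a smooth family of retractions
`π (y, ·)` onto the fibres `p⁻¹(y)`. It provides local sections of `p`, curves in the fibres with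
prescribed velocity, and extensions of functions on the fibres. -/
theorem exists_fiber_retraction {p : N → P} {u : N} (hp : SmoothNear 𝓘(ℝ, E) 𝓘(ℝ, F) p u)
    (hs : Function.Surjective (mfderiv 𝓘(ℝ, E) 𝓘(ℝ, F) p u)) :
    ∃ π : P × N → N, SmoothNear (𝓘(ℝ, F).prod 𝓘(ℝ, E)) 𝓘(ℝ, E) π (p u, u) ∧ π (p u, u) = u ∧
      (∀ᶠ q in 𝓝 (p u, u), p (π q) = q.1) ∧ ∀ᶠ h in 𝓝 u, π (p h, h) = h := by
  set e := extChartAt 𝓘(ℝ, E) u with he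
  set c := extChartAt 𝓘(ℝ, F) (p u) with hc
  have h0 : e.symm (e u) = u := extChartAt_to_inv u
  have hf0 : inCharts E F p u (e u) = c (p u) := by simp only [inCharts, ← he, ← hc, h0]
  obtain ⟨π, hπs, hπ0, hπ1, hπ2⟩ := exists_fiber_retraction_aux
    (smoothNear_iff_contDiffAt.1 hp.inCharts) (hasFDerivAt_inCharts hp.mdifferentiableAt) hs
  rw [hf0] at hπs hπ0 hπ1
  simp only [← he] at hπs hπ0 hπ1 hπ2
  have hin : SmoothNear (𝓘(ℝ, F).prod 𝓘(ℝ, E)) 𝓘(ℝ, F × E) (fun q : P × N => (c q.1, e q.2))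
      (p u, u) := by
    refine SmoothNear.prodMk_space ?_ ?_
    · exact SmoothNear.comp (g := c) (f := Prod.fst) (smoothNear_extChartAt (p u))
        (ContMDiff.smoothNear contMDiff_fst _)
    · exact SmoothNear.comp (g := e) (f := Prod.snd) (smoothNear_extChartAt u)
        (ContMDiff.smoothNear contMDiff_snd _)
  have hπin : SmoothNear (𝓘(ℝ, F).prod 𝓘(ℝ, E)) 𝓘(ℝ, E) (fun q : P × N => π (c q.1, e q.2))
      (p u, u) := SmoothNear.comp (g := π) (smoothNear_iff_contDiffAt.2 hπs) hin
  have hsm : SmoothNear (𝓘(ℝ, F).prod 𝓘(ℝ, E)) 𝓘(ℝ, E)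
      (fun q : P × N => e.symm (π (c q.1, e q.2))) (p u, u) := by
    refine SmoothNear.comp (g := e.symm) (f := fun q : P × N => π (c q.1, e q.2)) ?_ hπin
    simp only [hπ0]
    exact smoothNear_extChartAt_symm u
  refine ⟨fun q => e.symm (π (c q.1, e q.2)), hsm, by simp only [hπ0, h0], ?_, ?_⟩
  · have h1 : ∀ᶠ q : P × N in 𝓝 (p u, u), p (e.symm (π (c q.1, e q.2))) ∈ c.source := by
      have : ContinuousAt (fun q : P × N => p (e.symm (π (c q.1, e q.2)))) (p u, u) := by
        refine ContinuousAt.comp (g := p) ?_ hsm.continuousAt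
        simp only [hπ0, h0]
        exact hp.continuousAt
      refine this.eventually ?_
      simp only [hπ0, h0]
      exact (isOpen_extChartAt_source (p u)).mem_nhds (mem_extChartAt_source (p u))
    have h2 : ∀ᶠ q : P × N in 𝓝 (p u, u), q.1 ∈ c.source := continuousAt_fst.eventually
      ((isOpen_extChartAt_source (p u)).mem_nhds (mem_extChartAt_source (p u)))
    filter_upwards [h1, h2, hin.continuousAt.eventually hπ1] with q hq1 hq2 hq3
    exact c.injOn hq1 hq2 hq3
  · have h1 : ContinuousAt e u := (smoothNear_extChartAt u).continuousAt
    filter_upwards [h1.eventually hπ2, eventually_extChartAt_left_inv (E := E) u] with h hh hh2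
    simp only [inCharts, ← he, ← hc] at hh hh2
    rw [hh2] at hh
    rw [hh, hh2]

/-- Velocity along the fibres: a curve in the fibre of `p` through `u` with a given vertical
velocity at time `0`. -/
theorem exists_fiber_curve {p : N → P} {u : N} (hp : SmoothNear 𝓘(ℝ, E) 𝓘(ℝ, F) p u)
    (hs : Function.Surjective (mfderiv 𝓘(ℝ, E) 𝓘(ℝ, F) p u)) (k : E)
    (hk : mfderiv 𝓘(ℝ, E) 𝓘(ℝ, F) p u k = 0) :
    ∃ c : ℝ → N, c 0 = u ∧ (∀ᶠ τ in 𝓝 (0 : ℝ), p (c τ) = p u) ∧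
      HasMFDerivAt 𝓘(ℝ, ℝ) 𝓘(ℝ, E) c 0 ((1 : ℝ →L[ℝ] ℝ).smulRight k) := by
  obtain ⟨π, hπs, hπ0, hπ1, hπ2⟩ := exists_fiber_retraction hp hs
  set e := extChartAt 𝓘(ℝ, E) u with he
  have h0 : e.symm (e u) = u := extChartAt_to_inv u
  have hu : ∀ τ : ℝ, τ = 0 → e u + τ • k = e u := by rintro _ rfl; simp
  let c₀ : ℝ → N := fun τ => e.symm (e u + τ • k)
  have hc₀ : c₀ 0 = u := by simp only [c₀, hu 0 rfl, h0]
  have hc₀d : HasMFDerivAt 𝓘(ℝ, ℝ) 𝓘(ℝ, E) c₀ 0 ((1 : ℝ →L[ℝ] ℝ).smulRight k) := by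
    have h1 : HasFDerivAt (fun τ : ℝ => e u + τ • k)
        ((1 : ℝ →L[ℝ] ℝ).smulRight k) 0 :=
      ((1 : ℝ →L[ℝ] ℝ).smulRight k).hasFDerivAt.const_add (e u)
    have h2 : HasMFDerivAt 𝓘(ℝ, E) 𝓘(ℝ, E) e.symm (e u + (0 : ℝ) • k)
        (ContinuousLinearMap.id ℝ E) := by
      rw [hu 0 rfl, ← mfderiv_extChartAt_symm_self u]
      exact (smoothNear_extChartAt_symm u).mdifferentiableAt.hasMFDerivAt
    exact h2.comp (0 : ℝ) h1.hasMFDerivAt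
  have hD : HasMFDerivAt (𝓘(ℝ, F).prod 𝓘(ℝ, E)) 𝓘(ℝ, E) π (p u, u) (mfderiv _ _ π (p u, u)) :=
    hπs.mdifferentiableAt.hasMFDerivAt
  set D := mfderiv (𝓘(ℝ, F).prod 𝓘(ℝ, E)) 𝓘(ℝ, E) π (p u, u) with hDdef
  -- differentiating `π (p h, h) = h` shows that `D (0, k) = k` for vertical `k`
  have hDk : D ((0 : F), k) = k := by
    have h1 : HasMFDerivAt 𝓘(ℝ, E) 𝓘(ℝ, E) (fun h => π (p h, h)) u
        (D.comp ((mfderiv 𝓘(ℝ, E) 𝓘(ℝ, F) p u).prod (ContinuousLinearMap.id ℝ _))) :=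
      HasMFDerivAt.comp (g := π) u hD
        (hp.mdifferentiableAt.hasMFDerivAt.prodMk (hasMFDerivAt_id u))
    have h2 : HasMFDerivAt 𝓘(ℝ, E) 𝓘(ℝ, E) (fun h => π (p h, h)) u
        (ContinuousLinearMap.id ℝ _) := (hasMFDerivAt_id u).congr_of_eventuallyEq hπ2
    have h3 := hasMFDerivAt_unique h1 h2
    have h4 := congrArg (fun T : E →L[ℝ] E => T k) h3
    have h5 : D (mfderiv 𝓘(ℝ, E) 𝓘(ℝ, F) p u k, k) = k := h4
    rw [hk] at h5
    exact h5
  refine ⟨fun τ => π (p u, c₀ τ), by simp only [hc₀, hπ0], ?_, ?_⟩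
  · have : ContinuousAt (fun τ => (p u, c₀ τ)) 0 := continuousAt_const.prodMk hc₀d.continuousAt
    exact this.eventually (by simpa only [hc₀] using hπ1)
  · have h1 : HasMFDerivAt 𝓘(ℝ, ℝ) (𝓘(ℝ, F).prod 𝓘(ℝ, E)) (fun τ => (p u, c₀ τ)) 0
        ((0 : ℝ →L[ℝ] F).prod ((1 : ℝ →L[ℝ] ℝ).smulRight k)) :=
      (hasMFDerivAt_const (p u) (0 : ℝ)).prodMk hc₀d
    have h2 := HasMFDerivAt.comp (g := π) (g' := D) (0 : ℝ) (by rw [hc₀]; exact hD) h1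
    refine h2.congr_mfderiv (ContinuousLinearMap.ext fun (r : ℝ) => ?_)
    have h3 : D ((0 : F), r • k) = r • k := by
      have h4 : ((0 : F), r • k) = r • ((0 : F), k) := by simp
      rw [h4]
      exact (map_smul D r _).trans (congrArg (fun w : E => r • w) hDk)
    exact h3

end Retraction

/-! ### Vector fields: cut-offs, coordinates and flows -/

section Cutoff

variable {E F : Type*} [NormedAddCommGroup E] [NormedSpace ℝ E] [FiniteDimensional ℝ E]
  [NormedAddCommGroup F] [NormedSpace ℝ F]
  {N : Type*} [TopologicalSpace N] [ChartedSpace E N] [T2Space N] [IsManifold 𝓘(ℝ, E) ∞ N]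

theorem exists_cutoff {u : N} {O : Set N} (hO : O ∈ 𝓝 u) :
    ∃ χ : C^∞⟮𝓘(ℝ, E), N; ℝ⟯, HasCompactSupport χ ∧ tsupport χ ⊆ O ∧ ∀ᶠ w in 𝓝 u, χ w = 1 := by
  obtain ⟨f, -, hf⟩ := (SmoothBumpFunction.nhds_basis_tsupport (I := 𝓘(ℝ, E)) u).mem_iff.1 hO
  exact ⟨⟨f, f.contMDiff⟩, f.hasCompactSupport, hf, f.eventuallyEq_one⟩

/-- A map that is smooth near `u` agrees near `u` with a globally smooth map. -/
theorem SmoothNear.exists_global {f : N → F} {u : N} (hf : SmoothNear 𝓘(ℝ, E) 𝓘(ℝ, F) f u) :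
    ∃ g : N → F, ContMDiff 𝓘(ℝ, E) 𝓘(ℝ, F) ∞ g ∧ g =ᶠ[𝓝 u] f := by
  obtain ⟨χ, -, hχ, hχ1⟩ := exists_cutoff (E := E) hf
  refine ⟨fun w => χ w • f w, contMDiff_of_tsupport fun w hw => ?_, ?_⟩
  · exact (χ.contMDiff w).smul (hχ (tsupport_smul_subset_left _ _ hw))
  · filter_upwards [hχ1] with w hw
    rw [hw, one_smul]

end Cutoff

section Fields

variable {E : Type*} [NormedAddCommGroup E] [NormedSpace ℝ E]
  {N : Type*} [TopologicalSpace N] [ChartedSpace E N] [IsManifold 𝓘(ℝ, E) ∞ N]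

/-- The vector field `X` is smooth on a neighbourhood of `u`. -/
def SmoothFieldNear (X : ∀ w : N, TangentSpace 𝓘(ℝ, E) w) (u : N) : Prop :=
  ∀ᶠ w in 𝓝 u, ContMDiffAt 𝓘(ℝ, E) 𝓘(ℝ, E).tangent ∞
    (fun w => (⟨w, X w⟩ : TangentBundle 𝓘(ℝ, E) N)) w

theorem IsSmoothField.smoothFieldNear {X : ∀ w : N, TangentSpace 𝓘(ℝ, E) w}
    (hX : IsSmoothField X) (u : N) : SmoothFieldNear X u :=
  Eventually.of_forall fun w => hX w

theorem contMDiffAt_field_iff {X : ∀ w : N, TangentSpace 𝓘(ℝ, E) w} {u w : N}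
    (hw : w ∈ (chartAt E u).source) :
    ContMDiffAt 𝓘(ℝ, E) 𝓘(ℝ, E).tangent ∞ (fun w => (⟨w, X w⟩ : TangentBundle 𝓘(ℝ, E) N)) w ↔
      ContMDiffAt 𝓘(ℝ, E) 𝓘(ℝ, E) ∞
        (fun w => (mfderiv 𝓘(ℝ, E) 𝓘(ℝ, E) (extChartAt 𝓘(ℝ, E) u) w (X w) : E)) w := by
  rw [(trivializationAt E (TangentSpace 𝓘(ℝ, E)) u).contMDiffAt_section_iff
    (by rwa [TangentBundle.trivializationAt_baseSet])]
  refine Filter.EventuallyEq.contMDiffAt_iff ?_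
  filter_upwards [(chartAt E u).open_source.mem_nhds hw] with y hy
  have hb : y ∈ (trivializationAt E (TangentSpace 𝓘(ℝ, E)) u).baseSet := by
    rwa [TangentBundle.trivializationAt_baseSet]
  have h1 := TangentBundle.continuousLinearMapAt_trivializationAt (I := 𝓘(ℝ, E)) hy
  have h2 := congrArg (fun T : E →L[ℝ] E => T (X y)) h1
  refine Eq.trans ?_ h2
  exact (congrFun ((trivializationAt E (TangentSpace 𝓘(ℝ, E)) u).coe_linearMapAt_of_mem (R := ℝ)
    hb)
    (X y)).symm

/-- The coordinate expression, in the preferred chart at `u`, of a vector field on `N`. -/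
noncomputable def fieldInChart (X : ∀ w : N, TangentSpace 𝓘(ℝ, E) w) (u : N) (z : E) : E :=
  mfderiv 𝓘(ℝ, E) 𝓘(ℝ, E) (extChartAt 𝓘(ℝ, E) u) ((extChartAt 𝓘(ℝ, E) u).symm z)
    (X ((extChartAt 𝓘(ℝ, E) u).symm z))

/-- The vector field on the domain of the preferred chart at `u` with coordinate expression `x`. -/
noncomputable def fieldOfChart (u : N) (x : E → E) (w : N) : TangentSpace 𝓘(ℝ, E) w :=
  (mfderiv 𝓘(ℝ, E) 𝓘(ℝ, E) (extChartAt 𝓘(ℝ, E) u) w).inverse (x (extChartAt 𝓘(ℝ, E) u w))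

theorem mfderiv_fieldOfChart (u : N) (x : E → E) {w : N} (hw : w ∈ (chartAt E u).source) :
    mfderiv 𝓘(ℝ, E) 𝓘(ℝ, E) (extChartAt 𝓘(ℝ, E) u) w (fieldOfChart u x w) =
      x (extChartAt 𝓘(ℝ, E) u w) := by
  obtain ⟨e, he⟩ := isInvertible_mfderiv_extChartAt (I := 𝓘(ℝ, E)) (x := u) (y := w)
    (by rwa [extChartAt_source])
  rw [fieldOfChart, ← he, ContinuousLinearMap.inverse_equiv]
  exact e.apply_symm_apply _

theorem fieldInChart_self (X : ∀ w : N, TangentSpace 𝓘(ℝ, E) w) (u : N) :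
    fieldInChart X u (extChartAt 𝓘(ℝ, E) u u) = X u := by
  rw [fieldInChart, extChartAt_to_inv, mfderiv_extChartAt_self]
  rfl

theorem SmoothFieldNear.fieldInChart {X : ∀ w : N, TangentSpace 𝓘(ℝ, E) w} {u : N}
    (hX : SmoothFieldNear X u) :
    SmoothNear 𝓘(ℝ, E) 𝓘(ℝ, E) (fieldInChart X u) (extChartAt 𝓘(ℝ, E) u u) := by
  have h1 : SmoothNear 𝓘(ℝ, E) 𝓘(ℝ, E)
      (fun w => (mfderiv 𝓘(ℝ, E) 𝓘(ℝ, E) (extChartAt 𝓘(ℝ, E) u) w (X w) : E)) u := by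
    filter_upwards [hX, (chartAt E u).open_source.mem_nhds (mem_chart_source E u)] with w hw hw'
    exact (contMDiffAt_field_iff hw').1 hw
  refine SmoothNear.comp (g := fun w =>
    (mfderiv 𝓘(ℝ, E) 𝓘(ℝ, E) (extChartAt 𝓘(ℝ, E) u) w (X w) : E)) ?_ (smoothNear_extChartAt_symm u)
  rwa [extChartAt_to_inv]

theorem smoothFieldNear_fieldOfChart {x : E → E} {u : N}
    (hx : SmoothNear 𝓘(ℝ, E) 𝓘(ℝ, E) x (extChartAt 𝓘(ℝ, E) u u)) :
    SmoothFieldNear (fieldOfChart u x) u := by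
  have h1 : SmoothNear 𝓘(ℝ, E) 𝓘(ℝ, E) (fun w => x (extChartAt 𝓘(ℝ, E) u w)) u :=
    hx.comp (smoothNear_extChartAt u)
  filter_upwards [h1, (chartAt E u).open_source.mem_nhds (mem_chart_source E u)] with w hw hw'
  rw [contMDiffAt_field_iff hw']
  refine hw.congr_of_eventuallyEq ?_
  filter_upwards [(chartAt E u).open_source.mem_nhds hw'] with y hy
  exact mfderiv_fieldOfChart u x hy

/-- A vector field defined near `u` can be cut off to a smooth compactly supported field; the
cut-off can be chosen to be supported in a given neighbourhood. -/
theorem SmoothFieldNear.exists_cutoff [FiniteDimensional ℝ E] [T2Space N] {ι : Type*} [Finite ι]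
    {X : ι → ∀ w : N, TangentSpace 𝓘(ℝ, E) w} {u : N} (hX : ∀ j, SmoothFieldNear (X j) u)
    {O : Set N} (hO : O ∈ 𝓝 u) :
    ∃ χ : C^∞⟮𝓘(ℝ, E), N; ℝ⟯, tsupport χ ⊆ O ∧ (∀ᶠ w in 𝓝 u, χ w = 1) ∧
      ∀ j, IsSmoothField (fun w => χ w • X j w) ∧ IsCompactField (fun w => χ w • X j w) := by
  have h1 : ∀ᶠ w in 𝓝 u, ∀ j, ContMDiffAt 𝓘(ℝ, E) 𝓘(ℝ, E).tangent ∞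
    (fun w => (⟨w, X j w⟩ : TangentBundle 𝓘(ℝ, E) N)) w := eventually_all.2 hX
  obtain ⟨W, hW, hWo, huW⟩ := eventually_nhds_iff.1 h1
  obtain ⟨χ, hχc, hχs, hχ1⟩ := SingAlg.exists_cutoff (E := E) (inter_mem hO (hWo.mem_nhds huW))
  refine ⟨χ, hχs.trans inter_subset_left, hχ1, fun j => ⟨?_, ?_⟩⟩
  · exact ContMDiffOn.smul_section_of_tsupport (u := W) (s := X j) χ.contMDiff.contMDiffOn hWo
      (hχs.trans inter_subset_right) (fun w hw => (hW w hw j).contMDiffWithinAt)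
  · refine IsCompact.of_isClosed_subset hχc isClosed_closure (closure_mono fun w hw => ?_)
    intro h0
    exact hw (by simp only [h0, zero_smul])

/-- Smooth families of integral curves: the time-one map of `∑ j, λ j • V j` depends smoothly on
the (small) parameters `λ` and on the initial point, read in the chart at `u`. -/
theorem exists_smooth_field_flow [FiniteDimensional ℝ E] {ι : Type*} [Fintype ι]
    (V : ι → ∀ w : N, TangentSpace 𝓘(ℝ, E) w) {u : N} (hV : ∀ j, SmoothFieldNear (V j) u)
    (v₀ : ι → E) (hv₀ : ∀ j, v₀ j = V j u) :
    ∃ h : (ι → ℝ) × E → E,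
      (∀ᶠ q in 𝓝 ((0 : ι → ℝ), extChartAt 𝓘(ℝ, E) u u), ContDiffAt ℝ ∞ h q) ∧
      h (0, extChartAt 𝓘(ℝ, E) u u) = extChartAt 𝓘(ℝ, E) u u ∧
      HasFDerivAt h (ContinuousLinearMap.snd ℝ (ι → ℝ) E +
        ∑ j, (((ContinuousLinearMap.proj j : (ι → ℝ) →L[ℝ] ℝ).comp
          (ContinuousLinearMap.fst ℝ (ι → ℝ) E)).smulRight (v₀ j)))
        (0, extChartAt 𝓘(ℝ, E) u u) ∧
      ∀ᶠ q in 𝓝 ((0 : ι → ℝ), extChartAt 𝓘(ℝ, E) u u), ∃ c : ℝ → N,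
        c 0 = (extChartAt 𝓘(ℝ, E) u).symm q.2 ∧ c 1 = (extChartAt 𝓘(ℝ, E) u).symm (h q) ∧
        ∀ τ ∈ Ioo (-1 : ℝ) 2, HasMFDerivAt 𝓘(ℝ, ℝ) 𝓘(ℝ, E) c τ
          ((1 : ℝ →L[ℝ] ℝ).smulRight (∑ j, q.1 j • V j (c τ))) := by
  set e := extChartAt 𝓘(ℝ, E) u with he
  choose v hvs hv using fun j => (hV j).fieldInChart.exists_global
  have hO : {z | z ∈ e.target ∧ ∀ j, v j z = fieldInChart (V j) u z} ∈ 𝓝 (e u) := by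
    filter_upwards [(isOpen_extChartAt_target u).mem_nhds (mem_extChartAt_target u),
      eventually_all.2 hv] with z hz hz' using ⟨hz, hz'⟩
  obtain ⟨h, hs, h0, hd, hcurve⟩ := exists_smooth_flow v
    (fun j => contMDiff_iff_contDiff.1 (hvs j)) (e u) hO
  refine ⟨h, hs, h0, ?_, ?_⟩
  · have : ∀ j, v j (e u) = v₀ j := fun j => by
      rw [hv₀, (hv j).self_of_nhds, fieldInChart_self]
    simpa only [this] using hd
  · filter_upwards [hcurve] with q hq
    obtain ⟨c, hc0, hc1, hc⟩ := hq
    refine ⟨fun τ => e.symm (c τ), by simp only [hc0], by simp only [hc1], fun τ hτ => ?_⟩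
    obtain ⟨⟨hcO, hcv⟩, hcd⟩ := hc τ hτ
    have hsrc : e.symm (c τ) ∈ (chartAt E u).source := by
      have := e.map_target hcO
      rwa [he, extChartAt_source] at this
    have hsymm : HasMFDerivAt 𝓘(ℝ, E) 𝓘(ℝ, E) e.symm (c τ)
        (mfderiv 𝓘(ℝ, E) 𝓘(ℝ, E) e.symm (c τ)) := by
      refine MDifferentiableAt.hasMFDerivAt ?_
      exact ((contMDiffOn_extChartAt_symm (n := ∞) u).contMDiffAt
        ((isOpen_extChartAt_target u).mem_nhds hcO)).mdifferentiableAt (by simp)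
    have hcomp := hsymm.comp τ hcd.hasFDerivAt.hasMFDerivAt
    refine hcomp.congr_mfderiv (ContinuousLinearMap.ext fun (r : ℝ) => ?_)
    have hinv := mfderivWithin_extChartAt_symm_comp_mfderiv_extChartAt (I := 𝓘(ℝ, E)) (x := u) hcO
    rw [ModelWithCorners.range_eq_univ, mfderivWithin_univ] at hinv
    have hinv' : ∀ k : E, mfderiv 𝓘(ℝ, E) 𝓘(ℝ, E) e.symm (c τ)
        (mfderiv 𝓘(ℝ, E) 𝓘(ℝ, E) e (e.symm (c τ)) k) = k :=
      fun k => congrArg (fun T : E →L[ℝ] E => T k) hinv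
    have hsum : mfderiv 𝓘(ℝ, E) 𝓘(ℝ, E) e.symm (c τ) (∑ j, q.1 j • v j (c τ) : E) =
        ∑ j, q.1 j • V j (e.symm (c τ)) := by
      refine (map_sum (mfderiv 𝓘(ℝ, E) 𝓘(ℝ, E) e.symm (c τ))
        (fun j => (q.1 j • v j (c τ) : E)) _).trans (Finset.sum_congr rfl fun j _ => ?_)
      refine (map_smul (mfderiv 𝓘(ℝ, E) 𝓘(ℝ, E) e.symm (c τ)) (q.1 j) (v j (c τ) : E)).trans ?_
      rw [hcv j]
      exact congrArg (fun k : E => q.1 j • k) (hinv' (V j (e.symm (c τ))))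
    change mfderiv 𝓘(ℝ, E) 𝓘(ℝ, E) e.symm (c τ) (r • (∑ j, q.1 j • v j (c τ)) : E) = _
    refine (map_smul (mfderiv 𝓘(ℝ, E) 𝓘(ℝ, E) e.symm (c τ)) r
      (∑ j, q.1 j • v j (c τ) : E)).trans ?_
    exact congrArg (fun k : E => r • k) hsum

end Fields

/-! ### Vertical vector fields and sections of submersions -/

section Vertical

/-- A smooth family of projections onto the kernels of the derivatives of a submersion. -/
theorem exists_smooth_ker_projection {E F : Type*} [NormedAddCommGroup E] [NormedSpace ℝ E]
    [NormedAddCommGroup F] [NormedSpace ℝ F] [FiniteDimensional ℝ F]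
    {f : E → F} {a : E} (hf : ∀ᶠ z in 𝓝 a, ContDiffAt ℝ ∞ f z)
    (hs : Function.Surjective (fderiv ℝ f a)) :
    ∃ R : E → E →L[ℝ] E, (∀ᶠ z in 𝓝 a, ContDiffAt ℝ ∞ R z) ∧
      (∀ᶠ z in 𝓝 a, ∀ k, fderiv ℝ f z (R z k) = 0) ∧ ∀ z k, fderiv ℝ f z k = 0 → R z k = k := by
  have : CompleteSpace F := FiniteDimensional.complete ℝ F
  obtain ⟨L, hL⟩ := (fderiv ℝ f a).exists_rightInverse_of_surjective (LinearMap.range_eq_top.2 hs)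
  have hD : ∀ᶠ z in 𝓝 a, ContDiffAt ℝ ∞ (fderiv ℝ f) z := by
    filter_upwards [hf] with z hz using hz.fderiv_right (by simp)
  have hDL : ∀ᶠ z in 𝓝 a, ContDiffAt ℝ ∞ (fun z => (fderiv ℝ f z).comp L) z := by
    filter_upwards [hD] with z hz using hz.clm_comp contDiffAt_const
  have hinv : ∀ᶠ z in 𝓝 a, ∃ e : F ≃L[ℝ] F, (e : F →L[ℝ] F) = (fderiv ℝ f z).comp L := by
    have h1 : ContinuousAt (fun z => (fderiv ℝ f z).comp L) a := hDL.self_of_nhds.continuousAt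
    have h2 := (ContinuousLinearEquiv.refl ℝ F).nhds
    have h3 : ∀ᶠ T in 𝓝 ((fderiv ℝ f a).comp L), ∃ e : F ≃L[ℝ] F, (e : F →L[ℝ] F) = T := by
      rw [hL]
      exact h2
    exact h1.eventually h3
  refine ⟨fun z => ContinuousLinearMap.id ℝ E -
    L.comp (((fderiv ℝ f z).comp L).inverse.comp (fderiv ℝ f z)), ?_, ?_, ?_⟩
  · filter_upwards [hD, hDL, hinv] with z hz hz' hzi
    obtain ⟨e, he⟩ := hzi
    have h1 : ContDiffAt ℝ ∞ (fun z => ((fderiv ℝ f z).comp L).inverse) z := by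
      refine ContDiffAt.comp (g := ContinuousLinearMap.inverse) z ?_ hz'
      rw [← he]
      exact contDiffAt_map_inverse e
    exact contDiffAt_const.sub (contDiffAt_const.clm_comp (h1.clm_comp hz))
  · filter_upwards [hinv] with z hzi k
    obtain ⟨e, he⟩ := hzi
    have h1 : ∀ y, fderiv ℝ f z (L y) = e y := fun y =>
      (congrArg (fun T : F →L[ℝ] F => T y) he).symm
    rw [← he, ContinuousLinearMap.inverse_equiv]
    simp [h1]
  · intro z k hk
    simp [hk]

variable {E F : Type*} [NormedAddCommGroup E] [NormedSpace ℝ E] [NormedAddCommGroup F]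
  [NormedSpace ℝ F] {N P : Type*} [TopologicalSpace N] [ChartedSpace E N]
  [TopologicalSpace P] [ChartedSpace F P]
  [IsManifold 𝓘(ℝ, E) ∞ N] [IsManifold 𝓘(ℝ, F) ∞ P]

theorem SmoothNear.eventually_fderiv_inCharts {p : N → P} {u : N}
    (hp : SmoothNear 𝓘(ℝ, E) 𝓘(ℝ, F) p u) :
    ∀ᶠ w in 𝓝 u, ∀ k : E, fderiv ℝ (SingAlg.inCharts E F p u) (extChartAt 𝓘(ℝ, E) u w)
        (mfderiv 𝓘(ℝ, E) 𝓘(ℝ, E) (extChartAt 𝓘(ℝ, E) u) w k) =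
      mfderiv 𝓘(ℝ, F) 𝓘(ℝ, F) (extChartAt 𝓘(ℝ, F) (p u)) (p w)
        (mfderiv 𝓘(ℝ, E) 𝓘(ℝ, F) p w k) := by
  have hc := smoothNear_iff_contDiffAt.1 hp.inCharts
  filter_upwards [hp, (eventually_extChartAt_left_inv (E := E) u).eventually_nhds,
    (smoothNear_extChartAt (E := E) u).continuousAt.eventually hc,
    smoothNear_extChartAt (E := E) u,
    hp.continuousAt.eventually (smoothNear_extChartAt (E := F) (p u))] with w h1 h2 h3 h4 h5 k
  have hA := HasMFDerivAt.comp w (h3.differentiableAt (by simp)).hasFDerivAt.hasMFDerivAt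
    (h4.mdifferentiableAt (by simp)).hasMFDerivAt
  have hB := HasMFDerivAt.comp w (h5.mdifferentiableAt (by simp)).hasMFDerivAt
    (h1.mdifferentiableAt (by simp)).hasMFDerivAt
  have hAB := hasMFDerivAt_unique (hA.congr_of_eventuallyEq (f₁ := extChartAt 𝓘(ℝ, F) (p u) ∘ p)
    (by filter_upwards [h2] with y hy; simp only [Function.comp, SingAlg.inCharts, hy])) hB
  exact congrArg (fun T : E →L[ℝ] F => T k) hAB

/-- Near a point where `p` is a submersion, the module of vertical vector fields is generated by
finitely many compactly supported ones, with coefficients vanishing at `u` for a field vanishing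
at `u`. -/
theorem exists_vertical_generators [FiniteDimensional ℝ E] [FiniteDimensional ℝ F] [T2Space N]
    {p : N → P} {u : N} (hp : SmoothNear 𝓘(ℝ, E) 𝓘(ℝ, F) p u)
    (hs : Function.Surjective (mfderiv 𝓘(ℝ, E) 𝓘(ℝ, F) p u)) :
    ∃ (d : ℕ) (W : Fin d → ∀ w : N, TangentSpace 𝓘(ℝ, E) w),
      (∀ a, W a ∈ verticalFields (E := E) (F := F) p) ∧
      (∀ k : TangentSpace 𝓘(ℝ, E) u, mfderiv 𝓘(ℝ, E) 𝓘(ℝ, F) p u k = 0 →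
        ∃ r : Fin d → ℝ, k = ∑ a, r a • W a u) ∧
      ∀ Z : ∀ w : N, TangentSpace 𝓘(ℝ, E) w, IsSmoothField Z →
        (∀ w, mfderiv 𝓘(ℝ, E) 𝓘(ℝ, F) p w (Z w) = 0) → Z u = 0 →
        ∃ (χ : C^∞⟮𝓘(ℝ, E), N; ℝ⟯) (f : Fin d → C^∞⟮𝓘(ℝ, E), N; ℝ⟯), χ u = 1 ∧
          (∀ a, f a u = 0) ∧ ∀ w, χ w • Z w = ∑ a, f a w • W a w := by
  set e := extChartAt 𝓘(ℝ, E) u with he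
  have hDu := hasFDerivAt_inCharts hp.mdifferentiableAt
  have hDu' : fderiv ℝ (inCharts E F p u) (e u) = (mfderiv 𝓘(ℝ, E) 𝓘(ℝ, F) p u : E →L[ℝ] F) :=
    HasFDerivAt.fderiv (𝕜 := ℝ) (E := E) (F := F) hDu
  obtain ⟨R, hRs, hR0, hR1⟩ := exists_smooth_ker_projection
    (smoothNear_iff_contDiffAt.1 hp.inCharts) (fun y => by
      obtain ⟨z, hz⟩ := hs y
      exact ⟨z, (congrArg (fun T : E →L[ℝ] F => T z) hDu').trans hz⟩)
  let b := Module.finBasis ℝ E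
  let d := Module.finrank ℝ E
  let W₀ : Fin d → ∀ w : N, TangentSpace 𝓘(ℝ, E) w := fun a => fieldOfChart u (fun z => R z (b a))
  have hW₀ : ∀ a, SmoothFieldNear (W₀ a) u := fun a => by
    refine smoothFieldNear_fieldOfChart (smoothNear_iff_contDiffAt.2 ?_)
    filter_upwards [hRs] with z hz using hz.clm_apply contDiffAt_const
  have hpd := hp.eventually_fderiv_inCharts
  have hsrc : ∀ᶠ w in 𝓝 u, w ∈ (chartAt E u).source :=
    (chartAt E u).open_source.mem_nhds (mem_chart_source E u)
  have hsrc' : ∀ᶠ w in 𝓝 u, p w ∈ (chartAt F (p u)).source :=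
    hp.continuousAt.eventually ((chartAt F (p u)).open_source.mem_nhds (mem_chart_source F (p u)))
  have hvert : ∀ᶠ w in 𝓝 u, ∀ k : TangentSpace 𝓘(ℝ, E) w,
      mfderiv 𝓘(ℝ, E) 𝓘(ℝ, F) p w k = 0 ↔ fderiv ℝ (inCharts E F p u) (e w)
        (mfderiv 𝓘(ℝ, E) 𝓘(ℝ, E) e w k) = 0 := by
    filter_upwards [hpd, hsrc'] with w hw hw' k
    have h1 := hw k
    have h2 := (isInvertible_mfderiv_extChartAt (I := 𝓘(ℝ, F)) (x := p u) (y := p w)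
      (by rwa [extChartAt_source])).bijective.1
    rw [he, h1]
    constructor
    · intro h
      rw [h]
      exact map_zero (mfderiv 𝓘(ℝ, F) 𝓘(ℝ, F) (extChartAt 𝓘(ℝ, F) (p u)) (p w))
    · intro h
      exact h2 (h.trans (map_zero (mfderiv 𝓘(ℝ, F) 𝓘(ℝ, F) (extChartAt 𝓘(ℝ, F) (p u)) (p w))).symm)
  have hW₀v : ∀ᶠ w in 𝓝 u, ∀ a, mfderiv 𝓘(ℝ, E) 𝓘(ℝ, F) p w (W₀ a w) = 0 := by
    filter_upwards [hvert, hsrc, (smoothNear_extChartAt (E := E) u).continuousAt.eventually hR0]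
      with w h1 h2 h3 a
    rw [h1, mfderiv_fieldOfChart u _ h2]
    exact h3 (b a)
  obtain ⟨χ, hχs, hχ1, hχ⟩ := SmoothFieldNear.exists_cutoff hW₀ hW₀v
  -- the coordinates of a vertical field in a basis of `E` are its coefficients
  have hcoef : ∀ᶠ w in 𝓝 u, ∀ k : TangentSpace 𝓘(ℝ, E) w,
      mfderiv 𝓘(ℝ, E) 𝓘(ℝ, F) p w k = 0 →
      k = ∑ a, b.repr (mfderiv 𝓘(ℝ, E) 𝓘(ℝ, E) e w k : E) a • (χ w • W₀ a w) := by
    filter_upwards [hvert, hsrc, hχ1] with w h1 h2 h3 k hk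
    have h4 := hR1 (e w) _ ((h1 k).1 hk)
    have h5 := (isInvertible_mfderiv_extChartAt (I := 𝓘(ℝ, E)) (x := u) (y := w)
      (by rwa [extChartAt_source])).bijective.1
    apply h5
    rw [map_sum]
    have h6 : ∀ a, mfderiv 𝓘(ℝ, E) 𝓘(ℝ, E) e w
        (b.repr (mfderiv 𝓘(ℝ, E) 𝓘(ℝ, E) e w k : E) a • (χ w • W₀ a w)) =
        R (e w) (b.repr (mfderiv 𝓘(ℝ, E) 𝓘(ℝ, E) e w k : E) a • b a) := by
      intro a
      rw [h3, one_smul, map_smul, mfderiv_fieldOfChart u _ h2, map_smul]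
      rfl
    refine Eq.trans ?_ (Finset.sum_congr rfl fun a _ => (h6 a).symm)
    have h7 := map_sum (R (e w))
      (fun a => b.repr (mfderiv 𝓘(ℝ, E) 𝓘(ℝ, E) e w k : E) a • b a) Finset.univ
    refine Eq.trans ?_ h7
    exact h4.symm.trans
      (congrArg (R (e w)) (b.sum_repr (mfderiv 𝓘(ℝ, E) 𝓘(ℝ, E) e w k : E)).symm)
  refine ⟨d, fun a w => χ w • W₀ a w, fun a => ⟨(hχ a).1, (hχ a).2, fun w => ?_⟩, ?_, ?_⟩
  · change mfderiv 𝓘(ℝ, E) 𝓘(ℝ, F) p w (χ w • W₀ a w) = 0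
    by_cases hw : w ∈ tsupport χ
    · rw [map_smul, hχs hw a]
      exact smul_zero (χ w)
    · rw [image_eq_zero_of_notMem_tsupport hw, zero_smul, map_zero]
  · intro k hk
    exact ⟨_, hcoef.self_of_nhds k hk⟩
  · intro Z hZ hZv hZu
    have hZc : SmoothNear 𝓘(ℝ, E) 𝓘(ℝ, E) (fun w => fieldInChart Z u (e w)) u :=
      (hZ.smoothFieldNear u).fieldInChart.comp (smoothNear_extChartAt u)
    have hrep : ∀ a, SmoothNear 𝓘(ℝ, E) 𝓘(ℝ, ℝ) (fun w => b.repr (fieldInChart Z u (e w)) a) u := by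
      intro a
      have h1 : ContDiff ℝ ∞ (fun z : E => b.repr z a) :=
        (LinearMap.toContinuousLinearMap (b.coord a)).contDiff
      exact SmoothNear.comp (g := fun z : E => b.repr z a)
        (ContMDiff.smoothNear h1.contMDiff _) hZc
    choose g hgs hg using fun a => (hrep a).exists_global
    obtain ⟨ψ, -, hψs, hψ1⟩ := SingAlg.exists_cutoff (E := E)
      (hcoef.and ((eventually_extChartAt_left_inv (E := E) u).and (eventually_all.2 hg)))
    have hψu : ψ u = 1 := hψ1.self_of_nhds
    refine ⟨ψ, fun a => ψ * ⟨g a, hgs a⟩, hψu, fun a => ?_, fun w => ?_⟩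
    · have h1 : g a u = 0 := by
        have h2 : fieldInChart Z u (e u) = 0 := (fieldInChart_self Z u).trans hZu
        rw [(hg a).self_of_nhds]
        change b.repr (fieldInChart Z u (e u)) a = 0
        rw [h2, map_zero]
        rfl
      change ψ u * g a u = 0
      rw [h1, mul_zero]
    · by_cases hw : w ∈ tsupport ψ
      · obtain ⟨h1, h2, h3⟩ := hψs hw
        have h4 := h1 (Z w) (hZv w)
        have h5 : ∀ a, g a w = b.repr (mfderiv 𝓘(ℝ, E) 𝓘(ℝ, E) e w (Z w) : E) a := by
          intro a
          have h6 : fieldInChart Z u (e w) = mfderiv 𝓘(ℝ, E) 𝓘(ℝ, E) e w (Z w) := by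
            rw [SingAlg.fieldInChart, he, h2]
          exact (h3 a).trans (congrArg (fun k : E => b.repr k a) h6)
        refine (congrArg (fun k => ψ w • k) h4).trans ?_
        rw [Finset.smul_sum]
        refine Finset.sum_congr rfl fun a _ => ?_
        rw [smul_smul, ← h5 a]
        rfl
      · have h0 := image_eq_zero_of_notMem_tsupport hw
        have h1 : ∀ a, (ψ * ⟨g a, hgs a⟩ : C^∞⟮𝓘(ℝ, E), N; ℝ⟯) w = 0 := fun a => by
          change ψ w * g a w = 0
          rw [h0, zero_mul]
        rw [h0, zero_smul]
        exact (Finset.sum_eq_zero fun a _ => by rw [h1 a, zero_smul]).symm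

end Vertical

section Transversal

/-- Two surjective linear maps with the same source and target have a common section up to an
isomorphism: a right inverse of `A` whose composition with `B` is onto. -/
theorem exists_rightInverse_surjective_comp {E F : Type*} [AddCommGroup E] [Module ℝ E]
    [AddCommGroup F] [Module ℝ F] [FiniteDimensional ℝ F] (A B : E →ₗ[ℝ] F)
    (hA : Function.Surjective A) (hB : Function.Surjective B) :
    ∃ L : F →ₗ[ℝ] E, (∀ y, A (L y) = y) ∧ Function.Surjective (B ∘ₗ L) := by
  obtain ⟨L₀, hL₀⟩ := A.exists_rightInverse_of_surjective (LinearMap.range_eq_top.2 hA)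
  have hL₀' : ∀ y, A (L₀ y) = y := fun y => congrArg (fun T : F →ₗ[ℝ] F => T y) hL₀
  set C := B ∘ₗ L₀ with hC
  -- a correction `T` with values in `B (ker A)`, an isomorphism from `ker C` to a complement
  -- of `range C`
  obtain ⟨K, hK⟩ := Submodule.exists_isCompl (LinearMap.ker C)
  have hcod : ∀ y, ∃ k, A k = 0 ∧ ∃ z, B k + C z = y := by
    intro y
    obtain ⟨w, hw⟩ := hB y
    refine ⟨w - L₀ (A w), by simp [hL₀'], A w, ?_⟩
    simp [hC, hw]
  obtain ⟨S, hS⟩ := Submodule.exists_isCompl (LinearMap.range C)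
  have hdim : Module.finrank ℝ (LinearMap.ker C) = Module.finrank ℝ (F ⧸ LinearMap.range C) := by
    have h1 := C.finrank_range_add_finrank_ker
    have h2 := (LinearMap.range C).finrank_quotient_add_finrank
    omega
  let q : (LinearMap.ker C) ≃ₗ[ℝ] (F ⧸ LinearMap.range C) := LinearEquiv.ofFinrankEq _ _ hdim
  let Φ : LinearMap.ker A →ₗ[ℝ] (F ⧸ LinearMap.range C) :=
    (LinearMap.range C).mkQ ∘ₗ B ∘ₗ (LinearMap.ker A).subtype
  have hΦ : Function.Surjective Φ := by
    intro y
    obtain ⟨y, rfl⟩ := Submodule.mkQ_surjective _ y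
    obtain ⟨k, hk, z, hz⟩ := hcod y
    refine ⟨⟨k, hk⟩, ?_⟩
    change (LinearMap.range C).mkQ (B k) = _
    rw [← hz, map_add]
    have : (LinearMap.range C).mkQ (C z) = 0 := by simp
    rw [this, add_zero]
  obtain ⟨s, hs⟩ := Φ.exists_rightInverse_of_surjective (LinearMap.range_eq_top.2 hΦ)
  let pr : F →ₗ[ℝ] LinearMap.ker C := Submodule.projectionOnto _ K hK
  let M : F →ₗ[ℝ] E := (LinearMap.ker A).subtype ∘ₗ s ∘ₗ q.toLinearMap ∘ₗ pr
  have hAM : ∀ y, A (M y) = 0 := fun y => (s (q (pr y))).2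
  have hBM : ∀ y, (LinearMap.range C).mkQ (B (M y)) = q (pr y) := fun y =>
    congrArg (fun T : (F ⧸ LinearMap.range C) →ₗ[ℝ] _ => T (q (pr y))) hs
  refine ⟨L₀ + M, fun y => by simp [hL₀', hAM], ?_⟩
  rw [← LinearMap.injective_iff_surjective, injective_iff_map_eq_zero]
  intro y hy
  have h1 : C y + B (M y) = 0 := by simpa [hC] using hy
  have h2 : q (pr y) = 0 := by
    have h0 : (LinearMap.range C).mkQ (C y) = 0 := by simp
    have h1' := (map_add (LinearMap.range C).mkQ (C y) (B (M y))).symm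
    rwa [h1, map_zero, h0, zero_add, hBM] at h1'
  have h3 : pr y = 0 := by simpa using h2
  have h4 : M y = 0 := by simp [M, h3]
  rw [h4, map_zero, add_zero] at h1
  have h5 : pr y = ⟨y, h1⟩ := Submodule.projectionOnto_apply_left hK ⟨y, h1⟩
  rw [h3] at h5
  exact (congrArg Subtype.val h5).symm

variable {E F : Type*} [NormedAddCommGroup E] [NormedSpace ℝ E] [FiniteDimensional ℝ E]
  [NormedAddCommGroup F]
  [NormedSpace ℝ F] [FiniteDimensional ℝ F] {N P : Type*} [TopologicalSpace N] [ChartedSpace E N]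
  [TopologicalSpace P] [ChartedSpace F P]
  [IsManifold 𝓘(ℝ, E) ∞ N] [IsManifold 𝓘(ℝ, F) ∞ P]

/-- Through each point there is a local section of the submersion `p` that is transversal to the
fibres of a second submersion `q`: the germ of a bisection. -/
theorem exists_transversal_section {p q : N → P} {u : N}
    (hp : SmoothNear 𝓘(ℝ, E) 𝓘(ℝ, F) p u) (hq : SmoothNear 𝓘(ℝ, E) 𝓘(ℝ, F) q u)
    (hps : Function.Surjective (mfderiv 𝓘(ℝ, E) 𝓘(ℝ, F) p u))
    (hqs : Function.Surjective (mfderiv 𝓘(ℝ, E) 𝓘(ℝ, F) q u)) :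
    ∃ β : P → N, SmoothNear 𝓘(ℝ, F) 𝓘(ℝ, E) β (p u) ∧ β (p u) = u ∧
      (∀ᶠ y in 𝓝 (p u), p (β y) = y) ∧
      Function.Surjective (mfderiv 𝓘(ℝ, F) 𝓘(ℝ, F) (fun y => q (β y)) (p u)) := by
  have : CompleteSpace E := FiniteDimensional.complete ℝ E
  obtain ⟨π, hπs, hπ0, hπ1, hπ2⟩ := exists_fiber_retraction hp hps
  set c := extChartAt 𝓘(ℝ, F) (p u) with hc
  set e := extChartAt 𝓘(ℝ, E) u with he
  let Dp : E →L[ℝ] F := mfderiv 𝓘(ℝ, E) 𝓘(ℝ, F) p u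
  let Dq : E →L[ℝ] F := mfderiv 𝓘(ℝ, E) 𝓘(ℝ, F) q u
  obtain ⟨L₀, hL₀, hL₀'⟩ := exists_rightInverse_surjective_comp Dp.toLinearMap Dq.toLinearMap
    hps hqs
  let L : F →L[ℝ] E := LinearMap.toContinuousLinearMap L₀
  -- the affine section in charts, retracted onto the fibres of `p`
  let s : P → N := fun y => e.symm (e u + L (c y - c (p u)))
  have hs0 : s (p u) = u := by simp [s, he]
  let A : F → E := fun z => e u + L (z - c (p u))
  have hA : ContDiff ℝ ∞ A := contDiff_const.add (L.contDiff.comp (contDiff_id.sub contDiff_const))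
  have hA0 : A (c (p u)) = e u := by simp [A]
  have hs : SmoothNear 𝓘(ℝ, F) 𝓘(ℝ, E) s (p u) := by
    refine SmoothNear.comp (g := e.symm) ?_ (SmoothNear.comp (g := A)
      (ContMDiff.smoothNear hA.contMDiff _) (smoothNear_extChartAt (p u)))
    have hA0' : e u + L (c (p u) - c (p u)) = e u := hA0
    rw [hA0']
    exact smoothNear_extChartAt_symm u
  have hsd : HasMFDerivAt 𝓘(ℝ, F) 𝓘(ℝ, E) s (p u) L := by
    have h1 : HasMFDerivAt 𝓘(ℝ, F) 𝓘(ℝ, F) c (p u) (ContinuousLinearMap.id ℝ F) := by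
      have h := (smoothNear_extChartAt (E := F) (p u)).mdifferentiableAt.hasMFDerivAt
      rwa [mfderiv_extChartAt_self] at h
    have h2 : HasMFDerivAt 𝓘(ℝ, E) 𝓘(ℝ, E) e.symm (A (c (p u))) (ContinuousLinearMap.id ℝ E) := by
      have h := (smoothNear_extChartAt_symm (E := E) u).mdifferentiableAt.hasMFDerivAt
      rw [mfderiv_extChartAt_symm_self] at h
      rw [hA0]
      exact h
    have h3 : HasFDerivAt A L (c (p u)) := by
      have := ((L.hasFDerivAt (x := c (p u))).sub_const (L (c (p u)))).const_add (e u)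
      exact this.congr_of_eventuallyEq (Eventually.of_forall fun z => by simp [A])
    exact h2.comp (p u) (HasMFDerivAt.comp (p u) h3.hasMFDerivAt h1)
  have hin : SmoothNear 𝓘(ℝ, F) (𝓘(ℝ, F).prod 𝓘(ℝ, E)) (fun y => (y, s y)) (p u) :=
    SmoothNear.prodMk (ContMDiff.smoothNear contMDiff_id _) hs
  refine ⟨fun y => π (y, s y), ?_, by simp only [hs0, hπ0], ?_, ?_⟩
  · exact SmoothNear.comp (g := π) (by rwa [hs0]) hin
  · have h1 : ∀ᶠ q in 𝓝 (p u, s (p u)), p (π q) = q.1 := by rwa [hs0]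
    exact hin.continuousAt.eventually h1
  · -- `β` and `s` have the same derivative, as `π (p h, h) = h` and `dp ∘ L = id`
    set D := mfderiv (𝓘(ℝ, F).prod 𝓘(ℝ, E)) 𝓘(ℝ, E) π (p u, u) with hDdef
    have hD : HasMFDerivAt (𝓘(ℝ, F).prod 𝓘(ℝ, E)) 𝓘(ℝ, E) π (p u, u) D :=
      hπs.mdifferentiableAt.hasMFDerivAt
    have hDk : ∀ k : E, D (mfderiv 𝓘(ℝ, E) 𝓘(ℝ, F) p u k, k) = k := by
      intro k
      have h1 : HasMFDerivAt 𝓘(ℝ, E) 𝓘(ℝ, E) (fun h => π (p h, h)) u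
          (D.comp ((mfderiv 𝓘(ℝ, E) 𝓘(ℝ, F) p u).prod (ContinuousLinearMap.id ℝ _))) :=
        HasMFDerivAt.comp (g := π) u hD
          (hp.mdifferentiableAt.hasMFDerivAt.prodMk (hasMFDerivAt_id u))
      have h2 : HasMFDerivAt 𝓘(ℝ, E) 𝓘(ℝ, E) (fun h => π (p h, h)) u
          (ContinuousLinearMap.id ℝ _) := (hasMFDerivAt_id u).congr_of_eventuallyEq hπ2
      exact congrArg (fun T : E →L[ℝ] E => T k) (hasMFDerivAt_unique h1 h2)
    have h1 : HasMFDerivAt 𝓘(ℝ, F) 𝓘(ℝ, E) (fun y => π (y, s y)) (p u)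
        (D.comp ((ContinuousLinearMap.id ℝ _).prod L)) :=
      HasMFDerivAt.comp (g := π) (g' := D) (p u) (by rw [hs0]; exact hD)
        ((hasMFDerivAt_id (p u)).prodMk hsd)
    have h2 : HasMFDerivAt 𝓘(ℝ, E) 𝓘(ℝ, F) q (π (p u, s (p u))) (mfderiv 𝓘(ℝ, E) 𝓘(ℝ, F) q u) := by
      rw [hs0, hπ0]
      exact hq.mdifferentiableAt.hasMFDerivAt
    have h3 := HasMFDerivAt.comp (g := q) (p u) h2 h1
    have h4 : mfderiv 𝓘(ℝ, F) 𝓘(ℝ, F) (fun y => q (π (y, s y))) (p u) = _ := h3.mfderiv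
    rw [h4]
    intro y
    obtain ⟨z, hz⟩ := hL₀' y
    refine ⟨z, Eq.trans ?_ hz⟩
    have h5 := hDk (L z)
    have h6 : mfderiv 𝓘(ℝ, E) 𝓘(ℝ, F) p u (L z) = z := hL₀ z
    rw [h6] at h5
    exact congrArg (fun k : E => (mfderiv 𝓘(ℝ, E) 𝓘(ℝ, F) q u k : F)) h5

end Transversal

/-! ### Velocities of curves -/

section Velocity

variable {E F : Type*} [NormedAddCommGroup E] [NormedSpace ℝ E] [NormedAddCommGroup F]
  [NormedSpace ℝ F] {N P : Type*} [TopologicalSpace N] [ChartedSpace E N]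
  [TopologicalSpace P] [ChartedSpace F P]

/-- The curve `c` has velocity `v` at time `τ`. -/
def HasVelocity (E : Type*) [NormedAddCommGroup E] [NormedSpace ℝ E] {N : Type*}
    [TopologicalSpace N] [ChartedSpace E N] (c : ℝ → N) (v : E) (τ : ℝ) : Prop :=
  HasMFDerivAt 𝓘(ℝ, ℝ) 𝓘(ℝ, E) c τ ((1 : ℝ →L[ℝ] ℝ).smulRight v)

theorem HasVelocity.unique {c : ℝ → N} {v w : E} {τ : ℝ} (hv : HasVelocity E c v τ)
    (hw : HasVelocity E c w τ) : v = w := by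
  have h : (1 : ℝ) • v = (1 : ℝ) • w :=
    congrArg (fun T : ℝ →L[ℝ] E => T 1) (hasMFDerivAt_unique hv hw)
  simpa using h

theorem HasVelocity.continuousAt {c : ℝ → N} {v : E} {τ : ℝ} (hv : HasVelocity E c v τ) :
    ContinuousAt c τ := HasMFDerivAt.continuousAt hv

theorem HasVelocity.congr {c c' : ℝ → N} {v : E} {τ : ℝ} (hv : HasVelocity E c v τ)
    (h : c' =ᶠ[𝓝 τ] c) : HasVelocity E c' v τ := by
  have h1 : HasMFDerivAt 𝓘(ℝ, ℝ) 𝓘(ℝ, E) c τ ((1 : ℝ →L[ℝ] ℝ).smulRight v) := hv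
  have h2 := h1.congr_of_eventuallyEq h
  exact h2

theorem HasVelocity.comp {c : ℝ → N} {v : E} {τ : ℝ} (hv : HasVelocity E c v τ) {f : N → P}
    (hf : MDifferentiableAt 𝓘(ℝ, E) 𝓘(ℝ, F) f (c τ)) :
    HasVelocity F (fun τ => f (c τ)) (mfderiv 𝓘(ℝ, E) 𝓘(ℝ, F) f (c τ) v) τ := by
  refine (HasMFDerivAt.comp τ hf.hasMFDerivAt hv).congr_mfderiv
    (ContinuousLinearMap.ext fun (r : ℝ) => ?_)
  exact map_smul (mfderiv 𝓘(ℝ, E) 𝓘(ℝ, F) f (c τ)) r v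

theorem HasVelocity.comp_within {c : ℝ → N} {v : E} {τ : ℝ} (hv : HasVelocity E c v τ) {f : N → P}
    {S : Set N} {f' : E →L[ℝ] F} (hf : HasMFDerivWithinAt 𝓘(ℝ, E) 𝓘(ℝ, F) f S (c τ) f')
    (hS : ∀ᶠ σ in 𝓝 τ, c σ ∈ S) : HasVelocity F (fun τ => f (c τ)) (f' v) τ := by
  have h1 := HasMFDerivWithinAt.comp τ hf (HasMFDerivAt.hasMFDerivWithinAt (s := c ⁻¹' S) hv)
    (Subset.refl _)
  refine (h1.hasMFDerivAt hS).congr_mfderiv (ContinuousLinearMap.ext fun (r : ℝ) => ?_)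
  exact map_smul f' r v

theorem hasVelocity_const (g : N) (τ : ℝ) : HasVelocity E (fun _ => g) (0 : E) τ := by
  refine (hasMFDerivAt_const g τ).congr_mfderiv (ContinuousLinearMap.ext fun (r : ℝ) => ?_)
  exact (smul_zero r).symm

theorem HasVelocity.comp_affine {c : ℝ → N} {v : E} {a b τ : ℝ}
    (hv : HasVelocity E c v (a * τ + b)) : HasVelocity E (fun τ => c (a * τ + b)) (a • v) τ := by
  have h1 : HasFDerivAt (fun τ : ℝ => a * τ + b) ((1 : ℝ →L[ℝ] ℝ).smulRight a) τ := by
    have := ((hasDerivAt_id τ).const_mul a).add_const b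
    have h2 := this.hasFDerivAt
    refine h2.congr_fderiv (ContinuousLinearMap.ext fun r => ?_)
    simp
  refine (HasMFDerivAt.comp (g := c) (f := fun τ : ℝ => a * τ + b)
    (g' := (1 : ℝ →L[ℝ] ℝ).smulRight v) τ hv h1.hasMFDerivAt).congr_mfderiv
    (ContinuousLinearMap.ext fun (r : ℝ) => ?_)
  exact mul_smul r a v

theorem HasVelocity.comp_add {c : ℝ → N} {v : E} {b τ : ℝ} (hv : HasVelocity E c v (τ + b)) :
    HasVelocity E (fun τ => c (τ + b)) v τ := by
  have h := HasVelocity.comp_affine (E := E) (c := c) (v := v) (a := 1) (b := b) (τ := τ)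
    (by rwa [one_mul])
  simpa using h

/-- A curve with zero velocity is constant. -/
theorem eqOn_of_hasVelocity_zero [T2Space N] [CompleteSpace E] [IsManifold 𝓘(ℝ, E) ∞ N]
    {c : ℝ → N} {a b : ℝ}
    (hc : ∀ τ ∈ Ioo a b, HasVelocity E c (0 : E) τ) {τ τ₀ : ℝ} (hτ : τ ∈ Ioo a b)
    (hτ₀ : τ₀ ∈ Ioo a b) : c τ = c τ₀ := by
  have : IsManifold 𝓘(ℝ, E) 1 N := IsManifold.of_le (n := ∞) (by simp)
  have hv : ContMDiff 𝓘(ℝ, E) 𝓘(ℝ, E).tangent 1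
      (fun x => (⟨x, (0 : E)⟩ : TangentBundle 𝓘(ℝ, E) N)) :=
    Bundle.contMDiff_zeroSection ℝ (TangentSpace 𝓘(ℝ, E) : N → Type _)
  exact isMIntegralCurveOn_Ioo_eqOn_of_contMDiff_boundaryless (γ := c) (γ' := fun _ => c τ₀)
    (v := fun _ => (0 : E)) hτ₀ hv (fun σ hσ => (hc σ hσ).hasMFDerivWithinAt)
    (fun σ hσ => (hasVelocity_const (c τ₀) σ).hasMFDerivWithinAt) rfl hτ

end Velocity

/-! ### Right translations and right-invariant vector fields -/

section Groupoid

variable {EG EM G M : Type*} [NormedAddCommGroup EG] [NormedSpace ℝ EG] [FiniteDimensional ℝ EG]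
  [NormedAddCommGroup EM] [NormedSpace ℝ EM] [FiniteDimensional ℝ EM]
  [TopologicalSpace G] [ChartedSpace EG G] [IsManifold 𝓘(ℝ, EG) ∞ G]
  [TopologicalSpace M] [ChartedSpace EM M] [IsManifold 𝓘(ℝ, EM) ∞ M]
  (𝒢 : LieGroupoid EG EM G M)

namespace LieGroupoid

theorem smoothNear_s (g : G) : SmoothNear 𝓘(ℝ, EG) 𝓘(ℝ, EM) 𝒢.s g :=
  ContMDiffOn.smoothNear 𝒢.submersion_s.1 isOpen_univ (mem_univ g)

theorem smoothNear_t (g : G) : SmoothNear 𝓘(ℝ, EG) 𝓘(ℝ, EM) 𝒢.t g :=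
  ContMDiffOn.smoothNear 𝒢.submersion_t.1 isOpen_univ (mem_univ g)

/-- The product of two smooth maps that are composable near a point. -/
theorem smoothNear_mul {E' H' N : Type*} [NormedAddCommGroup E'] [NormedSpace ℝ E']
    [TopologicalSpace H'] {I : ModelWithCorners ℝ E' H'} [TopologicalSpace N] [ChartedSpace H' N]
    {f k : N → G} {x : N} (hf : SmoothNear I 𝓘(ℝ, EG) f x) (hk : SmoothNear I 𝓘(ℝ, EG) k x)
    (h : ∀ᶠ y in 𝓝 x, 𝒢.s (f y) = 𝒢.t (k y)) :
    SmoothNear I 𝓘(ℝ, EG) (fun y => 𝒢.mul (f y) (k y)) x := by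
  filter_upwards [hf, hk, h.eventually_nhds] with y hy hy' hy''
  have h1 := ContMDiffWithinAt.comp y (𝒢.smooth_mul (f y, k y) hy''.self_of_nhds)
    (f := fun y => (f y, k y)) (s := {y | 𝒢.s (f y) = 𝒢.t (k y)})
    (hy.prodMk hy').contMDiffWithinAt (fun _ h => h)
  exact h1.contMDiffAt hy''

/-- Right translation, a map between fibres, extends to a map that is smooth jointly in both
factors. -/
theorem exists_mul_extension {g h₀ : G} (h : 𝒢.s h₀ = 𝒢.t g) :
    ∃ R : G × G → G, SmoothNear (𝓘(ℝ, EG).prod 𝓘(ℝ, EG)) 𝓘(ℝ, EG) R (g, h₀) ∧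
      ∀ᶠ k in 𝓝 h₀, ∀ g', 𝒢.s k = 𝒢.t g' → R (g', k) = 𝒢.mul k g' := by
  have : CompleteSpace EG := FiniteDimensional.complete ℝ EG
  obtain ⟨π, hπs, hπ0, hπ1, hπ2⟩ := exists_fiber_retraction (𝒢.smoothNear_s h₀)
    (𝒢.submersion_s.2 h₀ (mem_univ _))
  rw [h] at hπs hπ0 hπ1
  have h1 : SmoothNear (𝓘(ℝ, EG).prod 𝓘(ℝ, EG)) (𝓘(ℝ, EM).prod 𝓘(ℝ, EG))
      (fun q : G × G => (𝒢.t q.1, q.2)) (g, h₀) :=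
    SmoothNear.prodMk (SmoothNear.comp (g := 𝒢.t) (f := Prod.fst) (𝒢.smoothNear_t g)
      (ContMDiff.smoothNear contMDiff_fst _)) (ContMDiff.smoothNear contMDiff_snd _)
  refine ⟨fun q => 𝒢.mul (π (𝒢.t q.1, q.2)) q.1, ?_, ?_⟩
  · exact 𝒢.smoothNear_mul (SmoothNear.comp (g := π) hπs h1)
      (ContMDiff.smoothNear contMDiff_fst _) (h1.continuousAt.eventually hπ1)
  · filter_upwards [hπ2] with k hk g' hg'
    rw [← hg', hk]

/-- Right translation is differentiable on source fibres. -/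
theorem hasMFDerivWithinAt_mul_right {g h₀ : G} (h : 𝒢.s h₀ = 𝒢.t g) :
    HasMFDerivWithinAt 𝓘(ℝ, EG) 𝓘(ℝ, EG) (fun k => 𝒢.mul k g) {k | 𝒢.s k = 𝒢.t g} h₀
      (mfderivWithin 𝓘(ℝ, EG) 𝓘(ℝ, EG) (fun k => 𝒢.mul k g) {k | 𝒢.s k = 𝒢.t g} h₀) := by
  obtain ⟨R, hR, hR'⟩ := 𝒢.exists_mul_extension h
  have h1 : MDifferentiableAt 𝓘(ℝ, EG) 𝓘(ℝ, EG) (fun k => R (g, k)) h₀ :=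
    MDifferentiableAt.comp (g := R) h₀ hR.mdifferentiableAt
      (mdifferentiableAt_const.prodMk mdifferentiableAt_id)
  refine MDifferentiableWithinAt.hasMFDerivWithinAt ?_
  refine (h1.hasMFDerivAt.hasMFDerivWithinAt.congr_of_eventuallyEq ?_
    (hR'.self_of_nhds g h).symm).mdifferentiableWithinAt
  filter_upwards [mem_nhdsWithin_of_mem_nhds hR', self_mem_nhdsWithin] with k hk hk'
  exact (hk g hk').symm

/-- The velocity of a right translated curve. -/
theorem hasVelocity_mul_right {c : ℝ → G} {v : EG} {τ : ℝ} (hv : HasVelocity EG c v τ) {g : G}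
    (h : ∀ᶠ σ in 𝓝 τ, 𝒢.s (c σ) = 𝒢.t g) :
    HasVelocity EG (fun σ => 𝒢.mul (c σ) g) (mfderivWithin 𝓘(ℝ, EG) 𝓘(ℝ, EG) (fun k => 𝒢.mul k g)
      {k | 𝒢.s k = 𝒢.t g} (c τ) v) τ :=
  hv.comp_within (𝒢.hasMFDerivWithinAt_mul_right h.self_of_nhds) h

theorem mul_mul_inv {h g : G} (hg : 𝒢.s h = 𝒢.t g) : 𝒢.mul (𝒢.mul h g) (𝒢.inv g) = h := by
  rw [𝒢.mul_assoc h g _ hg (𝒢.t_inv g).symm, 𝒢.mul_inv, ← hg, 𝒢.mul_one]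

variable {𝒢} {α : 𝒢.Sec}

/-- The defining property of the right-invariant field: `→α` at `g` is the velocity of `c g` for a
curve `c` in the source fibre of `1_{t g}` with velocity `α (t g)`. -/
theorem Sec.IsSection.exists_curve (hα : α.IsSection) (y : M) :
    ∃ c : ℝ → G, c 0 = 𝒢.one y ∧ (∀ᶠ τ in 𝓝 (0 : ℝ), 𝒢.s (c τ) = y) ∧ HasVelocity EG c (α y) 0 ∧
      ∀ g, 𝒢.t g = y → HasVelocity EG (fun τ => 𝒢.mul (c τ) g) (α.right g) 0 := by
  have : CompleteSpace EG := FiniteDimensional.complete ℝ EG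
  obtain ⟨c, hc0, hcs, hc⟩ := exists_fiber_curve (𝒢.smoothNear_s (𝒢.one y))
    (𝒢.submersion_s.2 _ (mem_univ _)) (α y) (hα.2 y)
  have hcs' : ∀ᶠ τ in 𝓝 (0 : ℝ), 𝒢.s (c τ) = y := by
    filter_upwards [hcs] with τ hτ
    rw [hτ, 𝒢.s_one]
  refine ⟨c, hc0, hcs', hc, ?_⟩
  rintro g rfl
  have h1 := 𝒢.hasVelocity_mul_right (v := α (𝒢.t g)) hc hcs'
  rw [hc0] at h1
  exact h1

theorem Sec.IsSection.eq_zero_of_right_eq_zero (hα : α.IsSection) {g : G} (h : α.right g = 0) :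
    α (𝒢.t g) = 0 := by
  obtain ⟨c, hc0, hcs, hc, hcg⟩ := hα.exists_curve (𝒢.t g)
  have h1 : HasVelocity EG (fun τ => 𝒢.mul (c τ) g) (0 : EG) 0 := by
    have := hcg g rfl
    rwa [h] at this
  have hs : ∀ᶠ τ in 𝓝 (0 : ℝ), 𝒢.s (𝒢.mul (c τ) g) = 𝒢.t (𝒢.inv g) := by
    filter_upwards [hcs] with τ hτ
    rw [𝒢.s_mul _ _ hτ, 𝒢.t_inv]
  have h2 := 𝒢.hasVelocity_mul_right h1 hs
  have h3 := h2.congr (c' := c) (by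
    filter_upwards [hcs] with τ hτ
    exact (𝒢.mul_mul_inv hτ).symm)
  exact (hc.unique h3).trans (map_zero _)

theorem Sec.IsSection.mfderiv_s_right (hα : α.IsSection) (g : G) :
    mfderiv 𝓘(ℝ, EG) 𝓘(ℝ, EM) 𝒢.s g (α.right g) = 0 := by
  obtain ⟨c, hc0, hcs, hc, hcg⟩ := hα.exists_curve (𝒢.t g)
  have h0 : 𝒢.mul (c 0) g = g := by rw [hc0, 𝒢.one_mul]
  have h1 := (hcg g rfl).comp (f := 𝒢.s) (𝒢.smoothNear_s _).mdifferentiableAt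
  have h2 := h1.congr (c' := fun _ => 𝒢.s g) (by
    filter_upwards [hcs] with τ hτ
    exact (𝒢.s_mul _ _ hτ).symm)
  have h3 := h2.unique (hasVelocity_const (𝒢.s g) 0)
  rw [h0] at h3
  exact h3

/-- Right invariance of `→α`. -/
theorem Sec.IsSection.mfderivWithin_mul_right (hα : α.IsSection) {h g : G} (hg : 𝒢.s h = 𝒢.t g) :
    mfderivWithin 𝓘(ℝ, EG) 𝓘(ℝ, EG) (fun k => 𝒢.mul k g) {k | 𝒢.s k = 𝒢.t g} h (α.right h) =
      α.right (𝒢.mul h g) := by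
  obtain ⟨c, hc0, hcs, hc, hcg⟩ := hα.exists_curve (𝒢.t h)
  have h0 : 𝒢.mul (c 0) h = h := by rw [hc0, 𝒢.one_mul]
  have h1 := 𝒢.hasVelocity_mul_right (hcg h rfl) (g := g) (by
    filter_upwards [hcs] with τ hτ
    rw [𝒢.s_mul _ _ hτ, hg])
  have h2 := h1.congr (c' := fun τ => 𝒢.mul (c τ) (𝒢.mul h g)) (by
    filter_upwards [hcs] with τ hτ
    exact (𝒢.mul_assoc _ _ _ hτ hg).symm)
  have h3 := h2.unique (hcg (𝒢.mul h g) (𝒢.t_mul h g hg))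
  rw [h0] at h3
  exact h3

/-- Right translates of integral curves of `→α` are integral curves. -/
theorem Sec.IsSection.hasVelocity_mul_right (hα : α.IsSection) {γ : ℝ → G} {τ : ℝ}
    (hγ : HasVelocity EG γ (α.right (γ τ)) τ) {g : G} (h : ∀ᶠ σ in 𝓝 τ, 𝒢.s (γ σ) = 𝒢.t g) :
    HasVelocity EG (fun σ => 𝒢.mul (γ σ) g) (α.right (𝒢.mul (γ τ) g)) τ := by
  have h1 := 𝒢.hasVelocity_mul_right hγ h
  have h2 : _ = (α.right (𝒢.mul (γ τ) g) : EG) := hα.mfderivWithin_mul_right h.self_of_nhds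
  rwa [h2] at h1

/-- Right-invariant vector fields are smooth. -/
theorem Sec.IsSection.isSmoothField_right (hα : α.IsSection) : IsSmoothField α.right := by
  intro g₀
  have : IsManifold 𝓘(ℝ, EG) 1 G := IsManifold.of_le (n := ∞) (by simp)
  obtain ⟨R, hR, hR'⟩ := 𝒢.exists_mul_extension (g := g₀) (h₀ := 𝒢.one (𝒢.t g₀)) (𝒢.s_one _)
  have ht : ContMDiff 𝓘(ℝ, EG) 𝓘(ℝ, EM) ∞ 𝒢.t := contMDiffOn_univ.1 𝒢.submersion_t.1
  have hot : ContMDiff 𝓘(ℝ, EG) 𝓘(ℝ, EG) ∞ (fun g => 𝒢.one (𝒢.t g)) := 𝒢.smooth_one.comp ht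
  -- `→α` is the image of `α ∘ t` under the partial derivative of the extended multiplication
  have h1 := ContMDiffAt.mfderiv (x₀ := g₀) (I := 𝓘(ℝ, EG)) (I' := 𝓘(ℝ, EG)) (J := 𝓘(ℝ, EG))
    (m := ∞) (n := ∞) (fun g k => R (g, k))
    (fun g => 𝒢.one (𝒢.t g)) hR.contMDiffAt hot.contMDiffAt (by simp)
  have h2 : ContMDiffAt 𝓘(ℝ, EG) 𝓘(ℝ, EG) ∞ (fun g => R (g, 𝒢.one (𝒢.t g))) g₀ :=
    ContMDiffAt.comp (g := R) g₀ hR.contMDiffAt (contMDiffAt_id.prodMk hot.contMDiffAt)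
  have h3 : ContMDiffAt 𝓘(ℝ, EG) 𝓘(ℝ, EG).tangent ∞
      (fun g => (⟨𝒢.one (𝒢.t g), α (𝒢.t g)⟩ : TangentBundle 𝓘(ℝ, EG) G)) g₀ :=
    (hα.1.comp ht).contMDiffAt
  have h4 := ContMDiffAt.clm_apply_of_inCoordinates (b₁ := fun g => 𝒢.one (𝒢.t g))
    (b₂ := fun g => R (g, 𝒢.one (𝒢.t g))) (v := fun g => α (𝒢.t g)) h1 h3 h2
  refine h4.congr_of_eventuallyEq ?_
  filter_upwards [hot.continuous.continuousAt.eventually hR'.eventually_nhds,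
    (continuousAt_id.prodMk hot.continuous.continuousAt : ContinuousAt
      (fun g => (g, 𝒢.one (𝒢.t g))) g₀).eventually hR] with g hg hRg
  have hb : R (g, 𝒢.one (𝒢.t g)) = g := by
    rw [hg.self_of_nhds g (𝒢.s_one _), 𝒢.one_mul]
  have hd : MDifferentiableAt 𝓘(ℝ, EG) 𝓘(ℝ, EG) (fun k => R (g, k)) (𝒢.one (𝒢.t g)) :=
    MDifferentiableAt.comp (g := R) _ (hRg.mdifferentiableAt (by simp))
      (mdifferentiableAt_const.prodMk mdifferentiableAt_id)
  obtain ⟨c, hc0, hcs, hc, hcg⟩ := hα.exists_curve (𝒢.t g)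
  have hv := hc.comp (f := fun k => R (g, k)) (by rwa [hc0])
  have hcc : ∀ᶠ τ in 𝓝 0, ∀ g', 𝒢.s (c τ) = 𝒢.t g' → R (g', c τ) = 𝒢.mul (c τ) g' :=
    hc.continuousAt.eventually (by rw [hc0]; exact hg)
  have hv' := (hcg g rfl).unique (hv.congr (c' := fun τ => 𝒢.mul (c τ) g) (by
    filter_upwards [hcc, hcs] with τ hτ hτ'
    exact (hτ g hτ').symm))
  rw [hc0] at hv'
  have hmk : ∀ (p q : G) (k : EG), p = q →
      (⟨p, k⟩ : TangentBundle 𝓘(ℝ, EG) G) = ⟨q, k⟩ := by rintro p _ k rfl; rfl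
  refine Eq.trans ?_ (hmk _ _ _ hb).symm
  exact congrArg (fun k : EG => (⟨g, k⟩ : TangentBundle 𝓘(ℝ, EG) G)) hv'

end LieGroupoid

end Groupoid

/-! ### Flows of right-invariant vector fields -/

section Flow

variable {EG EM G M : Type*} [NormedAddCommGroup EG] [NormedSpace ℝ EG] [FiniteDimensional ℝ EG]
  [NormedAddCommGroup EM] [NormedSpace ℝ EM] [FiniteDimensional ℝ EM]
  [TopologicalSpace G] [ChartedSpace EG G] [IsManifold 𝓘(ℝ, EG) ∞ G]
  [TopologicalSpace M] [ChartedSpace EM M] [IsManifold 𝓘(ℝ, EM) ∞ M] [T2Space M]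
  {𝒢 : LieGroupoid EG EM G M} {α : 𝒢.Sec}

namespace LieGroupoid

/-- Integral curves of `→α` stay in a source fibre. -/
theorem Sec.IsSection.s_eq (hα : α.IsSection) {γ : ℝ → G} {a b : ℝ}
    (hγ : ∀ τ ∈ Ioo a b, HasVelocity EG γ (α.right (γ τ)) τ) {τ τ₀ : ℝ} (hτ : τ ∈ Ioo a b)
    (hτ₀ : τ₀ ∈ Ioo a b) : 𝒢.s (γ τ) = 𝒢.s (γ τ₀) := by
  have : CompleteSpace EM := FiniteDimensional.complete ℝ EM
  refine eqOn_of_hasVelocity_zero (E := EM) (c := fun τ => 𝒢.s (γ τ)) (fun σ hσ => ?_) hτ hτ₀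
  have h1 := (hγ σ hσ).comp (f := 𝒢.s) (𝒢.smoothNear_s _).mdifferentiableAt
  rwa [hα.mfderiv_s_right] at h1

/-- Integral curves of `→α` are unique: they stay in a source fibre, which is Hausdorff although
`G` may not be. -/
theorem Sec.IsSection.eqOn_Ioo (hα : α.IsSection) {γ γ' : ℝ → G} {a b τ₀ : ℝ}
    (hτ₀ : τ₀ ∈ Ioo a b) (hγ : ∀ τ ∈ Ioo a b, HasVelocity EG γ (α.right (γ τ)) τ)
    (hγ' : ∀ τ ∈ Ioo a b, HasVelocity EG γ' (α.right (γ' τ)) τ) (h0 : γ τ₀ = γ' τ₀) :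
    EqOn γ γ' (Ioo a b) := by
  have : CompleteSpace EG := FiniteDimensional.complete ℝ EG
  have : IsManifold 𝓘(ℝ, EG) 1 G := IsManifold.of_le (n := ∞) (by simp)
  have := 𝒢.hausdorff_fiber (𝒢.s (γ τ₀))
  have hs : ∀ τ : Ioo a b, 𝒢.s (γ τ) = 𝒢.s (γ τ₀) := fun τ => hα.s_eq hγ τ.2 hτ₀
  have hs' : ∀ τ : Ioo a b, 𝒢.s (γ' τ) = 𝒢.s (γ τ₀) := fun τ => by
    rw [h0]
    exact hα.s_eq hγ' τ.2 hτ₀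
  let f : Ioo a b → {g : G // 𝒢.s g = 𝒢.s (γ τ₀)} := fun τ => ⟨γ τ, hs τ⟩
  let f' : Ioo a b → {g : G // 𝒢.s g = 𝒢.s (γ τ₀)} := fun τ => ⟨γ' τ, hs' τ⟩
  have hf : Continuous f := continuous_iff_continuousAt.2 fun τ => by
    have h1 : ContinuousAt (fun τ : Ioo a b => γ τ) τ :=
      (hγ τ τ.2).continuousAt.comp continuousAt_subtype_val
    exact Topology.IsInducing.subtypeVal.continuousAt_iff.2 h1
  have hf' : Continuous f' := continuous_iff_continuousAt.2 fun τ => by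
    have h1 : ContinuousAt (fun τ : Ioo a b => γ' τ) τ :=
      (hγ' τ τ.2).continuousAt.comp continuousAt_subtype_val
    exact Topology.IsInducing.subtypeVal.continuousAt_iff.2 h1
  have hclosed : IsClosed {τ : Ioo a b | f τ = f' τ} := isClosed_eq hf hf'
  have hopen : IsOpen {τ : Ioo a b | f τ = f' τ} := by
    rw [isOpen_iff_mem_nhds]
    intro τ hτ
    have hloc : γ =ᶠ[𝓝 (τ : ℝ)] γ' := by
      refine isMIntegralCurveAt_eventuallyEq_of_contMDiffAt_boundaryless (v := α.right)
        ((hα.isSmoothField_right _).of_le (by simp)) ?_ ?_ (congrArg Subtype.val hτ)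
      · filter_upwards [isOpen_Ioo.mem_nhds τ.2] with σ hσ using hγ σ hσ
      · filter_upwards [isOpen_Ioo.mem_nhds τ.2] with σ hσ using hγ' σ hσ
    filter_upwards [continuousAt_subtype_val.eventually hloc] with σ hσ using Subtype.ext hσ
  have : PreconnectedSpace (Ioo a b) := Subtype.preconnectedSpace isPreconnected_Ioo
  have huniv := IsClopen.eq_univ ⟨hclosed, hopen⟩ ⟨⟨τ₀, hτ₀⟩, Subtype.ext h0⟩
  intro τ hτ
  have h1 : (⟨τ, hτ⟩ : Ioo a b) ∈ {τ : Ioo a b | f τ = f' τ} := by rw [huniv]; trivial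
  exact congrArg Subtype.val h1

/-- Near a unit, the integral curves of `→α` starting at units exist for a uniform time. -/
theorem Sec.IsSection.exists_local_flow (hα : α.IsSection) (x : M) :
    ∃ ε > 0, ∀ᶠ y in 𝓝 x, ∃ γ : ℝ → G, γ 0 = 𝒢.one y ∧
      ∀ τ ∈ Ioo (-ε) ε, HasVelocity EG γ (α.right (γ τ)) τ := by
  obtain ⟨h, -, -, -, hc⟩ := exists_smooth_field_flow (E := EG) (ι := Unit) (fun _ => α.right)
    (u := 𝒢.one x) (fun _ => hα.isSmoothField_right.smoothFieldNear _) (fun _ => α.right (𝒢.one x))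
    (fun _ => rfl)
  set e := extChartAt 𝓘(ℝ, EG) (𝒢.one x) with he
  rw [nhds_prod_eq] at hc
  obtain ⟨pa, hpa, pb, hpb, hab⟩ := eventually_prod_iff.1 hc
  have hcont : Continuous (fun δ : ℝ => (fun _ : Unit => δ)) := by fun_prop
  obtain ⟨ε, hε, hεa⟩ := Metric.eventually_nhds_iff.1
    ((hcont.continuousAt (x := 0)).eventually (p := pa) hpa)
  have hε2 : (0 : ℝ) < ε / 2 := by linarith
  refine ⟨ε / 2, hε2, ?_⟩
  have hone : ContinuousAt 𝒢.one x := 𝒢.smooth_one.continuous.continuousAt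
  filter_upwards [hone.eventually
    ((smoothNear_extChartAt (E := EG) (𝒢.one x)).continuousAt.eventually hpb),
    hone.eventually (eventually_extChartAt_left_inv (E := EG) (𝒢.one x))] with y hy hy'
  obtain ⟨c, hc0, -, hc⟩ := hab (x := fun _ => ε / 2) (hεa (by
    rw [Real.dist_eq, sub_zero, abs_of_pos hε2]; linarith)) hy
  -- the curve is run through at the speed `ε / 2`
  refine ⟨fun τ => c ((ε / 2)⁻¹ * τ + 0), ?_, fun τ hτ => ?_⟩
  · simp only [mul_zero, add_zero, hc0]
    exact hy'
  · have h1 : (ε / 2)⁻¹ * τ + 0 ∈ Ioo (-1 : ℝ) 2 := by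
      rw [add_zero, inv_mul_eq_div]
      constructor
      · rw [lt_div_iff₀ hε2]; linarith [hτ.1]
      · rw [div_lt_iff₀ hε2]; linarith [hτ.2]
    have h2 := HasVelocity.comp_affine (E := EG) (c := c) (hc _ h1)
    have h3 : ∀ k : EG, (ε / 2)⁻¹ • ∑ _j : Unit, (ε / 2) • k = k := fun k => by
      rw [Fintype.sum_unique, smul_smul, inv_mul_cancel₀ hε2.ne', one_smul]
    have h4 := h3 (α.right (c ((ε / 2)⁻¹ * τ + 0)))
    have h5 : HasVelocity EG (fun τ => c ((ε / 2)⁻¹ * τ + 0)) ((ε / 2)⁻¹ • ∑ _j : Unit,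
      (ε / 2) • (α.right (c ((ε / 2)⁻¹ * τ + 0)) : EG)) τ := h2
    exact h4 ▸ h5

theorem Sec.right_eq_zero {g : G} (h : α (𝒢.t g) = 0) : α.right g = 0 := by
  rw [Sec.right, h]
  exact map_zero _

/-- If `α` has compact support, the integral curves of `→α` exist for a uniform time. -/
theorem Sec.IsSection.exists_uniform_flow (hα : α.IsSection) (hc : IsCompact α.supp) :
    ∃ ε > 0, ∀ g : G, ∃ γ : ℝ → G, γ 0 = g ∧
      ∀ τ ∈ Ioo (-ε) ε, HasVelocity EG γ (α.right (γ τ)) τ := by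
  obtain ⟨ε, hε, hflow⟩ : ∃ ε > 0, ∀ y ∈ α.supp, ∃ γ : ℝ → G, γ 0 = 𝒢.one y ∧
      ∀ τ ∈ Ioo (-ε) ε, HasVelocity EG γ (α.right (γ τ)) τ := by
    refine hc.induction_on (p := fun S => ∃ ε > 0, ∀ y ∈ S, ∃ γ : ℝ → G, γ 0 = 𝒢.one y ∧
      ∀ τ ∈ Ioo (-ε) ε, HasVelocity EG γ (α.right (γ τ)) τ) ⟨1, one_pos, by simp⟩ ?_ ?_ ?_
    · rintro S T hST ⟨ε, hε, h⟩
      exact ⟨ε, hε, fun y hy => h y (hST hy)⟩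
    · rintro S T ⟨ε, hε, h⟩ ⟨ε', hε', h'⟩
      refine ⟨min ε ε', lt_min hε hε', fun y hy => ?_⟩
      rcases hy with hy | hy
      · obtain ⟨γ, h0, hγ⟩ := h y hy
        exact ⟨γ, h0, fun τ hτ => hγ τ ⟨(neg_le_neg (min_le_left _ _)).trans_lt hτ.1,
          hτ.2.trans_le (min_le_left _ _)⟩⟩
      · obtain ⟨γ, h0, hγ⟩ := h' y hy
        exact ⟨γ, h0, fun τ hτ => hγ τ ⟨(neg_le_neg (min_le_right _ _)).trans_lt hτ.1,
          hτ.2.trans_le (min_le_right _ _)⟩⟩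
    · intro x _
      obtain ⟨ε, hε, h⟩ := hα.exists_local_flow x
      exact ⟨_, mem_nhdsWithin_of_mem_nhds h, ε, hε, fun y hy => hy⟩
  refine ⟨ε, hε, fun g => ?_⟩
  by_cases hg : 𝒢.t g ∈ α.supp
  · obtain ⟨γ, hγ0, hγ⟩ := hflow _ hg
    have h0 : (0 : ℝ) ∈ Ioo (-ε) ε := ⟨by linarith, hε⟩
    refine ⟨fun τ => 𝒢.mul (γ τ) g, by simp only [hγ0, 𝒢.one_mul], fun τ hτ => ?_⟩
    refine hα.hasVelocity_mul_right (hγ τ hτ) ?_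
    filter_upwards [isOpen_Ioo.mem_nhds hτ] with σ hσ
    rw [hα.s_eq hγ hσ h0, hγ0, 𝒢.s_one]
  · have h0 : α (𝒢.t g) = 0 := by
      by_contra h
      exact hg (subset_closure h)
    refine ⟨fun _ => g, rfl, fun τ _ => ?_⟩
    have h1 := hasVelocity_const (E := EG) g τ
    have h2 : α.right g = (0 : EG) := Sec.right_eq_zero h0
    change HasVelocity EG (fun _ => g) (α.right g) τ
    rwa [h2]

/-- If all integral curves exist on `(-a, a)`, they exist on `(-3a/2, 3a/2)`. -/
theorem Sec.IsSection.extend_flow (hα : α.IsSection) {a : ℝ} (ha : 0 < a)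
    (h : ∀ g : G, ∃ γ : ℝ → G, γ 0 = g ∧ ∀ τ ∈ Ioo (-a) a, HasVelocity EG γ (α.right (γ τ)) τ)
    (g : G) : ∃ γ : ℝ → G, γ 0 = g ∧
      ∀ τ ∈ Ioo (-(3 / 2 * a)) (3 / 2 * a), HasVelocity EG γ (α.right (γ τ)) τ := by
  obtain ⟨γ, hγ0, hγ⟩ := h g
  obtain ⟨γ₁, hγ₁0, hγ₁⟩ := h (γ (a / 2))
  obtain ⟨γ₂, hγ₂0, hγ₂⟩ := h (γ (-(a / 2)))
  have hd₁ : ∀ τ ∈ Ioo (-(a / 2)) (3 / 2 * a),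
      HasVelocity EG (fun τ => γ₁ (τ + -(a / 2))) (α.right (γ₁ (τ + -(a / 2)))) τ := fun τ hτ =>
    (hγ₁ _ ⟨by linarith [hτ.1], by linarith [hτ.2]⟩).comp_add
  have hd₂ : ∀ τ ∈ Ioo (-(3 / 2 * a)) (a / 2),
      HasVelocity EG (fun τ => γ₂ (τ + a / 2)) (α.right (γ₂ (τ + a / 2))) τ := fun τ hτ =>
    (hγ₂ _ ⟨by linarith [hτ.1], by linarith [hτ.2]⟩).comp_add
  have he₁ : EqOn γ (fun τ => γ₁ (τ + -(a / 2))) (Ioo (-(a / 2)) a) :=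
    hα.eqOn_Ioo (τ₀ := a / 2) ⟨by linarith, by linarith⟩
      (fun τ hτ => hγ τ ⟨by linarith [hτ.1], hτ.2⟩)
      (fun τ hτ => hd₁ τ ⟨hτ.1, by linarith [hτ.2]⟩) (by simp [hγ₁0])
  have he₂ : EqOn γ (fun τ => γ₂ (τ + a / 2)) (Ioo (-a) (a / 2)) :=
    hα.eqOn_Ioo (τ₀ := -(a / 2)) ⟨by linarith, by linarith⟩
      (fun τ hτ => hγ τ ⟨hτ.1, by linarith [hτ.2]⟩)
      (fun τ hτ => hd₂ τ ⟨by linarith [hτ.1], hτ.2⟩) (by simp [hγ₂0])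
  let Γ : ℝ → G := fun τ => if τ ≤ -(a / 2) then γ₂ (τ + a / 2) else if τ < a / 2 then γ τ
    else γ₁ (τ + -(a / 2))
  have hΓ : EqOn Γ γ (Ioo (-a) a) := fun τ hτ => by
    simp only [Γ]
    split_ifs with h1 h2
    · exact (he₂ ⟨hτ.1, by linarith⟩).symm
    · rfl
    · exact (he₁ ⟨by linarith, hτ.2⟩).symm
  have hΓ₁ : EqOn Γ (fun τ => γ₁ (τ + -(a / 2))) (Ioo (-(a / 2)) (3 / 2 * a)) := fun τ hτ => by
    by_cases h1 : τ < a / 2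
    · exact (hΓ ⟨by linarith [hτ.1], by linarith⟩).trans (he₁ ⟨hτ.1, by linarith⟩)
    · simp only [Γ, if_neg (not_le.2 hτ.1), if_neg h1]
  have hΓ₂ : EqOn Γ (fun τ => γ₂ (τ + a / 2)) (Ioo (-(3 / 2 * a)) (a / 2)) := fun τ hτ => by
    by_cases h1 : τ ≤ -(a / 2)
    · simp only [Γ, if_pos h1]
    · have h2 := not_le.1 h1
      exact (hΓ ⟨by linarith, by linarith [hτ.2]⟩).trans (he₂ ⟨by linarith, hτ.2⟩)
  refine ⟨Γ, (hΓ ⟨by linarith, ha⟩).trans hγ0, fun τ hτ => ?_⟩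
  have key : ∀ {c : ℝ → G} {p q : ℝ}, EqOn Γ c (Ioo p q) → τ ∈ Ioo p q →
      HasVelocity EG c (α.right (c τ)) τ → HasVelocity EG Γ (α.right (Γ τ)) τ := by
    intro c p q hc hτ hv
    rw [hc hτ]
    exact hv.congr (hc.eventuallyEq_of_mem (isOpen_Ioo.mem_nhds hτ))
  rcases lt_or_ge τ 0 with h0 | h0
  · have h1 : τ ∈ Ioo (-(3 / 2 * a)) (a / 2) := ⟨hτ.1, by linarith⟩
    exact key hΓ₂ h1 (hd₂ τ h1)
  · have h1 : τ ∈ Ioo (-(a / 2)) (3 / 2 * a) := ⟨by linarith, hτ.2⟩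
    exact key hΓ₁ h1 (hd₁ τ h1)

/-- Right-invariant fields of compactly supported sections are complete. -/
theorem Sec.IsSection.exists_isMIntegralCurve (hα : α.IsSection) (hc : IsCompact α.supp) (g : G) :
    ∃ γ : ℝ → G, γ 0 = g ∧ IsMIntegralCurve (I := 𝓘(ℝ, EG)) γ α.right := by
  obtain ⟨ε, hε, hflow⟩ := hα.exists_uniform_flow hc
  have hn : ∀ n : ℕ, ∀ g : G, ∃ γ : ℝ → G, γ 0 = g ∧
      ∀ τ ∈ Ioo (-((3 / 2 : ℝ) ^ n * ε)) ((3 / 2 : ℝ) ^ n * ε),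
        HasVelocity EG γ (α.right (γ τ)) τ := by
    intro n
    induction n with
    | zero => simpa using hflow
    | succ n ih =>
      have h1 := hα.extend_flow (by positivity) ih
      rw [pow_succ', _root_.mul_assoc]
      exact h1
  have hall : ∀ a : ℝ, ∃ γ : ℝ → G, γ 0 = g ∧
      ∀ τ ∈ Ioo (-a) a, HasVelocity EG γ (α.right (γ τ)) τ := by
    intro a
    obtain ⟨n, hna⟩ := pow_unbounded_of_one_lt (a / ε) (by norm_num : (1 : ℝ) < 3 / 2)
    rw [div_lt_iff₀ hε] at hna
    obtain ⟨γ, h0, hγ⟩ := hn n g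
    exact ⟨γ, h0, fun τ hτ => hγ τ ⟨by linarith [hτ.1], hτ.2.trans hna⟩⟩
  choose c hc0 hc using hall
  have hagree : ∀ a b τ, |τ| < a → |τ| < b → c a τ = c b τ := by
    intro a b τ ha hb
    have hpos : 0 < min a b := lt_min ((abs_nonneg τ).trans_lt ha) ((abs_nonneg τ).trans_lt hb)
    refine hα.eqOn_Ioo (a := -(min a b)) (b := min a b) (τ₀ := 0) ⟨by linarith, hpos⟩
      (fun σ hσ => hc a σ ?_) (fun σ hσ => hc b σ ?_) (by rw [hc0, hc0])
      (abs_lt.1 (lt_min ha hb))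
    · exact ⟨by linarith [hσ.1, min_le_left a b], hσ.2.trans_le (min_le_left a b)⟩
    · exact ⟨by linarith [hσ.1, min_le_right a b], hσ.2.trans_le (min_le_right a b)⟩
  refine ⟨fun τ => c (|τ| + 1) τ, hc0 _, fun τ => ?_⟩
  have h1 : c (|τ| + 1) τ = c (|τ| + 2) τ := hagree _ _ _ (by linarith) (by linarith)
  have h2 : HasVelocity EG (fun τ => c (|τ| + 1) τ) (α.right (c (|τ| + 1) τ)) τ := by
    rw [h1]
    refine (hc (|τ| + 2) τ (abs_lt.1 (by linarith))).congr ?_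
    have h3 : ∀ᶠ σ in 𝓝 τ, |σ| < |τ| + 2 :=
      continuous_abs.continuousAt.eventually (eventually_lt_nhds (by linarith))
    filter_upwards [h3] with σ hσ
    exact hagree _ _ _ (by linarith) hσ
  exact h2

/-- The time-one map of `→α` is computed by any integral curve. -/
theorem Sec.IsSection.expAt_eq (hα : α.IsSection) (hc : IsCompact α.supp) {γ : ℝ → G}
    (hγ : ∀ τ ∈ Ioo (-1 : ℝ) 2, HasVelocity EG γ (α.right (γ τ)) τ) :
    expAt α.right (γ 0) = γ 1 := by
  have h := hα.exists_isMIntegralCurve hc (γ 0)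
  rw [expAt, dif_pos h]
  exact hα.eqOn_Ioo (a := -1) (b := 2) (τ₀ := 0) (by norm_num) (fun τ _ => h.choose_spec.2 τ) hγ
    h.choose_spec.1 (by norm_num)

end LieGroupoid

end Flow

/-! ### Generators of a singular subalgebroid near a point -/

section Generators

variable {EG EM G M : Type*} [NormedAddCommGroup EG] [NormedSpace ℝ EG] [FiniteDimensional ℝ EG]
  [NormedAddCommGroup EM] [NormedSpace ℝ EM] [FiniteDimensional ℝ EM]
  [TopologicalSpace G] [ChartedSpace EG G] [IsManifold 𝓘(ℝ, EG) ∞ G]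
  [TopologicalSpace M] [ChartedSpace EM M] [IsManifold 𝓘(ℝ, EM) ∞ M] [T2Space M]
  {𝒢 : LieGroupoid EG EM G M}

namespace LieGroupoid

theorem Sec.right_smul (f : C^∞⟮𝓘(ℝ, EM), M; ℝ⟯) (α : 𝒢.Sec) (g : G) :
    (f • α).right g = f (𝒢.t g) • α.right g := map_smul _ (f (𝒢.t g)) (α (𝒢.t g))

theorem Sec.sum_apply {ι : Type*} (s : Finset ι) (α : ι → 𝒢.Sec) (y : M) :
    (∑ i ∈ s, α i) y = ∑ i ∈ s, α i y := Finset.sum_apply y s α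

theorem Sec.right_sum {ι : Type*} (s : Finset ι) (α : ι → 𝒢.Sec) (g : G) :
    (∑ i ∈ s, α i).right g = ∑ i ∈ s, (α i).right g := by
  rw [Sec.right, Sec.sum_apply]
  exact map_sum _ _ _

theorem Sec.right_sum_real_smul {ι : Type*} (s : Finset ι) (r : ι → ℝ) (α : ι → 𝒢.Sec) (g : G) :
    (∑ i ∈ s, r i • α i).right g = ∑ i ∈ s, r i • (α i).right g := by
  rw [Sec.right_sum]
  exact Finset.sum_congr rfl fun i _ => map_smul _ (r i) (α i (𝒢.t g))

end LieGroupoid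

namespace SingularSubalgebroid

variable (𝓑 : SingularSubalgebroid 𝒢)

/-- The `α j` generate `𝓑` near `x`, in the sense that a function `ρ` with `ρ x = 1` multiplies
`𝓑` into the submodule that they span. -/
def GeneratesAt (x : M) {n : ℕ} (α : Fin n → 𝓑.toSubmodule) : Prop :=
  ∃ ρ : C^∞⟮𝓘(ℝ, EM), M; ℝ⟯, ρ x = 1 ∧ ∀ b ∈ 𝓑.toSubmodule,
    ∃ h : Fin n → C^∞⟮𝓘(ℝ, EM), M; ℝ⟯, ρ • b = ∑ j, h j • (α j : 𝒢.Sec)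

theorem exists_generatesAt (x : M) :
    ∃ (n : ℕ) (α : Fin n → 𝓑.toSubmodule), 𝓑.GeneratesAt x α := by
  obtain ⟨W, k, Y, hW, hxW, hY, hB⟩ := 𝓑.locally_fg x
  obtain ⟨χ, hχc, hχs, hχ1⟩ := exists_cutoff (E := EM) (hW.mem_nhds hxW)
  refine ⟨k, fun j => ⟨χ • Y j, hY j χ hχc hχs⟩, χ * χ, ?_, fun b hb => ?_⟩
  · change χ x * χ x = 1
    rw [hχ1.self_of_nhds, mul_one]
  · have hsupp : LieGroupoid.Sec.supp (χ • b) ⊆ W := by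
      refine (closure_mono fun y hy => ?_).trans hχs
      intro h0
      exact hy (show χ y • b y = 0 by rw [h0, zero_smul])
    obtain ⟨f, -, hf⟩ := hB (χ • b) (𝓑.toSubmodule.smul_mem χ hb) hsupp
    refine ⟨f, ?_⟩
    rw [mul_smul, hf, Finset.smul_sum]
    exact Finset.sum_congr rfl fun j _ => smul_comm _ _ _

theorem mem_vanishingIdeal {x : M} {f : C^∞⟮𝓘(ℝ, EM), M; ℝ⟯} :
    f ∈ vanishingIdeal EM x ↔ f x = 0 := Iff.rfl

variable {𝓑}

/-- Nakayama's lemma: sections whose classes span `𝓑 / I_x 𝓑` generate `𝓑` near `x`. -/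
theorem IsMinimalGenerators.generatesAt {x : M} {n : ℕ} {α : Fin n → 𝓑.toSubmodule}
    (hα : 𝓑.IsMinimalGenerators x α) : 𝓑.GeneratesAt x α := by
  set I := vanishingIdeal EM x with hI
  set S : Submodule C^∞⟮𝓘(ℝ, EM), M; ℝ⟯ 𝓑.toSubmodule := Submodule.span _ (range α) with hS
  have htop : ∀ b : 𝓑.toSubmodule, ∃ s ∈ S, b - s ∈ I •
      (⊤ : Submodule C^∞⟮𝓘(ℝ, EM), M; ℝ⟯ 𝓑.toSubmodule) := by
    intro b
    have hb : (Submodule.Quotient.mk b : 𝓑.Fiber x) ∈ Submodule.span ℝ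
        (range fun i => (Submodule.Quotient.mk (α i) : 𝓑.Fiber x)) := by
      rw [hα.2]; trivial
    obtain ⟨c, hc⟩ := (Submodule.mem_span_range_iff_exists_fun ℝ).1 hb
    refine ⟨∑ i, c i • α i, S.sum_mem fun i _ =>
      S.smul_of_tower_mem (c i) (Submodule.subset_span ⟨i, rfl⟩), ?_⟩
    rw [← Submodule.Quotient.eq, ← hc]
    exact (map_sum ((I • (⊤ : Submodule C^∞⟮𝓘(ℝ, EM), M; ℝ⟯ 𝓑.toSubmodule)).mkQ)
      (fun j => c j • α j) Finset.univ).symm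
  obtain ⟨k, β, ρ, hρx, hρ⟩ := 𝓑.exists_generatesAt x
  -- in the quotient by the span of the `α j`, everything is a combination with coefficients in `I`
  have hqI : ∀ z, z ∈ I • (⊤ : Submodule C^∞⟮𝓘(ℝ, EM), M; ℝ⟯ (𝓑.toSubmodule ⧸ S)) := by
    intro z
    obtain ⟨b, rfl⟩ := S.mkQ_surjective z
    obtain ⟨s, hs, hbs⟩ := htop b
    have h1 : S.mkQ b = S.mkQ (b - s) := by
      rw [map_sub, (Submodule.Quotient.mk_eq_zero S (x := s)).2 hs |> fun h => (h : S.mkQ s = 0),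
        sub_zero]
    rw [h1]
    have h2 := Submodule.mem_map_of_mem (f := S.mkQ) hbs
    rw [Submodule.map_smul''] at h2
    exact Submodule.smul_mono le_rfl le_top h2
  let N : Submodule C^∞⟮𝓘(ℝ, EM), M; ℝ⟯ (𝓑.toSubmodule ⧸ S) :=
    Submodule.span _ (range fun j => S.mkQ (β j))
  have hρN : ∀ b : 𝓑.toSubmodule, S.mkQ (ρ • b) ∈ N := by
    intro b
    obtain ⟨h, hh⟩ := hρ b b.2
    have h1 : ρ • b = ∑ j, h j • β j := Subtype.ext (by simpa using hh)
    rw [h1, map_sum]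
    refine N.sum_mem fun j _ => ?_
    rw [map_smul]
    exact N.smul_mem _ (Submodule.subset_span ⟨j, rfl⟩)
  have hNI : N ≤ I • N := by
    intro z hz
    have h1 : ρ • z ∈ I • N := by
      refine Submodule.smul_induction_on (p := fun z => ρ • z ∈ I • N) (hqI z) ?_ ?_
      · intro r hr m _
        rw [smul_comm]
        obtain ⟨b, rfl⟩ := S.mkQ_surjective m
        exact Submodule.smul_mem_smul hr (hρN b)
      · intro a b ha hb
        rw [smul_add]
        exact add_mem ha hb
    have h2 : (1 - ρ) • z ∈ I • N := by
      refine Submodule.smul_mem_smul (mem_vanishingIdeal.2 ?_) hz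
      change 1 - ρ x = 0
      rw [hρx, sub_self]
    have h3 : z = ρ • z + (1 - ρ) • z := by rw [← add_smul, add_sub_cancel, one_smul]
    rw [h3]
    exact add_mem h1 h2
  obtain ⟨r, hr, hrN⟩ := Submodule.exists_sub_one_mem_and_smul_eq_zero_of_fg_of_le_smul I N
    (Submodule.fg_span (finite_range _)) hNI
  have hrx : r x = 1 := by
    have : r x - 1 = 0 := mem_vanishingIdeal.1 hr
    linarith
  refine ⟨r * ρ, ?_, fun b hb => ?_⟩
  · change r x * ρ x = 1
    rw [hrx, hρx, mul_one]
  · have h1 := hrN _ (hρN ⟨b, hb⟩)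
    rw [← map_smul] at h1
    have h2 : r • ρ • (⟨b, hb⟩ : 𝓑.toSubmodule) ∈ S := (Submodule.Quotient.mk_eq_zero S).1 h1
    obtain ⟨h, hh⟩ := (Submodule.mem_span_range_iff_exists_fun _).1 h2
    refine ⟨h, ?_⟩
    have h3 := congrArg Subtype.val hh
    rw [mul_smul]
    simpa using h3.symm

/-- Minimal generators have no relation at `x`: if `∑ c j α j` is, near `x`, a combination of the
`α j` with coefficients vanishing at `x`, then `c = 0`. -/
theorem IsMinimalGenerators.eq_zero {x : M} {n : ℕ} {α : Fin n → 𝓑.toSubmodule}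
    (hα : 𝓑.IsMinimalGenerators x α) {c : Fin n → ℝ} {ρ : C^∞⟮𝓘(ℝ, EM), M; ℝ⟯} (hρ : ρ x = 1)
    {f : Fin n → C^∞⟮𝓘(ℝ, EM), M; ℝ⟯} (hf : ∀ j, f j x = 0)
    (h : ∀ y, ρ y • ∑ j, c j • (α j : 𝒢.Sec) y = ∑ j, f j y • (α j : 𝒢.Sec) y) : c = 0 := by
  have h1 : ρ • ∑ j, c j • α j = ∑ j, f j • α j := by
    refine Subtype.ext (funext fun y => ?_)
    have h2 : ((ρ • ∑ j, c j • α j : 𝓑.toSubmodule) : 𝒢.Sec) = ρ • ∑ j, c j • (α j : 𝒢.Sec) := by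
      simp
    have h3 : ((∑ j, f j • α j : 𝓑.toSubmodule) : 𝒢.Sec) = ∑ j, f j • (α j : 𝒢.Sec) := by simp
    rw [h2, h3]
    refine Eq.trans ?_ ((h y).trans ?_)
    · exact congrArg (fun k => ρ y • k)
        (LieGroupoid.Sec.sum_apply Finset.univ (fun j => c j • (α j : 𝒢.Sec)) y)
    · exact (LieGroupoid.Sec.sum_apply Finset.univ (fun j => f j • (α j : 𝒢.Sec)) y).symm
  have h2 : ∑ j, c j • α j ∈
      vanishingIdeal EM x • (⊤ : Submodule C^∞⟮𝓘(ℝ, EM), M; ℝ⟯ 𝓑.toSubmodule) := by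
    have h3 : ∑ j, c j • α j = ∑ j, f j • α j + (1 - ρ) • ∑ j, c j • α j := by
      rw [← h1, ← add_smul, add_sub_cancel, one_smul]
    rw [h3]
    refine add_mem (Submodule.sum_mem _ fun j _ => Submodule.smul_mem_smul (hf j) trivial)
      (Submodule.smul_mem_smul (mem_vanishingIdeal.2 ?_) trivial)
    change 1 - ρ x = 0
    rw [hρ, sub_self]
  have h3 : ∑ j, c j • (Submodule.Quotient.mk (α j) : 𝓑.Fiber x) = 0 := by
    have h4 := (Submodule.Quotient.mk_eq_zero _).2 h2
    have h5 := map_sum ((vanishingIdeal EM x •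
      (⊤ : Submodule C^∞⟮𝓘(ℝ, EM), M; ℝ⟯ 𝓑.toSubmodule)).mkQ) (fun j => c j • α j) Finset.univ
    exact h5.symm.trans h4
  exact funext (Fintype.linearIndependent_iff.1 hα.1 c h3)

end SingularSubalgebroid

end Generators

/-! ### Lifting right-invariant flows to a bisubmersion -/

section FieldAlgebra

variable {E : Type*} [NormedAddCommGroup E] [NormedSpace ℝ E]
  {N : Type*} [TopologicalSpace N] [ChartedSpace E N] [IsManifold 𝓘(ℝ, E) ∞ N]

theorem IsSmoothField.smul {X : ∀ w : N, TangentSpace 𝓘(ℝ, E) w} (hX : IsSmoothField X)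
    {f : N → ℝ} (hf : ContMDiff 𝓘(ℝ, E) 𝓘(ℝ, ℝ) ∞ f) : IsSmoothField (fun w => f w • X w) :=
  fun w => (hf w).smul_section (hX w)

theorem IsSmoothField.sub {X Y : ∀ w : N, TangentSpace 𝓘(ℝ, E) w} (hX : IsSmoothField X)
    (hY : IsSmoothField Y) : IsSmoothField (fun w => X w - Y w) :=
  fun w => (hX w).sub_section (hY w)

theorem IsSmoothField.sum {ι : Type*} {s : Finset ι} {X : ι → ∀ w : N, TangentSpace 𝓘(ℝ, E) w}
    (hX : ∀ i, IsSmoothField (X i)) : IsSmoothField (fun w => ∑ i ∈ s, X i w) :=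
  fun w => ContMDiffAt.sum_section (fun i _ => hX i w)

end FieldAlgebra

section Lift

variable {EG EM G M : Type*} [NormedAddCommGroup EG] [NormedSpace ℝ EG] [FiniteDimensional ℝ EG]
  [NormedAddCommGroup EM] [NormedSpace ℝ EM] [FiniteDimensional ℝ EM]
  [TopologicalSpace G] [ChartedSpace EG G] [IsManifold 𝓘(ℝ, EG) ∞ G]
  [TopologicalSpace M] [ChartedSpace EM M] [IsManifold 𝓘(ℝ, EM) ∞ M] [T2Space M]
  {𝒢 : LieGroupoid EG EM G M} {𝓑 : SingularSubalgebroid 𝒢}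
  {E U : Type*} [NormedAddCommGroup E] [NormedSpace ℝ E] [FiniteDimensional ℝ E]
  [TopologicalSpace U] [ChartedSpace E U] [IsManifold 𝓘(ℝ, E) ∞ U] [T2Space U] {φ : U → G}

namespace IsBisubmersion

/-- If the fields `Z j` are `φ`-related to the `→α j`, then `φ` maps the integral curves of a
combination of the `Z j` to those of the same combination of the `→α j`. -/
theorem expAt_eq (hφ : IsBisubmersion 𝓑 (E := E) φ) {n : ℕ} (α : Fin n → 𝓑.toSubmodule)
    {lam : Fin n → ℝ} {c : ℝ → U} {v : ∀ τ, TangentSpace 𝓘(ℝ, E) (c τ)}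
    (hc : ∀ τ ∈ Ioo (-1 : ℝ) 2, HasVelocity E c (v τ) τ)
    (hv : ∀ τ, mfderiv 𝓘(ℝ, E) 𝓘(ℝ, EG) φ (c τ) (v τ) =
      ∑ j, lam j • (α j : 𝒢.Sec).right (φ (c τ))) :
    expAt (fun g => ∑ j, lam j • (α j : 𝒢.Sec).right g) (φ (c 0)) = φ (c 1) := by
  set a : 𝒢.Sec := ∑ j, lam j • (α j : 𝒢.Sec) with ha
  have haB : a ∈ 𝓑.toSubmodule := 𝓑.toSubmodule.sum_mem fun j _ =>
    𝓑.toSubmodule.smul_of_tower_mem (lam j) (α j).2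
  have hright : (fun g => ∑ j, lam j • (α j : 𝒢.Sec).right g) = a.right :=
    funext fun g => (LieGroupoid.Sec.right_sum_real_smul _ lam _ g).symm
  rw [hright]
  refine (𝓑.isSection a haB).expAt_eq (𝓑.compact_supp a haB) (γ := fun τ => φ (c τ))
    fun τ hτ => ?_
  have h1 := (hc τ hτ).comp (f := φ) (hφ.smooth.mdifferentiable (by simp) _)
  have h2 := (hv τ).trans (congrFun hright (φ (c τ)))
  rwa [h2] at h1

/-- Near a point, vertical fields of `s ∘ φ` are mapped by `dφ` to combinations of the `→α j`, for
generators `α j` of `𝓑`. -/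
theorem exists_coefficients (hφ : IsBisubmersion 𝓑 (E := E) φ) {n : ℕ} {α : Fin n → 𝓑.toSubmodule}
    {ρ : C^∞⟮𝓘(ℝ, EM), M; ℝ⟯} (hρ : ∀ b ∈ 𝓑.toSubmodule,
      ∃ h : Fin n → C^∞⟮𝓘(ℝ, EM), M; ℝ⟯, ρ • b = ∑ j, h j • (α j : 𝒢.Sec))
    {W : ∀ w : U, TangentSpace 𝓘(ℝ, E) w}
    (hW : W ∈ verticalFields (E := E) (F := EM) (fun w => 𝒢.s (φ w))) :
    ∃ g : Fin n → U → ℝ, (∀ j, ContMDiff 𝓘(ℝ, E) 𝓘(ℝ, ℝ) ∞ (g j)) ∧ ∀ w,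
      ρ (𝒢.t (φ w)) • mfderiv 𝓘(ℝ, E) 𝓘(ℝ, EG) φ w (W w) =
        ∑ j, g j w • (α j : 𝒢.Sec).right (φ w) := by
  rw [← hφ.pullback_right] at hW
  obtain ⟨-, -, k, f, Y, -, hY, hWY⟩ := hW
  choose a haB ha using hY
  choose h hh using fun i => hρ (a i) (haB i)
  have ht : ContMDiff 𝓘(ℝ, E) 𝓘(ℝ, EM) ∞ (fun w => 𝒢.t (φ w)) :=
    contMDiffOn_univ.1 hφ.submersion_t.1
  refine ⟨fun j w => ∑ i, f i w * h i j (𝒢.t (φ w)), fun j => ?_, fun w => ?_⟩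
  · exact contMDiff_finsetSum fun i _ =>
      ((f i).contMDiff).mul ((h i j).contMDiff.comp ht)
  · rw [hWY, Finset.smul_sum]
    have h1 : ∀ i, ρ (𝒢.t (φ w)) • f i w • Y i (φ w) =
        ∑ j, (f i w * h i j (𝒢.t (φ w))) • (α j : 𝒢.Sec).right (φ w) := by
      intro i
      rw [smul_comm, ha i, ← LieGroupoid.Sec.right_smul, hh i, LieGroupoid.Sec.right_sum,
        Finset.smul_sum]
      exact Finset.sum_congr rfl fun j _ => by rw [LieGroupoid.Sec.right_smul, smul_smul]
    rw [Finset.sum_congr rfl fun i _ => h1 i, Finset.sum_comm]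
    exact Finset.sum_congr rfl fun j _ => (Finset.sum_smul).symm

theorem mfderiv_source (hφ : IsBisubmersion 𝓑 (E := E) φ) (w : U) (k : TangentSpace 𝓘(ℝ, E) w) :
    mfderiv 𝓘(ℝ, E) 𝓘(ℝ, EM) (fun w => 𝒢.s (φ w)) w k =
      mfderiv 𝓘(ℝ, EG) 𝓘(ℝ, EM) 𝒢.s (φ w) (mfderiv 𝓘(ℝ, E) 𝓘(ℝ, EG) φ w k) := by
  have h1 := mfderiv_comp w (g := 𝒢.s) (f := φ) (I := 𝓘(ℝ, E)) (I' := 𝓘(ℝ, EG))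
    (I'' := 𝓘(ℝ, EM)) (𝒢.smoothNear_s _).mdifferentiableAt
    (hφ.smooth.mdifferentiable (by simp) w)
  exact congrArg (fun T : E →L[ℝ] EM => T k) h1

/-- Lifts of minimal generators to a bisubmersion are linearly independent modulo fields in the
kernel of `dφ`. -/
theorem eq_zero_of_sum_lift_eq (hφ : IsBisubmersion 𝓑 (E := E) φ) {β : M → U} {x : M}
    (hβ : SmoothNear 𝓘(ℝ, EM) 𝓘(ℝ, E) β x) (hβt : ∀ᶠ y in 𝓝 x, 𝒢.t (φ (β y)) = y)
    {n : ℕ} {α : Fin n → 𝓑.toSubmodule} (hα : 𝓑.IsMinimalGenerators x α)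
    {Z : Fin n → ∀ w : U, TangentSpace 𝓘(ℝ, E) w} (hZ : ∀ j, IsSmoothField (Z j))
    (hZr : ∀ j, IsRelated φ (Z j) (α j : 𝒢.Sec).right)
    {W : ∀ w : U, TangentSpace 𝓘(ℝ, E) w} (hW : IsSmoothField W)
    (hWr : ∀ w, mfderiv 𝓘(ℝ, E) 𝓘(ℝ, EG) φ w (W w) = 0) {c : Fin n → ℝ}
    (hc : ∑ j, c j • Z j (β x) = W (β x)) : c = 0 := by
  obtain ⟨ρ, hρx, hρ⟩ := hα.generatesAt
  have hsv : SmoothNear 𝓘(ℝ, E) 𝓘(ℝ, EM) (fun w => 𝒢.s (φ w)) (β x) :=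
    ContMDiffOn.smoothNear hφ.submersion_s.1 isOpen_univ (mem_univ _)
  obtain ⟨d, V, hV, -, hgen⟩ := exists_vertical_generators hsv
    (hφ.submersion_s.2 (β x) (mem_univ _))
  have hdξ : ∀ w, mfderiv 𝓘(ℝ, E) 𝓘(ℝ, EG) φ w (∑ j, c j • Z j w - W w) =
      ∑ j, c j • (α j : 𝒢.Sec).right (φ w) := by
    intro w
    rw [map_sub, hWr, sub_zero, map_sum]
    exact Finset.sum_congr rfl fun j _ => by rw [map_smul, hZr j w]
  have hsec : ∀ j, (α j : 𝒢.Sec).IsSection := fun j => 𝓑.isSection _ (α j).2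
  obtain ⟨χ, f, hχ, hf0, hf⟩ := hgen (fun w => ∑ j, c j • Z j w - W w)
    ((IsSmoothField.sum fun j => (hZ j).smul contMDiff_const).sub hW)
    (fun w => by
      rw [hφ.mfderiv_source, hdξ, map_sum]
      exact Finset.sum_eq_zero fun j _ => by
        rw [map_smul, (hsec j).mfderiv_s_right]; exact smul_zero _)
    (by rw [hc, sub_self])
  choose g hgs hg using fun a => hφ.exists_coefficients hρ (hV a)
  -- along `β`, this is a relation between the `α j`
  have hrel : ∀ᶠ y in 𝓝 x, ∑ j, (χ (β y) * ρ y * c j - ∑ a, f a (β y) * g a j (β y)) •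
      (α j : 𝒢.Sec) y = 0 := by
    filter_upwards [hβt] with y hy
    set r : Fin n → ℝ := fun j => χ (β y) * ρ y * c j - ∑ a, f a (β y) * g a j (β y) with hr
    have h1 := congrArg (fun k => ρ (𝒢.t (φ (β y))) • mfderiv 𝓘(ℝ, E) 𝓘(ℝ, EG) φ (β y) k)
      (hf (β y))
    simp only [map_smul, hdξ, map_sum, Finset.smul_sum] at h1
    have h2 : ∀ a, ρ (𝒢.t (φ (β y))) • f a (β y) •
        mfderiv 𝓘(ℝ, E) 𝓘(ℝ, EG) φ (β y) (V a (β y)) =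
        ∑ j, (f a (β y) * g a j (β y)) • (α j : 𝒢.Sec).right (φ (β y)) := by
      intro a
      rw [smul_comm, hg a, Finset.smul_sum]
      exact Finset.sum_congr rfl fun j _ => by rw [smul_smul]
    rw [Finset.sum_congr rfl fun a _ => h2 a, Finset.sum_comm, hy] at h1
    have h3 : (∑ j, r j • (α j : 𝒢.Sec)).right (φ (β y)) = 0 := by
      rw [LieGroupoid.Sec.right_sum_real_smul]
      simp only [hr, sub_smul, Finset.sum_sub_distrib, Finset.sum_smul]
      rw [← h1, sub_eq_zero]
      exact Finset.sum_congr rfl fun j _ => by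
        rw [smul_smul, smul_smul]
        congr 1
        ring
    have h4 := (𝓑.isSection (∑ j, r j • (α j : 𝒢.Sec)) (𝓑.toSubmodule.sum_mem fun j _ =>
      𝓑.toSubmodule.smul_of_tower_mem (r j) (α j).2)).eq_zero_of_right_eq_zero h3
    rw [hy, LieGroupoid.Sec.sum_apply] at h4
    exact h4
  -- the coefficients are made global by means of a bump function
  have hχβ : SmoothNear 𝓘(ℝ, EM) 𝓘(ℝ, ℝ) (fun y => χ (β y)) x :=
    SmoothNear.comp (g := χ) (ContMDiff.smoothNear χ.contMDiff _) hβ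
  have hkβ : ∀ j, SmoothNear 𝓘(ℝ, EM) 𝓘(ℝ, ℝ) (fun y => ∑ a, f a (β y) * g a j (β y)) x :=
    fun j => SmoothNear.comp (g := fun w => ∑ a, f a w * g a j w) (ContMDiff.smoothNear
      (contMDiff_finsetSum fun a _ => (f a).contMDiff.mul (hgs a j)) _) hβ
  obtain ⟨X, hXs, hX⟩ := hχβ.exists_global
  choose K hKs hK using fun j => (hkβ j).exists_global
  obtain ⟨ψ, -, hψs, hψ1⟩ := exists_cutoff (E := EM) (hrel.and (hX.and (eventually_all.2 hK)))
  refine hα.eq_zero (ρ := ψ * (⟨X, hXs⟩ * ρ)) ?_ (f := fun j => ψ * ⟨K j, hKs j⟩) ?_ ?_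
  · change ψ x * (X x * ρ x) = 1
    have h1 : X x = 1 := hX.self_of_nhds.trans hχ
    rw [hψ1.self_of_nhds, h1, hρx]
    norm_num
  · intro j
    change ψ x * K j x = 0
    rw [(hK j).self_of_nhds]
    simp [hf0]
  · intro y
    change (ψ y * (X y * ρ y)) • ∑ j, c j • (α j : 𝒢.Sec) y =
      ∑ j, (ψ y * K j y) • (α j : 𝒢.Sec) y
    by_cases hy : y ∈ tsupport ψ
    · obtain ⟨h1, h2, h3⟩ := hψs hy
      rw [← sub_eq_zero, ← Finset.sum_congr rfl fun j _ => (by rw [h3 j] :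
        (ψ y * (∑ a, f a (β y) * g a j (β y))) • (α j : 𝒢.Sec) y =
          (ψ y * K j y) • (α j : 𝒢.Sec) y), h2, Finset.smul_sum, ← Finset.sum_sub_distrib]
      have h4 := congrArg (fun k => ψ y • k) h1
      simp only [Finset.smul_sum, smul_zero] at h4
      rw [← h4]
      exact Finset.sum_congr rfl fun j _ => by
        rw [smul_smul, smul_smul, ← sub_smul]
        congr 1
        ring
    · have h0 := image_eq_zero_of_notMem_tsupport hy
      simp only [h0, zero_mul, zero_smul, Finset.sum_const_zero]

end IsBisubmersion

end Lift

/-! ### Bisubmersions and time-one flows -/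

section TimeOne

variable {EG EM G M : Type*} [NormedAddCommGroup EG] [NormedSpace ℝ EG] [FiniteDimensional ℝ EG]
  [NormedAddCommGroup EM] [NormedSpace ℝ EM] [FiniteDimensional ℝ EM]
  [TopologicalSpace G] [ChartedSpace EG G] [IsManifold 𝓘(ℝ, EG) ∞ G]
  [TopologicalSpace M] [ChartedSpace EM M] [IsManifold 𝓘(ℝ, EM) ∞ M] [T2Space M]
  {𝒢 : LieGroupoid EG EM G M} {𝓑 : SingularSubalgebroid 𝒢}
  {E U : Type*} [NormedAddCommGroup E] [NormedSpace ℝ E] [FiniteDimensional ℝ E]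
  [TopologicalSpace U] [ChartedSpace E U] [IsManifold 𝓘(ℝ, E) ∞ U] [T2Space U] {φ : U → G}

namespace IsBisubmersion

/-- The time-one flows of combinations of the `→α j`, starting on the image of a section `β` of
`t ∘ φ`, lift smoothly to the bisubmersion. -/
theorem exists_expAt_lift (hφ : IsBisubmersion 𝓑 (E := E) φ) {β : M → U} {x : M}
    (hβ : SmoothNear 𝓘(ℝ, EM) 𝓘(ℝ, E) β x) {n : ℕ} (α : Fin n → 𝓑.toSubmodule) :
    ∃ F : EuclideanSpace ℝ (Fin n) × M → U,
      SmoothNear (𝓘(ℝ, EuclideanSpace ℝ (Fin n)).prod 𝓘(ℝ, EM)) 𝓘(ℝ, E) F (0, x) ∧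
      F (0, x) = β x ∧ ∀ᶠ p in 𝓝 ((0 : EuclideanSpace ℝ (Fin n)), x), φ (F p) =
        expAt (fun g => ∑ j, p.1 j • (α j : 𝒢.Sec).right g) (φ (β p.2)) := by
  choose Z hZ hZr using fun j => hφ.lift_right (α j) (α j).2
  obtain ⟨h, hs, h0, -, hc⟩ := exists_smooth_field_flow Z (u := β x)
    (fun j => (hZ j).smoothFieldNear _) (fun j => Z j (β x)) (fun _ => rfl)
  set e := extChartAt 𝓘(ℝ, E) (β x) with he
  let T : EuclideanSpace ℝ (Fin n) →L[ℝ] (Fin n → ℝ) :=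
    (EuclideanSpace.equiv (Fin n) ℝ).toContinuousLinearMap
  have hin : SmoothNear (𝓘(ℝ, EuclideanSpace ℝ (Fin n)).prod 𝓘(ℝ, EM)) 𝓘(ℝ, (Fin n → ℝ) × E)
      (fun p : EuclideanSpace ℝ (Fin n) × M => (T p.1, e (β p.2))) (0, x) := by
    refine SmoothNear.prodMk_space ?_ ?_
    · exact SmoothNear.comp (g := T) (f := Prod.fst) (ContMDiff.smoothNear T.contDiff.contMDiff _)
        (ContMDiff.smoothNear contMDiff_fst _)
    · exact SmoothNear.comp (g := fun y => e (β y)) (f := Prod.snd)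
        (SmoothNear.comp (g := e) (smoothNear_extChartAt (β x)) hβ)
        (ContMDiff.smoothNear contMDiff_snd _)
  have hin0 : (T (0 : EuclideanSpace ℝ (Fin n)), e (β x)) = (0, e (β x)) := by rw [map_zero]
  have hmid : SmoothNear (𝓘(ℝ, EuclideanSpace ℝ (Fin n)).prod 𝓘(ℝ, EM)) 𝓘(ℝ, E)
      (fun p : EuclideanSpace ℝ (Fin n) × M => h (T p.1, e (β p.2))) (0, x) :=
    SmoothNear.comp (g := h) (by
      change SmoothNear _ _ _ (T (0 : EuclideanSpace ℝ (Fin n)), e (β x))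
      rw [hin0]
      exact smoothNear_iff_contDiffAt.2 hs) hin
  refine ⟨fun p => e.symm (h (T p.1, e (β p.2))), ?_, ?_, ?_⟩
  · refine SmoothNear.comp (g := e.symm) ?_ hmid
    change SmoothNear _ _ _ (h (T (0 : EuclideanSpace ℝ (Fin n)), e (β x)))
    rw [hin0, h0]
    exact smoothNear_extChartAt_symm _
  · change e.symm (h (T (0 : EuclideanSpace ℝ (Fin n)), e (β x))) = β x
    rw [hin0, h0]
    exact extChartAt_to_inv _
  · have hc' : ∀ᶠ q in 𝓝 (T (0 : EuclideanSpace ℝ (Fin n)), e (β x)), ∃ c : ℝ → U,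
        c 0 = e.symm q.2 ∧ c 1 = e.symm (h q) ∧
        ∀ τ ∈ Ioo (-1 : ℝ) 2, HasVelocity E c (∑ j, q.1 j • Z j (c τ)) τ := by
      rw [hin0]
      exact hc
    have hβc : ContinuousAt (fun p : EuclideanSpace ℝ (Fin n) × M => β p.2) (0, x) :=
      ContinuousAt.comp (g := β) hβ.continuousAt continuousAt_snd
    filter_upwards [hin.continuousAt.eventually hc',
      hβc.eventually (eventually_extChartAt_left_inv (E := E) (β x))] with p hp hp'
    obtain ⟨c, hc0, hc1, hcv⟩ := hp
    have h1 := hφ.expAt_eq α (lam := p.1) (c := c) (v := fun τ => ∑ j, p.1 j • Z j (c τ)) hcv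
      (fun τ => by
      rw [map_sum]
      exact Finset.sum_congr rfl fun j _ => by rw [map_smul, hZr j])
    rw [hc0, hc1] at h1
    change expAt _ (φ (e.symm (e (β p.2)))) = _ at h1
    rw [hp'] at h1
    exact h1.symm

/-- Near `β x`, the map `φ` factors through the time-one flows of combinations of generators
`→α j`, starting on the image of a section `β` of `t ∘ φ` that is transversal to the fibres of
`s ∘ φ`. For minimal generators the factoring map is a submersion. -/
theorem exists_expAt_factorization (hφ : IsBisubmersion 𝓑 (E := E) φ) {β : M → U} {x : M}
    (hβ : SmoothNear 𝓘(ℝ, EM) 𝓘(ℝ, E) β x) (hβt : ∀ᶠ y in 𝓝 x, 𝒢.t (φ (β y)) = y)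
    (hβs : Function.Surjective (mfderiv 𝓘(ℝ, EM) 𝓘(ℝ, EM) (fun y => 𝒢.s (φ (β y))) x))
    {n : ℕ} {α : Fin n → 𝓑.toSubmodule} (hα : 𝓑.GeneratesAt x α) :
    ∃ g : U → EuclideanSpace ℝ (Fin n) × M,
      SmoothNear 𝓘(ℝ, E) (𝓘(ℝ, EuclideanSpace ℝ (Fin n)).prod 𝓘(ℝ, EM)) g (β x) ∧
      g (β x) = (0, x) ∧
      (∀ᶠ w in 𝓝 (β x), expAt (fun k => ∑ j, (g w).1 j • (α j : 𝒢.Sec).right k)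
        (φ (β (g w).2)) = φ w) ∧
      (𝓑.IsMinimalGenerators x α → Function.Surjective (mfderiv 𝓘(ℝ, E)
        (𝓘(ℝ, EuclideanSpace ℝ (Fin n)).prod 𝓘(ℝ, EM)) g (β x))) := by
  have : CompleteSpace E := FiniteDimensional.complete ℝ E
  have : CompleteSpace EM := FiniteDimensional.complete ℝ EM
  obtain ⟨ρ, hρx, hρ⟩ := hα
  choose Z hZ hZr using fun j => hφ.lift_right (α j) (α j).2
  have hsv : SmoothNear 𝓘(ℝ, E) 𝓘(ℝ, EM) (fun w => 𝒢.s (φ w)) (β x) :=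
    ContMDiffOn.smoothNear hφ.submersion_s.1 isOpen_univ (mem_univ _)
  have ht : ContMDiff 𝓘(ℝ, E) 𝓘(ℝ, EM) ∞ (fun w => 𝒢.t (φ w)) :=
    contMDiffOn_univ.1 hφ.submersion_t.1
  obtain ⟨d, W, hW, hWspan, -⟩ := exists_vertical_generators hsv
    (hφ.submersion_s.2 (β x) (mem_univ _))
  choose γ hγs hγ using fun a => hφ.exists_coefficients hρ (hW a)
  -- the fields `W a`, corrected by combinations of the `Z j`, are in the kernel of `dφ`
  let W' : Fin d → ∀ w : U, TangentSpace 𝓘(ℝ, E) w := fun a w =>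
    ρ (𝒢.t (φ w)) • W a w - ∑ j, γ a j w • Z j w
  have hW's : ∀ a, IsSmoothField (W' a) := fun a =>
    ((hW a).1.smul (ρ.contMDiff.comp ht)).sub (IsSmoothField.sum fun j => (hZ j).smul (hγs a j))
  have hW'r : ∀ a w, mfderiv 𝓘(ℝ, E) 𝓘(ℝ, EG) φ w (W' a w) = 0 := by
    intro a w
    change mfderiv 𝓘(ℝ, E) 𝓘(ℝ, EG) φ w (ρ (𝒢.t (φ w)) • W a w - ∑ j, γ a j w • Z j w) = 0
    rw [map_sub, map_smul, hγ a w, map_sum, sub_eq_zero]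
    exact Finset.sum_congr rfl fun j _ => by rw [map_smul, hZr j w]
  let V : Fin n ⊕ Fin d → ∀ w : U, TangentSpace 𝓘(ℝ, E) w := Sum.elim Z W'
  have hV : ∀ i, IsSmoothField (V i) := by
    rintro (j | a)
    · exact hZ j
    · exact hW's a
  let v₀ : Fin n ⊕ Fin d → E := fun i => V i (β x)
  obtain ⟨h, hs, h0, hd, hc⟩ := exists_smooth_field_flow V (u := β x)
    (fun i => (hV i).smoothFieldNear _) v₀ (fun _ => rfl)
  set e := extChartAt 𝓘(ℝ, E) (β x) with he
  set c := extChartAt 𝓘(ℝ, EM) x with hcdef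
  -- the flow starting on the image of `β`, in coordinates
  let b : EM → E := inCharts EM E β x
  have hb : SmoothNear 𝓘(ℝ, EM) 𝓘(ℝ, E) b (c x) := hβ.inCharts
  have hb0 : b (c x) = e (β x) :=
    congrArg (fun y => e (β y)) (extChartAt_to_inv (I := 𝓘(ℝ, EM)) x)
  let B : EM →L[ℝ] E := mfderiv 𝓘(ℝ, EM) 𝓘(ℝ, E) β x
  have hB : HasFDerivAt b B (c x) := hasFDerivAt_inCharts hβ.mdifferentiableAt
  let H : (Fin n ⊕ Fin d → ℝ) × EM → E := fun q => h (q.1, b q.2)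
  let A : (Fin n ⊕ Fin d → ℝ) × EM := (0, c x)
  let H' : (Fin n ⊕ Fin d → ℝ) × EM →L[ℝ] E :=
    (ContinuousLinearMap.snd ℝ (Fin n ⊕ Fin d → ℝ) E +
        ∑ j, (((ContinuousLinearMap.proj j : (Fin n ⊕ Fin d → ℝ) →L[ℝ] ℝ).comp
          (ContinuousLinearMap.fst ℝ (Fin n ⊕ Fin d → ℝ) E)).smulRight (v₀ j))).comp
      ((ContinuousLinearMap.fst ℝ _ EM).prod (B.comp (ContinuousLinearMap.snd ℝ _ EM)))
  have hH'app : ∀ ν z, H' (ν, z) = B z + ∑ j, ν j • v₀ j := fun ν z => by simp [H']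
  have hH0 : H A = e (β x) := by simp only [H, A, hb0, h0]
  have hHd : HasFDerivAt H H' A := by
    refine HasFDerivAt.comp (g := h) A ?_ (hasFDerivAt_fst.prodMk
      (HasFDerivAt.comp (g := b) A hB hasFDerivAt_snd))
    simp only [A, hb0]
    exact hd
  have hHs : ∀ᶠ q in 𝓝 A, ContDiffAt ℝ ∞ H q := by
    have h1 : SmoothNear 𝓘(ℝ, (Fin n ⊕ Fin d → ℝ) × E) 𝓘(ℝ, E) h (A.1, b A.2) := by
      simp only [A, hb0]
      exact smoothNear_iff_contDiffAt.2 hs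
    have h2 : SmoothNear 𝓘(ℝ, (Fin n ⊕ Fin d → ℝ) × EM) 𝓘(ℝ, (Fin n ⊕ Fin d → ℝ) × E)
        (fun q : (Fin n ⊕ Fin d → ℝ) × EM => (q.1, b q.2)) A :=
      SmoothNear.prodMk_space (ContMDiff.smoothNear contDiff_fst.contMDiff _)
        (SmoothNear.comp (g := b) (f := Prod.snd) hb
          (ContMDiff.smoothNear contDiff_snd.contMDiff _))
    exact smoothNear_iff_contDiffAt.1 (SmoothNear.comp (g := h) h1 h2)
  -- the derivative of `s ∘ φ`
  let S : E →L[ℝ] EM := mfderiv 𝓘(ℝ, E) 𝓘(ℝ, EM) (fun w => 𝒢.s (φ w)) (β x)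
  have hSB : Function.Surjective (S.comp B) := by
    have h1 := mfderiv_comp x (g := fun w => 𝒢.s (φ w)) (f := β) (I := 𝓘(ℝ, EM)) (I' := 𝓘(ℝ, E))
      (I'' := 𝓘(ℝ, EM)) hsv.mdifferentiableAt hβ.mdifferentiableAt
    intro y
    obtain ⟨z, hz⟩ := hβs y
    exact ⟨z, (congrArg (fun T : EM →L[ℝ] EM => T z) h1).symm.trans hz⟩
  have hSBi : Function.Injective (S.comp B) :=
    (LinearMap.injective_iff_surjective (f := (S.comp B).toLinearMap)).2 hSB
  have hSv : ∀ i, S (v₀ i) = 0 := by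
    rintro (j | a)
    · exact (hφ.mfderiv_source (β x) (Z j (β x))).trans
        ((congrArg (mfderiv 𝓘(ℝ, EG) 𝓘(ℝ, EM) 𝒢.s (φ (β x))) (hZr j (β x))).trans
          ((𝓑.isSection _ (α j).2).mfderiv_s_right _))
    · exact (hφ.mfderiv_source (β x) (W' a (β x))).trans
        ((congrArg (mfderiv 𝓘(ℝ, EG) 𝓘(ℝ, EM) 𝒢.s (φ (β x))) (hW'r a (β x))).trans (map_zero _))
  have hHsurj : Function.Surjective H' := by
    intro k
    obtain ⟨z, hz⟩ := hSB (S k)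
    have hz' : S (k - B z) = 0 := by
      rw [map_sub, sub_eq_zero]
      exact hz.symm
    obtain ⟨r, hr⟩ := hWspan (k - B z) hz'
    let Wu : Fin d → E := fun a => W a (β x)
    have hW0 : ∀ a, Wu a = v₀ (Sum.inr a) + ∑ j, γ a j (β x) • v₀ (Sum.inl j) := by
      intro a
      have h1 : v₀ (Sum.inr a) = ρ (𝒢.t (φ (β x))) • Wu a -
        ∑ j, γ a j (β x) • v₀ (Sum.inl j) := rfl
      rw [h1, hβt.self_of_nhds, hρx, one_smul, sub_add_cancel]
    have hr' : k - B z = ∑ a, r a • (v₀ (Sum.inr a) + ∑ j, γ a j (β x) • v₀ (Sum.inl j)) :=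
      Eq.trans hr (Finset.sum_congr rfl fun a _ => congrArg (fun k : E => r a • k) (hW0 a))
    refine ⟨(Sum.elim (fun j => ∑ a, r a * γ a j (β x)) r, z), ?_⟩
    rw [hH'app, Fintype.sum_sum_type]
    simp only [Sum.elim_inl, Sum.elim_inr]
    have h2 : k = B z + ∑ a, r a • (v₀ (Sum.inr a) + ∑ j, γ a j (β x) • v₀ (Sum.inl j)) := by
      rw [← hr', add_sub_cancel]
    rw [h2]
    congr 1
    simp only [smul_add, Finset.sum_add_distrib, Finset.smul_sum, Finset.sum_smul, smul_smul]
    rw [add_comm, Finset.sum_comm]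
  obtain ⟨π, hπs, hπ0, hπ1, -⟩ := exists_fiber_retraction_aux hHs hHd hHsurj
  rw [hH0] at hπs hπ0 hπ1
  -- a smooth right inverse of the flow map
  let σ : E → (Fin n ⊕ Fin d → ℝ) × EM := fun y => π (y, A)
  have hin : Continuous (fun y : E => (y, A)) := by fun_prop
  have hσs : SmoothNear 𝓘(ℝ, E) 𝓘(ℝ, (Fin n ⊕ Fin d → ℝ) × EM) σ (e (β x)) :=
    SmoothNear.comp (g := π) (f := fun y : E => (y, A)) (smoothNear_iff_contDiffAt.2 hπs)
      (ContMDiff.smoothNear (contDiff_id.prodMk contDiff_const).contMDiff _)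
  have hσ0 : σ (e (β x)) = A := hπ0
  have hσ1 : ∀ᶠ y in 𝓝 (e (β x)), H (σ y) = y := (hin.continuousAt (x := e (β x))).eventually hπ1
  obtain ⟨T, hTapp⟩ : ∃ T : (Fin n ⊕ Fin d → ℝ) →L[ℝ] EuclideanSpace ℝ (Fin n),
      ∀ ν j, T ν j = ν (Sum.inl j) :=
    ⟨(EuclideanSpace.equiv (Fin n) ℝ).symm.toContinuousLinearMap.comp
      (ContinuousLinearMap.pi fun j => ContinuousLinearMap.proj (Sum.inl j)), fun _ _ => rfl⟩
  have hes : SmoothNear 𝓘(ℝ, E) 𝓘(ℝ, E) e (β x) := smoothNear_extChartAt (β x)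
  have hσe : SmoothNear 𝓘(ℝ, E) 𝓘(ℝ, (Fin n ⊕ Fin d → ℝ) × EM) (fun w => σ (e w)) (β x) :=
    SmoothNear.comp (g := σ) hσs hes
  have hcs : SmoothNear 𝓘(ℝ, EM) 𝓘(ℝ, EM) c.symm (σ (e (β x))).2 := by
    rw [hσ0]
    exact smoothNear_extChartAt_symm x
  have hsnd : SmoothNear 𝓘(ℝ, E) 𝓘(ℝ, EM) (fun w => (σ (e w)).2) (β x) :=
    SmoothNear.comp (g := Prod.snd) (ContMDiff.smoothNear contDiff_snd.contMDiff _) hσe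
  have hg2 : SmoothNear 𝓘(ℝ, E) 𝓘(ℝ, EM) (fun w => c.symm (σ (e w)).2) (β x) :=
    SmoothNear.comp (g := c.symm) hcs hsnd
  have hg1 : SmoothNear 𝓘(ℝ, E) 𝓘(ℝ, EuclideanSpace ℝ (Fin n)) (fun w => T (σ (e w)).1) (β x) :=
    SmoothNear.comp (g := fun q : (Fin n ⊕ Fin d → ℝ) × EM => T q.1)
      (ContMDiff.smoothNear (T.contDiff.comp contDiff_fst).contMDiff _) hσe
  refine ⟨fun w => (T (σ (e w)).1, c.symm (σ (e w)).2), hg1.prodMk hg2, ?_, ?_, ?_⟩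
  · simp only [hσ0, A, map_zero, hcdef, extChartAt_to_inv]
  · -- `φ` maps integral curves of the fields `V i` to those of the fields `→α j`
    have hqc : ContinuousAt (fun w => ((σ (e w)).1, b (σ (e w)).2)) (β x) := by
      have h1 : ContinuousAt (fun w => b (σ (e w)).2) (β x) :=
        ContinuousAt.comp (g := b) (by rw [hσ0]; exact hb.continuousAt) hsnd.continuousAt
      exact (continuousAt_fst.comp hσe.continuousAt).prodMk h1
    have hq0 : ((σ (e (β x))).1, b (σ (e (β x))).2) = (0, e (β x)) := by
      rw [hσ0]
      simp only [A, hb0]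
    have hβg : ContinuousAt (fun w => β (c.symm (σ (e w)).2)) (β x) := by
      refine ContinuousAt.comp (g := β) ?_ hg2.continuousAt
      simp only [hσ0, A, hcdef, extChartAt_to_inv]
      exact hβ.continuousAt
    have hβg0 : β (c.symm (σ (e (β x))).2) = β x := by
      simp only [hσ0, A, hcdef, extChartAt_to_inv]
    rw [← hq0] at hc
    have hinv := eventually_extChartAt_left_inv (E := E) (β x)
    rw [← he] at hinv
    have hinv' := hinv
    nth_rewrite 1 [← hβg0] at hinv'
    filter_upwards [hqc.eventually hc, hes.continuousAt.eventually hσ1, hinv,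
      hβg.eventually hinv'] with w hw hw1 hw2 hw3
    obtain ⟨k, hk0, hk1, hkv⟩ := hw
    have h1 := hφ.expAt_eq α (lam := fun j => (σ (e w)).1 (Sum.inl j)) (c := k)
      (v := fun τ => ∑ i, (σ (e w)).1 i • V i (k τ)) hkv (fun τ => by
      rw [Fintype.sum_sum_type, map_add, map_sum, map_sum]
      have h2 : ∀ a, mfderiv 𝓘(ℝ, E) 𝓘(ℝ, EG) φ (k τ)
          ((σ (e w)).1 (Sum.inr a) • V (Sum.inr a) (k τ)) = 0 := fun a => by
        rw [map_smul]
        exact (congrArg (fun z => (σ (e w)).1 (Sum.inr a) • z) (hW'r a (k τ))).trans (smul_zero _)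
      rw [Finset.sum_eq_zero fun a _ => h2 a, add_zero]
      exact Finset.sum_congr rfl fun j _ => by
        rw [map_smul]
        exact congrArg (fun z => (σ (e w)).1 (Sum.inl j) • z) (hZr j (k τ)))
    rw [hk0, hk1] at h1
    have h3 : h ((σ (e w)).1, b (σ (e w)).2) = e w := hw1
    have h4 : e.symm (b (σ (e w)).2) = β (c.symm (σ (e w)).2) := hw3
    rw [h3, hw2] at h1
    change expAt _ (φ (e.symm (b (σ (e w)).2))) = _ at h1
    rw [h4] at h1
    simpa only [hTapp] using h1
  · intro hmin
    let Dσ : E →L[ℝ] (Fin n ⊕ Fin d → ℝ) × EM := fderiv ℝ σ (e (β x))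
    have hD : HasFDerivAt σ Dσ (e (β x)) :=
      ((smoothNear_iff_contDiffAt.1 hσs).self_of_nhds.differentiableAt (by simp)).hasFDerivAt
    have hHD : ∀ k, H' (Dσ k) = k := by
      have h1 : HasFDerivAt (fun y => H (σ y)) (H'.comp Dσ) (e (β x)) :=
        HasFDerivAt.comp (g := H) _ (by rw [hσ0]; exact hHd) hD
      have h2 : HasFDerivAt (fun y => H (σ y)) (ContinuousLinearMap.id ℝ E) (e (β x)) :=
        (hasFDerivAt_id _).congr_of_eventuallyEq hσ1
      exact fun k => congrArg (fun T : E →L[ℝ] E => T k) (h1.unique h2)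
    have hed : HasMFDerivAt 𝓘(ℝ, E) 𝓘(ℝ, E) e (β x) (ContinuousLinearMap.id ℝ E) := by
      have h := hes.mdifferentiableAt.hasMFDerivAt
      rwa [mfderiv_extChartAt_self] at h
    have hcd : HasMFDerivAt 𝓘(ℝ, EM) 𝓘(ℝ, EM) c.symm (σ (e (β x))).2
        (ContinuousLinearMap.id ℝ EM) := by
      have h := hcs.mdifferentiableAt.hasMFDerivAt
      rw [hσ0] at h ⊢
      change HasMFDerivAt 𝓘(ℝ, EM) 𝓘(ℝ, EM) c.symm (c x) _ at h
      rw [mfderiv_extChartAt_symm_self] at h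
      exact h
    have hT : HasFDerivAt (fun y => T (σ y).1)
        ((T.comp (ContinuousLinearMap.fst ℝ (Fin n ⊕ Fin d → ℝ) EM)).comp Dσ) (e (β x)) :=
      HasFDerivAt.comp (g := T.comp (ContinuousLinearMap.fst ℝ (Fin n ⊕ Fin d → ℝ) EM)) _
        (ContinuousLinearMap.hasFDerivAt _) hD
    have hd1 := HasMFDerivAt.comp (g := fun y => T (σ y).1) (f := e) (β x) hT.hasMFDerivAt hed
    have hS : HasFDerivAt (fun y => (σ y).2)
        ((ContinuousLinearMap.snd ℝ (Fin n ⊕ Fin d → ℝ) EM).comp Dσ) (e (β x)) :=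
      HasFDerivAt.comp (g := Prod.snd) _ hasFDerivAt_snd hD
    have hd2 := HasMFDerivAt.comp (g := c.symm) (f := fun w => (σ (e w)).2) (β x) hcd
      (HasMFDerivAt.comp (g := fun y => (σ y).2) (f := e) (β x) hS.hasMFDerivAt hed)
    have hfull := (hd1.prodMk hd2).mfderiv
    rintro ⟨(lam : EuclideanSpace ℝ (Fin n)), (z : EM)⟩
    let k : E := B z + ∑ j, lam j • v₀ (Sum.inl j)
    refine ⟨k, (congrArg (fun D : E →L[ℝ] EuclideanSpace ℝ (Fin n) × EM => D k) hfull).trans ?_⟩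
    obtain ⟨ν, z', hνz⟩ : ∃ ν z', Dσ k = (ν, z') := ⟨_, _, rfl⟩
    have h1 : B z' + ∑ i, ν i • v₀ i = B z + ∑ j, lam j • v₀ (Sum.inl j) := by
      rw [← hH'app, ← hνz, hHD]
    have h2 : z' = z := by
      refine hSBi ?_
      have h3 := congrArg S h1
      simp only [map_add, map_sum, map_smul, hSv, smul_zero, Finset.sum_const_zero, add_zero] at h3
      exact h3
    rw [h2] at h1 hνz
    have h3 := add_left_cancel h1
    rw [Fintype.sum_sum_type] at h3
    have h4 : (fun j => lam j - ν (Sum.inl j)) = 0 := by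
      refine hφ.eq_zero_of_sum_lift_eq hβ hβt hmin hZ hZr
        (W := fun w => ∑ a, ν (Sum.inr a) • W' a w)
        (IsSmoothField.sum fun a => (hW's a).smul contMDiff_const) (fun w => ?_) ?_
      · rw [map_sum]
        exact Finset.sum_eq_zero fun a _ => by
          rw [map_smul, hW'r]; exact smul_zero _
      · change ∑ j, (lam j - ν (Sum.inl j)) • v₀ (Sum.inl j) = ∑ a, ν (Sum.inr a) • v₀ (Sum.inr a)
        simp only [sub_smul, Finset.sum_sub_distrib]
        rw [← h3, add_sub_cancel_left]
    have h5 : T ν = lam := by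
      ext j
      rw [hTapp]
      have := congrFun h4 j
      simp only [Pi.zero_apply] at this
      linarith
    change (T (Dσ k).1, (Dσ k).2) = (lam, z)
    rw [hνz, h5]

end IsBisubmersion

end TimeOne

/-! ### Local morphisms of bisubmersions -/

section Morphisms

variable {EG EM G M : Type*} [NormedAddCommGroup EG] [NormedSpace ℝ EG] [FiniteDimensional ℝ EG]
  [NormedAddCommGroup EM] [NormedSpace ℝ EM] [FiniteDimensional ℝ EM]
  [TopologicalSpace G] [ChartedSpace EG G] [IsManifold 𝓘(ℝ, EG) ∞ G]
  [TopologicalSpace M] [ChartedSpace EM M] [IsManifold 𝓘(ℝ, EM) ∞ M] [T2Space M]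
  {𝒢 : LieGroupoid EG EM G M} {𝓑 : SingularSubalgebroid 𝒢}

theorem surjective_mfderiv_of_leftInverse {f k : M → M} {x : M}
    (hf : MDifferentiableAt 𝓘(ℝ, EM) 𝓘(ℝ, EM) f x)
    (hk : MDifferentiableAt 𝓘(ℝ, EM) 𝓘(ℝ, EM) k (f x)) (h : ∀ᶠ y in 𝓝 x, k (f y) = y) :
    Function.Surjective (mfderiv 𝓘(ℝ, EM) 𝓘(ℝ, EM) f x) := by
  have h1 := HasMFDerivAt.comp x hk.hasMFDerivAt hf.hasMFDerivAt
  have h2 := hasMFDerivAt_unique h1 ((hasMFDerivAt_id x).congr_of_eventuallyEq h)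
  let D : EM →L[ℝ] EM := mfderiv 𝓘(ℝ, EM) 𝓘(ℝ, EM) f x
  let D' : EM →L[ℝ] EM := mfderiv 𝓘(ℝ, EM) 𝓘(ℝ, EM) k (f x)
  have h3 : ∀ z, D' (D z) = z := fun z => congrArg (fun T : EM →L[ℝ] EM => T z) h2
  exact (LinearMap.injective_iff_surjective (f := D.toLinearMap)).1
    (Function.LeftInverse.injective h3)

namespace Bisubmersion

theorem smoothNear_source (U : Bisubmersion.{v} 𝓑) (u : U.carrier) :
    SmoothNear 𝓘(ℝ, U.model) 𝓘(ℝ, EM) (fun w => 𝒢.s (U.φ w)) u :=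
  ContMDiffOn.smoothNear U.isBisubmersion.submersion_s.1 isOpen_univ (mem_univ _)

theorem smoothNear_target (U : Bisubmersion.{v} 𝓑) (u : U.carrier) :
    SmoothNear 𝓘(ℝ, U.model) 𝓘(ℝ, EM) (fun w => 𝒢.t (U.φ w)) u :=
  ContMDiffOn.smoothNear U.isBisubmersion.submersion_t.1 isOpen_univ (mem_univ _)

theorem localMorphism_iff {U₁ U₂ : Bisubmersion.{v} 𝓑} {u₁ : U₁.carrier} {u₂ : U₂.carrier} :
    U₁.LocalMorphism U₂ u₁ u₂ ↔ ∃ f : U₁.carrier → U₂.carrier,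
      SmoothNear 𝓘(ℝ, U₁.model) 𝓘(ℝ, U₂.model) f u₁ ∧ f u₁ = u₂ ∧
      ∀ᶠ w in 𝓝 u₁, U₂.φ (f w) = U₁.φ w := by
  constructor
  · rintro ⟨W, f, hW, hu, ⟨hf, hφ⟩, hfu⟩
    exact ⟨f, ContMDiffOn.smoothNear hf hW hu, hfu, by
      filter_upwards [hW.mem_nhds hu] with w hw using hφ w hw⟩
  · rintro ⟨f, hf, hfu, hφ⟩
    obtain ⟨W, hW, hWo, hu⟩ := eventually_nhds_iff.1 (hf.and hφ)
    exact ⟨W, f, hWo, hu, ⟨fun w hw => (hW w hw).1.contMDiffWithinAt, fun w hw => (hW w hw).2⟩, hfu⟩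

/-- A bisection through `u`, as the image of a section `β` of `t ∘ φ` that is transversal to the
fibres of `s ∘ φ`. -/
theorem IsBisection.exists_section {U : Bisubmersion.{v} 𝓑} {b : Set U.carrier}
    (hb : U.IsBisection b) {u : U.carrier} (hu : u ∈ b) :
    ∃ β : M → U.carrier, SmoothNear 𝓘(ℝ, EM) 𝓘(ℝ, U.model) β (𝒢.t (U.φ u)) ∧
      β (𝒢.t (U.φ u)) = u ∧
      (∀ᶠ y in 𝓝 (𝒢.t (U.φ u)), 𝒢.t (U.φ (β y)) = y ∧ β y ∈ b) ∧
      Function.Surjective (mfderiv 𝓘(ℝ, EM) 𝓘(ℝ, EM) (fun y => 𝒢.s (U.φ (β y)))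
        (𝒢.t (U.φ u))) := by
  obtain ⟨⟨V', σ', hV', hσ', hsσ', hb'⟩, ⟨V, σ, hV, hσ, htσ, rfl⟩⟩ := hb
  obtain ⟨y, hy, rfl⟩ := hu
  have hty : 𝒢.t (U.φ (σ y)) = y := htσ y hy
  rw [hty]
  have hσy : SmoothNear 𝓘(ℝ, EM) 𝓘(ℝ, U.model) σ y := ContMDiffOn.smoothNear hσ hV hy
  -- on the bisection, `σ' ∘ s` is the identity
  have hσ's : ∀ z ∈ V, 𝒢.s (U.φ (σ z)) ∈ V' ∧ σ' (𝒢.s (U.φ (σ z))) = σ z := by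
    intro z hz
    have h1 : σ z ∈ σ' '' V' := hb' ▸ mem_image_of_mem σ hz
    obtain ⟨z', hz', h2⟩ := h1
    have h3 : 𝒢.s (U.φ (σ z)) = z' := h2 ▸ hsσ' z' hz'
    rw [h3]
    exact ⟨hz', h2⟩
  refine ⟨σ, hσy, rfl, ?_, ?_⟩
  · filter_upwards [hV.mem_nhds hy] with z hz using ⟨htσ z hz, mem_image_of_mem σ hz⟩
  · have h1 := SmoothNear.comp (g := fun w => 𝒢.s (U.φ w)) (U.smoothNear_source (σ y)) hσy
    have h2 : SmoothNear 𝓘(ℝ, EM) 𝓘(ℝ, EM) (fun z => 𝒢.t (U.φ (σ' z))) (𝒢.s (U.φ (σ y))) :=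
      SmoothNear.comp (g := fun w => 𝒢.t (U.φ w)) (U.smoothNear_target _)
        (ContMDiffOn.smoothNear hσ' hV' (hσ's y hy).1)
    refine surjective_mfderiv_of_leftInverse h1.mdifferentiableAt h2.mdifferentiableAt ?_
    filter_upwards [hV.mem_nhds hy] with z hz
    rw [(hσ's z hz).2]
    exact htσ z hz

/-- If sections `β₁`, `β₂` of the target maps have the same image in `G` and `β₁` is transversal to
the source fibres, there is a local morphism: factor `φ₁` through the time-one flows starting on the
common image and lift these to `U₂`. -/
theorem localMorphism_of_sections {U₁ U₂ : Bisubmersion.{v} 𝓑} {β₁ : M → U₁.carrier}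
    {β₂ : M → U₂.carrier} {x : M} (hβ₁ : SmoothNear 𝓘(ℝ, EM) 𝓘(ℝ, U₁.model) β₁ x)
    (hβ₂ : SmoothNear 𝓘(ℝ, EM) 𝓘(ℝ, U₂.model) β₂ x)
    (ht : ∀ᶠ y in 𝓝 x, 𝒢.t (U₁.φ (β₁ y)) = y)
    (hs : Function.Surjective (mfderiv 𝓘(ℝ, EM) 𝓘(ℝ, EM) (fun y => 𝒢.s (U₁.φ (β₁ y))) x))
    (hφ : ∀ᶠ y in 𝓝 x, U₁.φ (β₁ y) = U₂.φ (β₂ y)) :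
    U₁.LocalMorphism U₂ (β₁ x) (β₂ x) := by
  obtain ⟨n, α, hα⟩ := 𝓑.exists_generatesAt x
  obtain ⟨F, hF, hF0, hFφ⟩ := U₂.isBisubmersion.exists_expAt_lift hβ₂ α
  obtain ⟨g, hg, hg0, hgφ, -⟩ := U₁.isBisubmersion.exists_expAt_factorization hβ₁ ht hs hα
  have hg2 : ContinuousAt (fun w => (g w).2) (β₁ x) := continuousAt_snd.comp hg.continuousAt
  rw [← hg0] at hF hFφ
  have hφ' : ∀ᶠ y in 𝓝 (g (β₁ x)).2, U₁.φ (β₁ y) = U₂.φ (β₂ y) := by rwa [hg0]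
  refine localMorphism_iff.2 ⟨fun w => F (g w), SmoothNear.comp (g := F) hF hg, by
    simp only [hg0, hF0], ?_⟩
  filter_upwards [hgφ, hg.continuousAt.eventually hFφ, hg2.eventually hφ'] with w h1 h2 h3
  rw [h2, ← h3, h1]

theorem LocalMorphism.refl (U : Bisubmersion.{v} 𝓑) (u : U.carrier) : U.LocalMorphism U u u :=
  localMorphism_iff.2 ⟨id, ContMDiff.smoothNear contMDiff_id _, rfl,
    Eventually.of_forall fun _ => rfl⟩

theorem LocalMorphism.trans {U₁ U₂ U₃ : Bisubmersion.{v} 𝓑} {u₁ : U₁.carrier} {u₂ : U₂.carrier}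
    {u₃ : U₃.carrier} (h : U₁.LocalMorphism U₂ u₁ u₂) (h' : U₂.LocalMorphism U₃ u₂ u₃) :
    U₁.LocalMorphism U₃ u₁ u₃ := by
  obtain ⟨f, hf, rfl, hfφ⟩ := localMorphism_iff.1 h
  obtain ⟨f', hf', rfl, hfφ'⟩ := localMorphism_iff.1 h'
  refine localMorphism_iff.2 ⟨fun w => f' (f w), SmoothNear.comp (g := f') hf' hf, rfl, ?_⟩
  filter_upwards [hfφ, hf.continuousAt.eventually hfφ'] with w h1 h2
  rw [h2, h1]

/-- Local morphisms can be reversed: a local bisection of `U₁` is mapped to one of `U₂` with the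
same image in `G`. -/
theorem LocalMorphism.symm {U₁ U₂ : Bisubmersion.{v} 𝓑} {u₁ : U₁.carrier} {u₂ : U₂.carrier}
    (h : U₁.LocalMorphism U₂ u₁ u₂) : U₂.LocalMorphism U₁ u₂ u₁ := by
  obtain ⟨f, hf, rfl, hfφ⟩ := localMorphism_iff.1 h
  obtain ⟨β, hβ, hβ0, hβt, hβs⟩ := exists_transversal_section (U₁.smoothNear_target u₁)
    (U₁.smoothNear_source u₁) (U₁.isBisubmersion.submersion_t.2 u₁ (mem_univ _))
    (U₁.isBisubmersion.submersion_s.2 u₁ (mem_univ _))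
  set x := 𝒢.t (U₁.φ u₁) with hx
  have hfβ : ∀ᶠ y in 𝓝 x, U₂.φ (f (β y)) = U₁.φ (β y) :=
    hβ.continuousAt.eventually (by rwa [hβ0])
  have h1 := localMorphism_of_sections (U₁ := U₂) (U₂ := U₁) (β₁ := fun y => f (β y)) (β₂ := β)
    (x := x) (SmoothNear.comp (g := f) (by rwa [hβ0]) hβ) hβ ?_ ?_ hfβ
  · rwa [hβ0] at h1
  · filter_upwards [hβt, hfβ] with y h2 h3
    rw [h3, h2]
  · have h2 : (fun y => 𝒢.s (U₂.φ (f (β y)))) =ᶠ[𝓝 x] fun y => 𝒢.s (U₁.φ (β y)) := by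
      filter_upwards [hfβ] with y hy
      rw [hy]
    have h3 := h2.mfderiv_eq (I := 𝓘(ℝ, EM)) (I' := 𝓘(ℝ, EM))
    intro z
    obtain ⟨z', hz'⟩ := hβs z
    exact ⟨z', (congrArg (fun T : EM →L[ℝ] EM => T z') h3).trans hz'⟩

/-- The sections of `t ∘ φ` given by bisections that are carried by `u`. -/
theorem Carries.exists_section {U : Bisubmersion.{v} 𝓑} {u : U.carrier} {c : Set G}
    (h : U.Carries u c) :
    ∃ β : M → U.carrier, SmoothNear 𝓘(ℝ, EM) 𝓘(ℝ, U.model) β (𝒢.t (U.φ u)) ∧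
      β (𝒢.t (U.φ u)) = u ∧
      (∀ᶠ y in 𝓝 (𝒢.t (U.φ u)), 𝒢.t (U.φ (β y)) = y ∧ U.φ (β y) ∈ c) ∧
      Function.Surjective (mfderiv 𝓘(ℝ, EM) 𝓘(ℝ, EM) (fun y => 𝒢.s (U.φ (β y)))
        (𝒢.t (U.φ u))) := by
  obtain ⟨-, -, b, hb, hub, O, -, hO⟩ := h
  obtain ⟨β, hβ, hβ0, hβt, hβs⟩ := hb.exists_section hub
  refine ⟨β, hβ, hβ0, ?_, hβs⟩
  filter_upwards [hβt] with y hy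
  have h1 : U.φ (β y) ∈ O ∩ c := hO ▸ mem_image_of_mem U.φ hy.2
  exact ⟨hy.1, h1.2⟩

/-- Points over the same arrow that carry a common bisection are related by a local morphism. -/
theorem LocalMorphism.of_carries {U₁ U₂ : Bisubmersion.{v} 𝓑} {u₁ : U₁.carrier} {u₂ : U₂.carrier}
    (h : U₁.φ u₁ = U₂.φ u₂) {c : Set G} (h₁ : U₁.Carries u₁ c) (h₂ : U₂.Carries u₂ c) :
    U₁.LocalMorphism U₂ u₁ u₂ := by
  obtain ⟨β₁, hβ₁, hβ₁0, hβ₁t, hβ₁s⟩ := h₁.exists_section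
  obtain ⟨β₂, hβ₂, hβ₂0, hβ₂t, -⟩ := h₂.exists_section
  rw [← h] at hβ₂ hβ₂0 hβ₂t
  obtain ⟨-, V, τ, -, -, hτ, rfl⟩ := h₁.1
  have key := localMorphism_of_sections hβ₁ hβ₂ (hβ₁t.mono fun y hy => hy.1) hβ₁s (by
    filter_upwards [hβ₁t, hβ₂t] with y hy hy'
    obtain ⟨h1, z, hz, h2⟩ := hy
    obtain ⟨h1', z', hz', h2'⟩ := hy'
    rw [← h2, hτ z hz] at h1
    rw [← h2', hτ z' hz'] at h1'
    rw [← h2, ← h2', h1, h1'])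
  rwa [hβ₁0, hβ₂0] at key

/-- Near a point carrying the identity bisection, `φ` factors through the minimal path holonomy
bisubmersion by a submersion. -/
theorem Carries.exists_submersion {U : Bisubmersion.{v} 𝓑} {u : U.carrier} {x : M}
    (hu : U.φ u = 𝒢.one x) (h : U.Carries u (range 𝒢.one)) {n : ℕ} {α : Fin n → 𝓑.toSubmodule}
    (hα : 𝓑.IsMinimalGenerators x α) {U₀ : Set (EuclideanSpace ℝ (Fin n) × M)} (hU₀ : IsOpen U₀)
    (hx : (0, x) ∈ U₀) :
    ∃ (U' : Set U.carrier) (g : U.carrier → EuclideanSpace ℝ (Fin n) × M),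
      IsOpen U' ∧ u ∈ U' ∧ MapsTo g U' U₀ ∧
      IsSubmersionOn 𝓘(ℝ, U.model) (𝓘(ℝ, EuclideanSpace ℝ (Fin n)).prod 𝓘(ℝ, EM)) g U' ∧
      (∀ w ∈ U', 𝓑.pathHolonomyMap α (g w) = U.φ w) ∧ g u = (0, x) := by
  have : CompleteSpace EM := FiniteDimensional.complete ℝ EM
  obtain ⟨β, hβ, hβ0, hβt, hβs⟩ := h.exists_section
  have hxu : 𝒢.t (U.φ u) = x := by rw [hu, 𝒢.t_one]
  rw [hxu] at hβ hβ0 hβt hβs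
  obtain ⟨g, hg, hg0, hgφ, hgs⟩ := U.isBisubmersion.exists_expAt_factorization hβ
    (hβt.mono fun y hy => hy.1) hβs hα.generatesAt
  rw [hβ0] at hg hg0 hgφ hgs
  have hone : ∀ᶠ y in 𝓝 (g u).2, U.φ (β y) = 𝒢.one y := by
    rw [hg0]
    filter_upwards [hβt] with y hy
    obtain ⟨h1, z, hz⟩ := hy
    rw [← hz, 𝒢.t_one] at h1
    rw [← hz, h1]
  have hg2 : ContinuousAt (fun w => (g w).2) u := continuousAt_snd.comp hg.continuousAt
  obtain ⟨U', hU', hU'o, huU'⟩ := eventually_nhds_iff.1 (hg.and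
    ((hg.eventually_surjective (hgs hα)).and (hgφ.and ((hg2.eventually hone).and
      (hg.continuousAt.eventually (hU₀.mem_nhds (by rwa [hg0])))))))
  refine ⟨U', g, hU'o, huU', fun w hw => (hU' w hw).2.2.2.2,
    ⟨fun w hw => (hU' w hw).1.contMDiffWithinAt, fun w hw => (hU' w hw).2.1⟩, fun w hw => ?_, hg0⟩
  obtain ⟨-, -, h1, h2, -⟩ := hU' w hw
  rw [← h1, h2]
  rfl

end Bisubmersion

end Morphisms

end SingAlg

theorem mainTheorem9
    {EG EM G M : Type*}
    [NormedAddCommGroup EG] [NormedSpace ℝ EG] [FiniteDimensional ℝ EG]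
    [NormedAddCommGroup EM] [NormedSpace ℝ EM] [FiniteDimensional ℝ EM]
    [TopologicalSpace G] [ChartedSpace EG G] [IsManifold 𝓘(ℝ, EG) ∞ G]
    [TopologicalSpace M] [ChartedSpace EM M] [IsManifold 𝓘(ℝ, EM) ∞ M]
    [T2Space M] [SecondCountableTopology M]
    (𝒢 : SingAlg.LieGroupoid EG EM G M) (𝓑 : SingAlg.SingularSubalgebroid 𝒢) :
    -- near a point carrying the identity bisection, a bisubmersion submerses onto the minimal
    -- path holonomy bisubmersion
    (∀ (x : M) (n : ℕ) (α : Fin n → 𝓑.toSubmodule), 𝓑.IsMinimalGenerators x α →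
      ∀ U₀ : Set (EuclideanSpace ℝ (Fin n) × M), 𝓑.IsPathHolonomyDomain x α U₀ →
      ∀ (U : SingAlg.Bisubmersion.{v} 𝓑) (u : U.carrier),
        U.φ u = 𝒢.one x → U.Carries u (Set.range 𝒢.one) →
        ∃ (U' : Set U.carrier) (g : U.carrier → EuclideanSpace ℝ (Fin n) × M),
          IsOpen U' ∧ u ∈ U' ∧ Set.MapsTo g U' U₀ ∧
          SingAlg.IsSubmersionOn 𝓘(ℝ, U.model)
            (𝓘(ℝ, EuclideanSpace ℝ (Fin n)).prod 𝓘(ℝ, EM)) g U' ∧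
          (∀ w ∈ U', 𝓑.pathHolonomyMap α (g w) = U.φ w) ∧
          g u = (0, x)) ∧
    -- points over the same arrow that both carry the identity bisection
    (∀ (U₁ U₂ : SingAlg.Bisubmersion.{v} 𝓑) (u₁ : U₁.carrier) (u₂ : U₂.carrier),
      U₁.φ u₁ = U₂.φ u₂ → U₁.Carries u₁ (Set.range 𝒢.one) → U₂.Carries u₂ (Set.range 𝒢.one) →
      U₁.LocalMorphism U₂ u₁ u₂) ∧
    -- points over the same arrow that carry a common bisection
    (∀ (U₁ U₂ : SingAlg.Bisubmersion.{v} 𝓑) (u₁ : U₁.carrier) (u₂ : U₂.carrier),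
      U₁.φ u₁ = U₂.φ u₂ → (∃ c : Set G, U₁.Carries u₁ c ∧ U₂.Carries u₂ c) →
      U₁.LocalMorphism U₂ u₁ u₂) ∧
    -- morphisms can be inverted locally
    (∀ (U₁ U₂ : SingAlg.Bisubmersion.{v} 𝓑) (u₁ : U₁.carrier) (u₂ : U₂.carrier)
      (g : U₁.carrier → U₂.carrier), U₁.IsMorphismOn U₂ Set.univ g → g u₁ = u₂ →
      U₂.LocalMorphism U₁ u₂ u₁) ∧
    -- local morphisms define an equivalence relation on the points of all bisubmersions
    Equivalence (fun p q : (Σ U : SingAlg.Bisubmersion.{v} 𝓑, U.carrier) =>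
      p.1.LocalMorphism q.1 p.2 q.2) := by
  refine ⟨fun x n α hα U₀ hU₀ U u hu h => h.exists_submersion hu hα hU₀.1 hU₀.2.1,
    fun U₁ U₂ u₁ u₂ h h₁ h₂ => .of_carries h h₁ h₂,
    fun U₁ U₂ u₁ u₂ h ⟨c, h₁, h₂⟩ => .of_carries h h₁ h₂,
    fun U₁ U₂ u₁ u₂ g hg hgu => SingAlg.Bisubmersion.LocalMorphism.symm
      ⟨Set.univ, g, isOpen_univ, Set.mem_univ u₁, hg, hgu⟩,
    fun p => .refl p.1 p.2, fun h => h.symm, fun h h' => h.trans h'⟩
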